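/- **Setting.** Bits are added and multiplied in $GF(2)$. A $(2N+1)$-partite non-signaling system consists of conditional distributions $P_{XYZ|UVW}$, where $x,y,u,v\in\{0,1\}^N$ and Eve's input $w$ and output $z$ have arbitrary ranges, such that for every $i$ the joint distribution of all outputs except $x_i$ does not depend on $u_i$, that of all outputs except $y_i$ does not depend on $v_i$, and that of $(x,y)$ does not depend on $w$. Let $h$ be the binary entropy function (in bits). **Protocol** (parameters $n,k,s\in\mathbb N$ and a statistical tolerance $\eta>0$). Alice and Bob use a $(2(n+k)+1)$-partite non-signaling system with uniformly random inputs $u,v\in\{0,1\}^{n+k}$ and obtain $x,y$. Among the rounds with $u_i=v_i=0$ they select $n$ at random for the raw keys $\mathbf x,\mathbf y\in\{0,1\}^n$ (if there are fewer than $n$ such rounds, they abort). They announce all inputs, the selected rounds, and the outputs of the $k$ remaining (test) rounds. Let $\hat\varepsilon$ be $\eta$ plus the fraction of test rounds with $x_i\oplus y_i\ne u_iv_i$, and $\hat\delta$ be $\eta$ plus the fraction, among the test rounds with input $(0,0)$, of those with $x_i\neq y_i$. They continue iff there is a test round with input $(0,0)$, the fractions of ones among Alice's and among Bob's test outputs are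 both within $\eta$ of $1/2$, $\hat\delta<\frac12$ and $\hat\varepsilon<2^{-h(\hat\delta)-1}-\frac14$; otherwise they abort. Alice chooses a uniformly random $(m+s)\times n$ matrix $A$ over $GF(2)$, $m=\lceil n\,h(\hat\delta)\rceil$, and publishes $A$ and the first $m$ bits of $A\mathbf x$; the last $s$ bits of $A\mathbf x$ are her key $S_A$. Bob replaces $\mathbf y$ by a string $\mathbf y'$ of minimal Hamming distance to $\mathbf y$ among those for which the first $m$ bits of $A\mathbf y'$ agree with the published ones (ties are broken by any rule), and his key $S_B$ consists of the last $s$ bits of $A\mathbf y'$. Eve learns the public transcript $Q$, and may then choose her input $w$ depending on $Q$ and obtains $z$. **Theorem.** For every $\eta>0$ there are an integer $\kappa\ge1$ and real numbers $\sigma,c>0$ such that for all sufficiently large $n$ the protocol with $k=\kappa n$ and key length $s=\lceil\sigma n\rceil$ (thus with the positive key rate $s/(n+k)\ge\sigma/(1+\kappa)$) has the following properties. 1. Whenever the parameter estimation shows $\hat\varepsilon<1/5$ (an approximation of PR boxes with accuracy exceeding $80\%$) and $\hat\delta<1/50$ (a correlation of the outputs on input $(0,0)$ higher than $98\%$), there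 is a test round with input $(0,0)$, and the test outputs are balanced up to $\eta$, the protocol is continued. 2. For every $(2(n+k)+1)$-partite non-signaling system (no other assumption is made on the devices or on Eve) there is an event $\mathcal A$, whose joint distribution with the outcome of the protocol does not depend on Eve's input, with ${\rm Prob}[\mathcal A]\le2^{-cn}$, such that, given that $\mathcal A$ does not occur and the protocol is not aborted, Alice and Bob share a common and perfectly secret key: for each input $w$ of Eve, $S_A=S_B$, and this key is uniform on $\{0,1\}^s$ given every value of $(Q,Z)$. 3. If the system of Alice and Bob consists of $n+k$ independent copies of a box $P_{XY|UV}$ with uniform marginals $X$ and $Y$ for each input, with $\varepsilon+2\eta\le1/5$ and $\delta+2\eta\le1/50$, where $\varepsilon$ is the probability that $X\oplus Y\ne U\cdot V$ for uniform inputs and $\delta$ the probability that $X\neq Y$ on input $(0,0)$, then the protocol is aborted with probability at most $2^{-cn}$. If $\eta\le1/160$, then this holds in particular when Alice and Bob measure singlets $\frac1{\sqrt2}(|01\rangle-|10\rangle)$ in the polarization bases at angles $90^\circ$ and $60^\circ$ (Alice, inputs $0$ and $1$) and $0^\circ$ and $30^\circ$ (Bob, inputs $0$ and $1$). -/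

import Mathlib

open scoped ENNReal Matrix

/-! ### Bits and non-signaling systems -/

/-- A bit, i.e. an element of `GF(2)`: `x + y` is the XOR and `u * v` the AND of two bits. -/
abbrev Bit : Type := ZMod 2

/-- Bit strings of length `N`. -/
abbrev BitStr (N : ℕ) : Type := Fin N → Bit

/-- A `(2N+1)`-partite non-signaling system `P_{XYZ|UVW}`. Alice and Bob hold `N` interfaces each,
every one with a one-bit input and a one-bit output; Eve has a single interface, with input and
output ranging over arbitrary types `W` and `Z`. For all inputs `u, v, w`, `law u v w` is the joint
distribution of the outputs `(x, y, z)`. No interface can signal to the other ones. -/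
structure NSBox (N : ℕ) (W Z : Type*) where
  law : BitStr N → BitStr N → W → PMF (BitStr N × BitStr N × Z)
  /-- Alice's `i`-th input does not influence all the other outputs. -/
  ns_alice : ∀ (i : Fin N) (b : Bit) (u v : BitStr N) (w : W) (x y : BitStr N) (z : Z),
    ∑ a : Bit, law u v w (Function.update x i a, y, z) =
      ∑ a : Bit, law (Function.update u i b) v w (Function.update x i a, y, z)
  /-- Bob's `i`-th input does not influence all the other outputs. -/
  ns_bob : ∀ (i : Fin N) (b : Bit) (u v : BitStr N) (w : W) (x y : BitStr N) (z : Z),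
    ∑ a : Bit, law u v w (x, Function.update y i a, z) =
      ∑ a : Bit, law u (Function.update v i b) w (x, Function.update y i a, z)
  /-- Eve's input does not influence the outputs of Alice and Bob. -/
  ns_eve : ∀ (u v : BitStr N) (w w' : W) (x y : BitStr N),
    ∑' z : Z, law u v w (x, y, z) = ∑' z : Z, law u v w' (x, y, z)

/-! ### Parameter estimation -/

/-- The binary entropy function, in bits. -/
noncomputable def binEntropyBits (p : ℝ) : ℝ := Real.binEntropy p / Real.log 2

/-- What Alice and Bob announce publicly before information reconciliation: all inputs `u, v`, the
rounds `raw` selected (in this order) for the raw key, and their outputs `x, y` in the remaining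
rounds (the entries of `x`, `y` at the selected rounds are blanked out, see `announce`). -/
structure Announcement (N n : ℕ) where
  u : BitStr N
  v : BitStr N
  raw : Fin n ↪ Fin N
  x : BitStr N
  y : BitStr N

/-- The announcement for inputs `u, v`, outputs `x, y` and selected rounds `raw`. -/
def announce {N n : ℕ} (u v : BitStr N) (raw : Fin n ↪ Fin N) (x y : BitStr N) :
    Announcement N n where
  u := u
  v := v
  raw := raw
  x := fun i => if i ∈ Finset.univ.map raw then 0 else x i
  y := fun i => if i ∈ Finset.univ.map raw then 0 else y i

namespace Announcement

variable {N n : ℕ}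

/-- The rounds not used for the raw key. -/
def testRounds (a : Announcement N n) : Finset (Fin N) := (Finset.univ.map a.raw)ᶜ

/-- The test rounds in which both inputs were `0`. -/
def zeroTestRounds (a : Announcement N n) : Finset (Fin N) :=
  a.testRounds.filter fun i => a.u i = 0 ∧ a.v i = 0

/-- The measured `ε`: the fraction of test rounds that violate the CHSH condition
`x ⊕ y = u · v`. -/
noncomputable def chshErrorRate (a : Announcement N n) : ℝ :=
  ((a.testRounds.filter fun i => a.x i + a.y i ≠ a.u i * a.v i).card : ℝ) / (a.testRounds.card : ℝ)

/-- The measured `δ`: the fraction of the test rounds with input `(0,0)` in which the two outputs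
differ. -/
noncomputable def keyErrorRate (a : Announcement N n) : ℝ :=
  ((a.zeroTestRounds.filter fun i => a.x i ≠ a.y i).card : ℝ) / (a.zeroTestRounds.card : ℝ)

/-- Both for Alice and for Bob, the fraction of ones among the test outputs is `1/2` up to `η`. -/
def Balanced (η : ℝ) (a : Announcement N n) : Prop :=
  |((a.testRounds.filter fun i => a.x i = 1).card : ℝ) / (a.testRounds.card : ℝ) - 1 / 2| ≤ η ∧
  |((a.testRounds.filter fun i => a.y i = 1).card : ℝ) / (a.testRounds.card : ℝ) - 1 / 2| ≤ η

/-- The estimate of `ε` (the upper end of the confidence interval of half-width `η`). -/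
noncomputable def epsEst (η : ℝ) (a : Announcement N n) : ℝ := a.chshErrorRate + η

/-- The estimate of `δ` (the upper end of the confidence interval of half-width `η`). -/
noncomputable def deltaEst (η : ℝ) (a : Announcement N n) : ℝ := a.keyErrorRate + η

/-- Alice and Bob continue: `δ` could be estimated at all, the output bits are balanced, and the
estimated `ε` and `δ` lie in the region in which key agreement is possible. -/
def Accepted (η : ℝ) (a : Announcement N n) : Prop :=
  a.zeroTestRounds.Nonempty ∧ a.Balanced η ∧ a.deltaEst η < 1 / 2 ∧
    a.epsEst η < (2 : ℝ) ^ (-binEntropyBits (a.deltaEst η) - 1) - 1 / 4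

/-- The number `m = ⌈n h(δ)⌉` of bits sent for information reconciliation. -/
noncomputable def syndromeLength (η : ℝ) (a : Announcement N n) : ℕ :=
  ⌈(n : ℝ) * binEntropyBits (a.deltaEst η)⌉₊

end Announcement

/-! ### The protocol -/

/-- Bob's error correction with an arbitrary rule for breaking ties: from the check matrix `H`, the
syndrome `H x` of Alice's raw key `x` and his own raw key `y` he computes a string that has the same
syndrome as `x` and, among all such strings, minimal Hamming distance to `y`. -/
structure MinDistDecoder (n : ℕ) where
  decode : ∀ m : ℕ, Matrix (Fin m) (Fin n) Bit → BitStr m → BitStr n → BitStr n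
  syndrome_decode : ∀ (m : ℕ) (H : Matrix (Fin m) (Fin n) Bit) (x y : BitStr n),
    H *ᵥ decode m H (H *ᵥ x) y = H *ᵥ x
  dist_decode_le : ∀ (m : ℕ) (H : Matrix (Fin m) (Fin n) Bit) (x y : BitStr n),
    hammingDist y (decode m H (H *ᵥ x) y) ≤ hammingDist y x

/-- The outcome of a run of the protocol. In the first two cases it is aborted. In the last case
`a`, `A` and `r` (the announcement, the matrix and the syndrome) are public, and `sA`, `sB` are the
keys output by Alice and Bob. -/
inductive Outcome (N n s : ℕ) (η : ℝ) : Type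
  | tooFewZeroRounds (u v : BitStr N)
  | abort (a : Announcement N n)
  | key (a : Announcement N n) (A : Matrix (Fin (a.syndromeLength η) ⊕ Fin s) (Fin n) Bit)
      (r : BitStr (a.syndromeLength η)) (sA sB : BitStr s)

/-- Whether a run ends with keys, i.e. is not aborted. -/
def Outcome.isKey {N n s : ℕ} {η : ℝ} : Outcome N n s η → Bool
  | tooFewZeroRounds _ _ => false
  | abort _ => false
  | key _ _ _ _ _ => true

open Classical in
/-- The real system: the joint distribution of the outcome of the protocol and of Eve's output when
Eve's input is `w`. Alice and Bob choose all `N` inputs uniformly at random and obtain outputs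
`x, y`. Among the rounds with input `(0,0)` they select `n` at random for the raw key; they announce
the rest and check the estimated parameters. Alice picks a uniformly random matrix `A` over `GF(2)`
with `m + s` rows and applies it to her raw key; the first `m` bits go to Bob over the public
channel and the other `s` bits are her key. Bob's key is obtained in the same way from his
decoded string. -/
noncomputable def protocolRun {N n s : ℕ} {W Z : Type*} (η : ℝ) (D : MinDistDecoder n)
    (P : NSBox N W Z) (w : W) : PMF (Outcome N n s η × Z) :=
  (PMF.uniformOfFintype (BitStr N × BitStr N)).bind fun uv =>
    (P.law uv.1 uv.2 w).bind fun xyz =>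
      if h : (Finset.univ.filter fun e : Fin n ↪ Fin N =>
          ∀ j, uv.1 (e j) = 0 ∧ uv.2 (e j) = 0).Nonempty then
        (PMF.uniformOfFinset _ h).bind fun e =>
          let a := announce uv.1 uv.2 e xyz.1 xyz.2.1
          if a.Accepted η then
            (PMF.uniformOfFintype
                (Matrix (Fin (a.syndromeLength η) ⊕ Fin s) (Fin n) Bit)).bind fun A =>
              let x : BitStr n := fun j => xyz.1 (e j)
              let y : BitStr n := fun j => xyz.2.1 (e j)
              let r := A.toRows₁ *ᵥ x
              PMF.pure (Outcome.key a A r (A.toRows₂ *ᵥ x)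
                (A.toRows₂ *ᵥ D.decode _ A.toRows₁ r y), xyz.2.2)
          else PMF.pure (Outcome.abort a, xyz.2.2)
      else PMF.pure (Outcome.tooFewZeroRounds uv.1 uv.2, xyz.2.2)

/-! ### Security -/

/-- There is an event `𝒜` of probability at most `p` such that, given that `𝒜` does not occur and
the protocol is not aborted, Alice and Bob share a common perfectly secret key. The event is an
additional output bit of the system (`true` means that `𝒜` occurs), which `ext` extends the real
system `run` by. -/
def SecureExcept {N n s : ℕ} {η : ℝ} {W Z : Type*} (run : W → PMF (Outcome N n s η × Z))
    (p : ℝ≥0∞) : Prop :=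
  ∃ ext : W → PMF (Outcome N n s η × Z × Bool),
    -- forgetting the event gives the real system
    (∀ w, (ext w).map (fun o => (o.1, o.2.1)) = run w) ∧
    -- the outcome of the protocol, together with the event, does not depend on Eve's input
    (∀ w w', (ext w).map (fun o => (o.1, o.2.2)) = (ext w').map (fun o => (o.1, o.2.2))) ∧
    (∀ w, (ext w).map (fun o => o.2.2) true ≤ p) ∧
    -- outside of the event, for each public transcript `(a, A, r)`, each input `w` of Eve (which
    -- may thus be chosen depending on the transcript) and each output `z` of Eve, both keys agree
    -- and their common value is uniform
    (∀ w z a A r sA sB,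
      ext w (Outcome.key a A r sA sB, z, false) =
        if sA = sB then
          (∑ tA : BitStr s, ∑ tB : BitStr s, ext w (Outcome.key a A r tA tB, z, false)) / 2 ^ s
        else 0)

/-! ### Honest devices -/

/-- A single bipartite system with one-bit inputs and outputs: `B u v` is the distribution of
`(x, y)` on inputs `u, v`. -/
abbrev SingleBox : Type := Bit → Bit → PMF (Bit × Bit)

/-- The probability `ε` of violating the CHSH condition for uniform inputs. -/
noncomputable def SingleBox.chshError (B : SingleBox) : ℝ :=
  1 / 4 * ∑ u : Bit, ∑ v : Bit, ∑ x : Bit, ∑ y : Bit,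
    if x + y ≠ u * v then (B u v (x, y)).toReal else 0

/-- The probability `δ` that the outputs differ on input `(0,0)`. -/
noncomputable def SingleBox.keyError (B : SingleBox) : ℝ :=
  ∑ x : Bit, ∑ y : Bit, if x ≠ y then (B 0 0 (x, y)).toReal else 0

/-- On every input, each of the two outputs is a uniform bit. -/
def SingleBox.Unbiased (B : SingleBox) : Prop :=
  ∀ u v b : Bit, ∑ y : Bit, B u v (b, y) = 1 / 2 ∧ ∑ x : Bit, B u v (x, b) = 1 / 2

/-- The system of Alice and Bob consists of `N` independent copies of `B`. -/
def NSBox.IsIID {N : ℕ} {W Z : Type*} (P : NSBox N W Z) (B : SingleBox) : Prop :=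
  ∀ u v w x y, ∑' z : Z, P.law u v w (x, y, z) = ∏ i, B (u i) (v i) (x i, y i)

/-- The singlet state `(|01⟩ - |10⟩) / √2`. -/
noncomputable def singletState : Fin 2 → Fin 2 → ℂ :=
  ![![0, 1 / (Real.sqrt 2 : ℂ)], ![-(1 / (Real.sqrt 2 : ℂ)), 0]]

/-- The basis of polarizations at angles `θ` (outcome `0`) and `θ + π/2` (outcome `1`). -/
noncomputable def polarization (θ : ℝ) (b : Bit) : Fin 2 → ℂ :=
  if b = 0 then ![(Real.cos θ : ℂ), (Real.sin θ : ℂ)]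
  else ![-(Real.sin θ : ℂ), (Real.cos θ : ℂ)]

/-- Alice's bases `U₀`, `U₁` are at angles `90°`, `60°`. -/
noncomputable def aliceAngle (u : Bit) : ℝ := if u = 0 then Real.pi / 2 else Real.pi / 3

/-- Bob's bases `V₀`, `V₁` are at angles `0°`, `30°`. -/
noncomputable def bobAngle (v : Bit) : ℝ := if v = 0 then 0 else Real.pi / 6

/-- The probability of the outcomes `x, y` when the two halves of a singlet are measured in the
bases `u, v` (Born rule). -/
noncomputable def singletProb (u v x y : Bit) : ℝ :=
  ‖∑ i, ∑ j, star (polarization (aliceAngle u) x i) * star (polarization (bobAngle v) y j) *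
    singletState i j‖ ^ 2

theorem sum_singletProb (u v : Bit) : ∑ x : Bit, ∑ y : Bit, singletProb u v x y = 1 := by
  have key : ∀ t : ℝ, ‖(t : ℂ) * (1 / (Real.sqrt 2 : ℂ))‖ ^ 2 = t ^ 2 / 2 := by
    intro t
    rw [norm_mul, mul_pow, norm_div, div_pow, Complex.norm_real, Complex.norm_real]
    simp [Real.sq_sqrt, div_eq_mul_inv]
  have hprob : ∀ x y : Bit, singletProb u v x y =
      ‖((((if x = 0 then Real.cos (aliceAngle u) else -Real.sin (aliceAngle u)) *
          (if y = 0 then Real.sin (bobAngle v) else Real.cos (bobAngle v)) -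
        (if x = 0 then Real.sin (aliceAngle u) else Real.cos (aliceAngle u)) *
          (if y = 0 then Real.cos (bobAngle v) else -Real.sin (bobAngle v)) : ℝ)) : ℂ) *
        (1 / (Real.sqrt 2 : ℂ))‖ ^ 2 := by
    intro x y
    unfold singletProb
    congr 2
    by_cases hx : x = 0 <;> by_cases hy : y = 0 <;>
      simp [polarization, singletState, hx, hy, Fin.sum_univ_two, -Complex.ofReal_cos,
        -Complex.ofReal_sin, Complex.conj_ofReal] <;> ring
  have h10 : (1 : Bit) ≠ 0 := by decide
  have hsum : ∀ f : Bit → ℝ, ∑ b : Bit, f b = f 0 + f 1 := fun f => Fin.sum_univ_two f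
  simp only [hprob, key, hsum, if_true, if_neg h10]
  have h1 := Real.sin_sq_add_cos_sq (aliceAngle u)
  have h2 := Real.sin_sq_add_cos_sq (bobAngle v)
  generalize Real.sin (aliceAngle u) = p at *
  generalize Real.cos (aliceAngle u) = q at *
  generalize Real.sin (bobAngle v) = r at *
  generalize Real.cos (bobAngle v) = t at *
  have h3 : (p ^ 2 + q ^ 2) * (r ^ 2 + t ^ 2) = 1 := by rw [h1, h2, one_mul]
  linear_combination h3

/-- The box obtained by measuring a singlet. -/
noncomputable def singletBox : SingleBox := fun u v =>
  PMF.ofFintype (fun xy => ENNReal.ofReal (singletProb u v xy.1 xy.2)) (by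
    rw [← ENNReal.ofReal_sum_of_nonneg (fun xy _ => by unfold singletProb; positivity),
      Fintype.sum_prod_type, sum_singletProb, ENNReal.ofReal_one])

/-!
The keys are secret because non-signaling limits how far the parities of Alice's raw key can be
biased, even given everything that Eve learns.

For fixed transcript, input and output of Eve, the weights of Alice's and Bob's inputs and outputs
form an unnormalized non-signaling system. In a single round the chained Bell inequality
(`dominates_bias`) bounds the bias of Alice's output on input `0` by the sum, over the four pairs
of inputs, of the weights of violating the CHSH condition. Such a bound between linear functionals
on non-signaling systems is inherited by products (`abs_sum_prod_mul_le`), so the bias of a parity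
of several outputs is bounded by the weight of violations occurring in all rounds involved. The
bounds for all parities of the raw key add up to a multiple of `∏ (1 + 4 V)`, with `V` the
indicators of violations in the raw rounds. By the XOR lemma (`sum_sub_pow_mul_sum_le`) the
deviation of the key from uniform is bounded by parities that are random combinations of the rows
of the matrix, and averaging over the matrix gives about `2 ^ (m + s - n) · ∏ (1 + 4 V)`
(`sum_secrecyLoss_le`). This bound is a functional of the inputs and outputs of Alice and Bob
alone, so its value does not depend on Eve's choices, and it can be estimated for each value of
these inputs and outputs, without any assumption of independence.

The only randomness left is then the selection of the raw rounds. The `n` raw rounds are few among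
all rounds, so the measured error rate can hardly be below the overall rate `K / N` of violations
(`violation_rate_le_epsEst`), while sampling without replacement gives the product a mean of at
most `(1 + 4 K / N) ^ n` (`sum_embeddings_prod_le`). As the protocol only continues if `1 + 4 ε <
2 ^ (1 - h)` for the estimated `ε` and `h = h(δ)`, and the estimates exceed the measured rates by
`η`, the loss is exponentially small for keys of a small positive rate
(`sum_secrecyLoss_le_of_manyZeroRounds`). Similarly, `m = ⌈n h(δ)⌉` syndrome bits single out
Alice's string in the Hamming ball around Bob's string whose radius is their distance
(`sum_keyProb_ne_le`); here it matters that accepted `δ` stay away from `1/2`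
(`exists_log_deltaEst_le`).

The failure event is constructed in `secureExcept_of_bound`. For each transcript and output of
Eve, the mass of the least likely value of the common key is kept for each value, and the rest
goes to the event; the kept part is then scaled down to its total for Eve's worst input, which
makes the probability of the event independent of that input.

For independent honest devices, Chernoff's bound (`chernoff_bound`) makes all counts typical, and
typical counts are accepted (`Typical.accepted`). The singlets have `ε = 3/16` and `δ = 0`.
-/

/-! ### Bits and real-valued sums -/

theorem bit_cases : ∀ b : Bit, b = 0 ∨ b = 1 := by decide

theorem sum_bit {M : Type*} [AddCommMonoid M] (f : Bit → M) : ∑ b, f b = f 0 + f 1 :=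
  Fin.sum_univ_two f

/-! ### Sampling without replacement -/

open Finset in
/-- Sending `(e, t)` to `(e j, swap (e j) t ∘ e)` is injective, which shows that, among the
embeddings into `Z`, the event `e j ∈ K` is not positively correlated with `e i ∈ K` for all
`i ∈ S`. -/
theorem card_embeddings_insert_mul_le {ι α : Type*} [Fintype ι] [DecidableEq ι] [Fintype α]
    [DecidableEq α] {K Z : Finset α} {S : Finset ι} {j : ι} (hj : j ∉ S) :
    #{e : ι ↪ α | (∀ i, e i ∈ Z) ∧ ∀ i ∈ insert j S, e i ∈ K} * #Z ≤
      #K * #{e : ι ↪ α | (∀ i, e i ∈ Z) ∧ ∀ i ∈ S, e i ∈ K} := by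
  rw [← card_product, ← card_product]
  refine card_le_card_of_injOn
    (fun p => (p.1 j, p.1.trans (Equiv.swap (p.1 j) p.2).toEmbedding)) ?_ ?_
  · rintro ⟨e, t⟩ h
    simp only [coe_product, Set.mem_prod, mem_coe, mem_filter, mem_univ, true_and,
      mem_insert, forall_eq_or_imp] at h ⊢
    obtain ⟨⟨hZ, hjK, hS⟩, ht⟩ := h
    refine ⟨hjK, fun i => ?_, fun i hi => ?_⟩
    · simp only [Function.Embedding.trans_apply, Equiv.coe_toEmbedding, Equiv.swap_apply_def]
      split_ifs
      exacts [ht, hZ j, hZ i]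
    · have hij : e i ≠ e j := fun h => hj (e.injective h ▸ hi)
      simp only [Function.Embedding.trans_apply, Equiv.coe_toEmbedding, Equiv.swap_apply_def,
        hij, if_false]
      split_ifs
      exacts [hjK, hS i hi]
  · rintro ⟨e, t⟩ _ ⟨e', t'⟩ _ h
    simp only [Prod.mk.injEq] at h
    obtain ⟨h1, h2⟩ := h
    have h3 : t = t' := by
      have := DFunLike.congr_fun h2 j
      simpa using this
    subst h3
    refine Prod.ext (DFunLike.ext _ _ fun i => ?_) rfl
    have := DFunLike.congr_fun h2 i
    simpa [h1] using this

open Finset in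
theorem card_embeddings_mul_pow_le {ι α : Type*} [Fintype ι] [DecidableEq ι] [Fintype α]
    [DecidableEq α] {K Z : Finset α} (S : Finset ι) :
    #{e : ι ↪ α | (∀ i, e i ∈ Z) ∧ ∀ i ∈ S, e i ∈ K} * #Z ^ #S ≤
      #K ^ #S * #{e : ι ↪ α | ∀ i, e i ∈ Z} := by
  induction S using Finset.induction_on with
  | empty => simp
  | insert j S hj ih =>
    rw [card_insert_of_notMem hj, pow_succ', pow_succ', ← mul_assoc]
    calc _ ≤ #K * #{e : ι ↪ α | (∀ i, e i ∈ Z) ∧ ∀ i ∈ S, e i ∈ K} * #Z ^ #S :=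
          Nat.mul_le_mul_right _ (card_embeddings_insert_mul_le hj)
      _ ≤ _ := by rw [mul_assoc, mul_assoc]; exact Nat.mul_le_mul_left _ ih

open Finset in
/-- Hoeffding's comparison of sampling without and with replacement, for exponential moments: if a
random embedding `e` into `Z` hits the subset `K` in `V` points, the mean of `(1 + μ) ^ V` is at
most what it would be for independent samples. -/
theorem sum_embeddings_prod_le {ι α : Type*} [Fintype ι] [DecidableEq ι] [Fintype α]
    [DecidableEq α] {K Z : Finset α} (hZ : Z.Nonempty) {μ : ℝ} (hμ : 0 ≤ μ) :
    ∑ e : ι ↪ α with ∀ i, e i ∈ Z, ∏ i, (1 + if e i ∈ K then μ else 0) ≤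
      #{e : ι ↪ α | ∀ i, e i ∈ Z} * (1 + μ * (#K / #Z)) ^ Fintype.card ι := by
  have hZ' : (0 : ℝ) < #Z := by exact_mod_cast hZ.card_pos
  have hpow : (1 + μ * ((#K : ℝ) / #Z)) ^ Fintype.card ι =
      ∑ S : Finset ι, (μ * ((#K : ℝ) / #Z)) ^ #S := by
    rw [← card_univ, ← prod_const, prod_one_add, powerset_univ]
    simp
  simp_rw [prod_one_add, powerset_univ]
  rw [sum_comm, hpow, mul_sum]
  refine sum_le_sum fun S _ => ?_
  have h1 : ∀ e : ι ↪ α, (∏ i ∈ S, if e i ∈ K then μ else 0) =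
      if ∀ i ∈ S, e i ∈ K then μ ^ #S else 0 := by
    intro e
    rw [prod_ite_zero, prod_const]
    split_ifs <;> rfl
  simp_rw [h1]
  rw [← sum_filter, filter_filter, sum_const, nsmul_eq_mul, mul_pow, div_pow]
  have h2 : (#{e : ι ↪ α | (∀ i, e i ∈ Z) ∧ ∀ i ∈ S, e i ∈ K} : ℝ) * (#Z : ℝ) ^ #S ≤
      (#K : ℝ) ^ #S * #{e : ι ↪ α | ∀ i, e i ∈ Z} := by
    exact_mod_cast card_embeddings_mul_pow_le S
  have h3 : (#{e : ι ↪ α | (∀ i, e i ∈ Z) ∧ ∀ i ∈ S, e i ∈ K} : ℝ) ≤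
      (#K : ℝ) ^ #S * #{e : ι ↪ α | ∀ i, e i ∈ Z} / (#Z : ℝ) ^ #S := by
    rwa [le_div_iff₀ (by positivity)]
  calc _ ≤ (#K : ℝ) ^ #S * #{e : ι ↪ α | ∀ i, e i ∈ Z} / (#Z : ℝ) ^ #S * μ ^ #S := by gcongr
    _ = _ := by ring

open Finset in
/-- There are at least `(|Z| - n) ^ n` ways to select `n` elements of `Z` in order. -/
theorem sub_pow_le_card_embeddings {α : Type*} [Fintype α] [DecidableEq α] (Z : Finset α) (n : ℕ) :
    (#Z - n) ^ n ≤ #{e : Fin n ↪ α | ∀ i, e i ∈ Z} := by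
  have h1 : Fintype.card (Fin n ↪ Z) ≤ #{e : Fin n ↪ α | ∀ i, e i ∈ Z} := by
    rw [← card_univ]
    refine card_le_card_of_injOn (fun e => e.trans (Function.Embedding.subtype _)) ?_ ?_
    · intro e _
      simp
    · intro e _ e' _ h
      ext i
      exact DFunLike.congr_fun h i
  refine le_trans ?_ h1
  rw [Fintype.card_embedding_eq, Fintype.card_coe, Fintype.card_fin]
  exact le_trans (Nat.pow_le_pow_left (by omega) n) (Nat.pow_sub_le_descFactorial _ _)

/-! ### Exponential moments -/

theorem one_add_mul_exp_sub_one_le {p l : ℝ} (hp0 : 0 ≤ p) (hp1 : p ≤ 1) (hl : |l| ≤ 1) :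
    1 + p * (Real.exp l - 1) ≤ Real.exp (l * p + l ^ 2) := by
  have h1 := (abs_le.1 (Real.abs_exp_sub_one_sub_id_le hl)).2
  have h2 := Real.add_one_le_exp (l * p + l ^ 2)
  nlinarith [mul_le_mul_of_nonneg_left h1 hp0, mul_le_mul_of_nonneg_right hp1 (sq_nonneg l)]

open Finset in
/-- Chernoff's bound: among `N` independent samples with weights `q`, the number of samples in `G`
exceeds its mean by `γ N` with exponentially small probability. -/
theorem chernoff_bound {C : Type*} [Fintype C] [DecidableEq C] (q : C → ℝ) (hq : ∀ c, 0 ≤ q c)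
    (hq1 : ∑ c, q c = 1) (G : C → Prop) [DecidablePred G] {p γ : ℝ}
    (hp : ∑ c with G c, q c ≤ p) (hγ0 : 0 ≤ γ) (hγ1 : γ ≤ 1) (N : ℕ) :
    ∑ c : Fin N → C, (if (p + γ) * N ≤ #{i | G (c i)} then ∏ i, q (c i) else 0) ≤
      Real.exp (-(γ ^ 2 / 4) * N) := by
  -- the exponent that minimizes `l ^ 2 - l γ`
  set l := γ / 2 with hl
  have hl0 : 0 ≤ l := by positivity
  have hl1 : |l| ≤ 1 := by rw [abs_of_nonneg hl0]; linarith
  set p' := ∑ c with G c, q c with hp'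
  have hp0 : 0 ≤ p' := sum_nonneg fun c _ => hq c
  have hp1 : p' ≤ 1 := by
    rw [← hq1]
    exact sum_le_sum_of_subset_of_nonneg (subset_univ _) fun c _ _ => hq c
  have hmean : ∑ c, q c * (1 + if G c then Real.exp l - 1 else 0) =
      1 + p' * (Real.exp l - 1) := by
    simp_rw [mul_add, mul_one, sum_add_distrib, hq1, mul_ite, mul_zero]
    rw [← sum_filter, sum_mul]
  have hcount : ∀ c : Fin N → C,
      ∏ i, (1 + if G (c i) then Real.exp l - 1 else 0) = Real.exp (l * #{i | G (c i)}) := by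
    intro c
    have : ∀ i, (1 + if G (c i) then Real.exp l - 1 else 0) =
        Real.exp (l * if G (c i) then 1 else 0) := by
      intro i; split_ifs <;> simp
    simp_rw [this]
    rw [← Real.exp_sum, ← mul_sum]
    simp
  calc _ ≤ ∑ c : Fin N → C, (∏ i, q (c i)) *
        (Real.exp (l * #{i | G (c i)}) * Real.exp (-(l * ((p + γ) * N)))) := by
        refine sum_le_sum fun c _ => ?_
        have h0 : 0 ≤ ∏ i, q (c i) := prod_nonneg fun i _ => hq _
        split_ifs with h
        · refine le_mul_of_one_le_right h0 ?_
          rw [← Real.exp_add]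
          exact Real.one_le_exp (by nlinarith)
        · positivity
    _ = (1 + p' * (Real.exp l - 1)) ^ N * Real.exp (-(l * ((p + γ) * N))) := by
        simp_rw [← mul_assoc, ← hcount, ← prod_mul_distrib]
        rw [← sum_mul, ← hmean, sum_pow']
        simp
    _ ≤ (Real.exp (l * p' + l ^ 2)) ^ N * Real.exp (-(l * ((p + γ) * N))) := by
        gcongr
        · have := Real.one_le_exp hl0
          nlinarith [mul_nonneg hp0 (sub_nonneg.2 this)]
        · exact one_add_mul_exp_sub_one_le hp0 hp1 hl1
    _ ≤ _ := by
        rw [← Real.exp_nat_mul, ← Real.exp_add]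
        refine Real.exp_le_exp.2 ?_
        have : l * p' ≤ l * p := mul_le_mul_of_nonneg_left hp hl0
        have hN : (0 : ℝ) ≤ N := N.cast_nonneg
        have h1 := mul_le_mul_of_nonneg_left this hN
        have h2 : γ = 2 * l := by rw [hl]; ring
        rw [h2]
        nlinarith

/-! ### Hamming balls -/

open Finset in
/-- The number of bit strings within distance `d` of `y`, bounded by the generating function of the
distance. -/
theorem card_hammingBall_mul_pow_le {n : ℕ} (y : BitStr n) (d : ℕ) {t : ℝ} (ht0 : 0 ≤ t)
    (ht1 : t ≤ 1) :
    (#{x : BitStr n | hammingDist y x ≤ d} : ℝ) * t ^ d ≤ (1 + t) ^ n := by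
  have hgen : ∑ x : BitStr n, t ^ hammingDist y x = (1 + t) ^ n := by
    have h1 : ∀ x : BitStr n, t ^ hammingDist y x = ∏ i, if y i ≠ x i then t else 1 := by
      intro x
      rw [← prod_filter, prod_const, hammingDist]
    have h2 : ∀ b : Bit, ∑ c : Bit, (if b ≠ c then t else 1) = 1 + t := by
      intro b
      rw [sum_bit]
      rcases bit_cases b with rfl | rfl
      · simp
      · simp [add_comm]
    simp_rw [h1]
    rw [← Fintype.prod_sum (fun i (c : Bit) => if y i ≠ c then t else 1)]
    simp_rw [h2]
    simp
  rw [← hgen, ← nsmul_eq_mul, ← sum_const]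
  calc _ ≤ ∑ x : BitStr n with hammingDist y x ≤ d, t ^ hammingDist y x :=
        sum_le_sum fun x hx => pow_le_pow_of_le_one ht0 ht1 (mem_filter.1 hx).2
    _ ≤ _ := sum_le_sum_of_subset_of_nonneg (subset_univ _) fun x _ _ => by positivity

/-! ### Bounding products of functionals on non-signaling systems -/

/-- The inputs and outputs `(u, v, x, y)` of Alice and Bob in a single round. -/
abbrev Round : Type := Bit × Bit × Bit × Bit

/-- A function of `(u, v, x, y)` whose sums over `x` do not depend on `u`, and whose sums over `y`
do not depend on `v`: an unnormalized bipartite non-signaling system. -/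
structure RoundNS (g : Round → ℝ) : Prop where
  alice : ∀ u u' v y, ∑ x, g (u, v, x, y) = ∑ x, g (u', v, x, y)
  bob : ∀ u v v' x, ∑ y, g (u, v, x, y) = ∑ y, g (u, v', x, y)

theorem RoundNS.add {g h : Round → ℝ} (hg : RoundNS g) (hh : RoundNS h) :
    RoundNS fun r => g r + h r where
  alice u u' v y := by simp only [Finset.sum_add_distrib, hg.alice u u', hh.alice u u']
  bob u v v' x := by simp only [Finset.sum_add_distrib, hg.bob u v v', hh.bob u v v']

theorem RoundNS.sub {g h : Round → ℝ} (hg : RoundNS g) (hh : RoundNS h) :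
    RoundNS fun r => g r - h r where
  alice u u' v y := by simp only [Finset.sum_sub_distrib, hg.alice u u', hh.alice u u']
  bob u v v' x := by simp only [Finset.sum_sub_distrib, hg.bob u v v', hh.bob u v v']

theorem RoundNS.sum_mul {ι : Type*} {s : Finset ι} {a : ι → ℝ} {g : ι → Round → ℝ}
    (hg : ∀ i, RoundNS (g i)) : RoundNS fun r => ∑ i ∈ s, a i * g i r where
  alice u u' v y := by
    rw [Finset.sum_comm, Finset.sum_comm (s := Finset.univ)]
    simp only [← Finset.mul_sum, (hg _).alice u u']
  bob u v v' x := by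
    rw [Finset.sum_comm, Finset.sum_comm (s := Finset.univ)]
    simp only [← Finset.mul_sum, (hg _).bob u v v']

/-- The functional with coefficients `ψ` dominates the one with coefficients `φ` on all nonnegative
bipartite non-signaling systems. -/
def Dominates (ψ φ : Round → ℝ) : Prop :=
  ∀ g : Round → ℝ, (∀ r, 0 ≤ g r) → RoundNS g → |∑ r, φ r * g r| ≤ ∑ r, ψ r * g r

/-- A function of the inputs and outputs in all rounds that is non-signaling in each round. -/
def RoundsNS {N : ℕ} (F : (Fin N → Round) → ℝ) : Prop :=
  ∀ i c, RoundNS fun r => F (Function.update c i r)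

theorem RoundsNS.add {N : ℕ} {F G : (Fin N → Round) → ℝ} (hF : RoundsNS F) (hG : RoundsNS G) :
    RoundsNS fun c => F c + G c := fun i c => (hF i c).add (hG i c)

theorem RoundsNS.sub {N : ℕ} {F G : (Fin N → Round) → ℝ} (hF : RoundsNS F) (hG : RoundsNS G) :
    RoundsNS fun c => F c - G c := fun i c => (hF i c).sub (hG i c)

theorem RoundsNS.sum_cons {N : ℕ} {F : (Fin (N + 1) → Round) → ℝ} (hF : RoundsNS F)
    (φ : Round → ℝ) : RoundsNS fun c : Fin N → Round => ∑ r, φ r * F (Fin.cons r c) := by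
  intro i c
  refine RoundNS.sum_mul fun r => ?_
  simpa only [Fin.cons_update] using hF i.succ (Fin.cons r c)

theorem RoundsNS.head {N : ℕ} {F : (Fin (N + 1) → Round) → ℝ} (hF : RoundsNS F)
    (c : Fin N → Round) : RoundNS fun r => F (Fin.cons r c) := by
  simpa only [Fin.update_cons_zero] using hF 0 (Fin.cons 0 c)

theorem sum_cons_prod {N : ℕ} (φ : Fin (N + 1) → Round → ℝ) (F : (Fin (N + 1) → Round) → ℝ) :
    ∑ c, (∏ i, φ i (c i)) * F c =
      ∑ c : Fin N → Round, (∏ i, φ i.succ (c i)) * ∑ r, φ 0 r * F (Fin.cons r c) := by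
  rw [← (Fin.consEquiv fun _ : Fin (N + 1) => Round).sum_comp, Fintype.sum_prod_type,
    Finset.sum_comm]
  refine Finset.sum_congr rfl fun c _ => ?_
  rw [Finset.mul_sum]
  refine Finset.sum_congr rfl fun r _ => ?_
  have h : Fin.consEquiv (fun _ : Fin (N + 1) => Round) (r, c) = Fin.cons r c := rfl
  simp only [h, Fin.prod_univ_succ, Fin.cons_zero, Fin.cons_succ]
  ring

/-- Domination of functionals is inherited by tensor products. If `F'` and `G'` arise from `F` by
applying the two functionals to the first round, then `G' + F'` and `G' - F'` are nonnegative
non-signaling systems again, and `F'` is half of their difference. -/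
theorem abs_sum_prod_mul_le {N : ℕ} {φ ψ : Fin N → Round → ℝ} (h : ∀ i, Dominates (ψ i) (φ i))
    {F : (Fin N → Round) → ℝ} (hF0 : ∀ c, 0 ≤ F c) (hF : RoundsNS F) :
    |∑ c, (∏ i, φ i (c i)) * F c| ≤ ∑ c, (∏ i, ψ i (c i)) * F c := by
  induction N with
  | zero => simp [abs_of_nonneg (hF0 _)]
  | succ N ih =>
    rw [sum_cons_prod, sum_cons_prod]
    have hle : ∀ c : Fin N → Round,
        |∑ r, φ 0 r * F (Fin.cons r c)| ≤ ∑ r, ψ 0 r * F (Fin.cons r c) :=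
      fun c => h 0 _ (fun r => hF0 _) (hF.head c)
    have h1 := ih (fun i => h i.succ)
      (F := fun c => ∑ r, ψ 0 r * F (Fin.cons r c) + ∑ r, φ 0 r * F (Fin.cons r c))
      (fun c => by linarith [(abs_le.1 (hle c)).1]) ((hF.sum_cons _).add (hF.sum_cons _))
    have h2 := ih (fun i => h i.succ)
      (F := fun c => ∑ r, ψ 0 r * F (Fin.cons r c) - ∑ r, φ 0 r * F (Fin.cons r c))
      (fun c => by linarith [(abs_le.1 (hle c)).2]) ((hF.sum_cons _).sub (hF.sum_cons _))
    simp only [mul_add, mul_sub, Finset.sum_add_distrib, Finset.sum_sub_distrib] at h1 h2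
    rw [abs_le] at h1 h2 ⊢
    constructor <;> linarith [h1.1, h1.2, h2.1, h2.2]

/-! ### The chained Bell inequality -/

/-- The sign `(-1)^b` of a bit. -/
def bitSign (b : Bit) : ℝ := if b = 0 then 1 else -1

@[simp] theorem bitSign_zero : bitSign 0 = 1 := by simp [bitSign]

@[simp] theorem bitSign_one : bitSign 1 = -1 := by simp [bitSign]

theorem bitSign_add (a b : Bit) : bitSign (a + b) = bitSign a * bitSign b := by
  rcases bit_cases a with rfl | rfl <;> rcases bit_cases b with rfl | rfl <;>
    simp [show (1 + 1 : Bit) = 0 by decide]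

theorem bitSign_sum {ι : Type*} (s : Finset ι) (f : ι → Bit) :
    bitSign (∑ i ∈ s, f i) = ∏ i ∈ s, bitSign (f i) := by
  classical
  induction s using Finset.induction_on with
  | empty => simp
  | insert i s hi ih => rw [Finset.sum_insert hi, Finset.prod_insert hi, bitSign_add, ih]

theorem abs_bitSign (b : Bit) : |bitSign b| = 1 := by
  rcases bit_cases b with rfl | rfl <;> simp

/-- The indicator of a violation of the CHSH condition. -/
def chshViolation (r : Round) : ℝ := if r.2.2.1 + r.2.2.2 ≠ r.1 * r.2.1 then 1 else 0

/-- Chained Bell inequality: `x₀ = y₀ = x₁ ≠ y₁ = x₀` is contradictory, so the bias of Alice's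
output on input `0` is at most the sum of the probabilities of the four violations. -/
theorem dominates_bias :
    Dominates chshViolation fun r => if r.1 = 0 ∧ r.2.1 = 0 then bitSign r.2.2.1 else 0 := by
  intro g hg hns
  have h11 : (1 + 1 : Bit) = 0 := by decide
  simp only [Fintype.sum_prod_type, sum_bit, chshViolation]
  have a1 := hns.alice 0 1 0 0
  have a2 := hns.alice 0 1 0 1
  have a3 := hns.alice 0 1 1 0
  have a4 := hns.alice 0 1 1 1
  have b1 := hns.bob 0 0 1 0
  have b2 := hns.bob 0 0 1 1
  have b3 := hns.bob 1 0 1 0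
  have b4 := hns.bob 1 0 1 1
  simp only [sum_bit] at a1 a2 a3 a4 b1 b2 b3 b4
  simp [h11]
  rw [abs_le]
  constructor <;>
  linarith [hg (0, 0, 0, 1), hg (0, 0, 1, 0), hg (0, 1, 0, 1), hg (0, 1, 1, 0), hg (1, 0, 0, 1),
    hg (1, 0, 1, 0), hg (1, 1, 0, 0), hg (1, 1, 1, 1)]

/-- By non-signaling, the total weight is the same for each of the four pairs of inputs. -/
theorem dominates_marginal :
    Dominates (fun _ => 1 / 4) fun r => if r.1 = 0 ∧ r.2.1 = 0 then 1 else 0 := by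
  intro g hg hns
  simp only [Fintype.sum_prod_type, sum_bit]
  have a1 := hns.alice 0 1 0 0
  have a2 := hns.alice 0 1 0 1
  have a3 := hns.alice 0 1 1 0
  have a4 := hns.alice 0 1 1 1
  have b1 := hns.bob 0 0 1 0
  have b2 := hns.bob 0 0 1 1
  have b3 := hns.bob 1 0 1 0
  have b4 := hns.bob 1 0 1 1
  simp only [sum_bit] at a1 a2 a3 a4 b1 b2 b3 b4
  simp
  rw [abs_le]
  constructor <;> linarith [hg (0, 0, 0, 1), hg (0, 0, 1, 0), hg (0, 0, 0, 0), hg (0, 0, 1, 1)]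

theorem dominates_self {ψ : Round → ℝ} (h : ∀ r, 0 ≤ ψ r) : Dominates ψ ψ := fun g hg _ => by
  rw [abs_of_nonneg (Finset.sum_nonneg fun r _ => mul_nonneg (h r) (hg r))]

/-! ### Fourier analysis over `GF(2)` -/

theorem sum_bitSign_dotProduct {ι : Type*} [Fintype ι] [DecidableEq ι] (v : ι → Bit) :
    ∑ c : ι → Bit, bitSign (c ⬝ᵥ v) = if v = 0 then (2 : ℝ) ^ Fintype.card ι else 0 := by
  have h : ∀ b : Bit, ∑ a : Bit, bitSign (a * b) = if b = 0 then 2 else 0 := by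
    intro b
    rw [sum_bit]
    rcases bit_cases b with rfl | rfl <;> norm_num
  simp_rw [dotProduct, bitSign_sum]
  rw [← Fintype.prod_sum (fun i (a : Bit) => bitSign (a * v i))]
  simp_rw [h, Finset.prod_ite_zero, funext_iff]
  simp

/-- Summing additive homomorphisms onto a group over the source samples the target uniformly. -/
theorem card_mul_sum_comp {G H : Type*} [AddCommGroup G] [AddCommGroup H] [Fintype G] [Fintype H]
    [DecidableEq H] (φ : G →+ H) (hφ : Function.Surjective φ) (f : H → ℝ) :
    (Fintype.card H : ℝ) * ∑ g, f (φ g) = Fintype.card G * ∑ h, f h := by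
  classical
  have hfib : ∀ h : H, (Finset.univ.filter fun g => φ g = h).card =
      (Finset.univ.filter fun g => φ g = 0).card := fun h =>
    AddMonoidHom.card_fiber_eq_of_mem_range φ (hφ h) (hφ 0)
  set k := (Finset.univ.filter fun g => φ g = 0).card with hk
  have hG : Fintype.card G = Fintype.card H * k := by
    rw [← Finset.card_univ, Finset.card_eq_sum_card_fiberwise (f := φ) (t := Finset.univ)
      (fun _ _ => Finset.mem_coe.2 (Finset.mem_univ _))]
    simp_rw [hfib]
    simp
  have hsum : ∑ g, f (φ g) = k * ∑ h, f h := by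
    rw [← Finset.sum_fiberwise (s := Finset.univ) (g := φ), Finset.mul_sum]
    refine Finset.sum_congr rfl fun h _ => ?_
    rw [Finset.sum_congr rfl (fun g hg => by rw [(Finset.mem_filter.1 hg).2]), Finset.sum_const,
      hfib, nsmul_eq_mul]
  rw [hsum, hG]
  push_cast
  ring

/-- For a uniformly random matrix `A` and `c ≠ 0`, the row vector `c A` is uniform. -/
theorem sum_vecMul_eq {ι κ : Type*} [Fintype ι] [Fintype κ] [DecidableEq ι] [DecidableEq κ]
    {c : ι → Bit} (hc : c ≠ 0) (f : (κ → Bit) → ℝ) :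
    (2 : ℝ) ^ Fintype.card κ * ∑ A : Matrix ι κ Bit, f (c ᵥ* A) =
      Fintype.card (Matrix ι κ Bit) * ∑ χ, f χ := by
  obtain ⟨i, hi⟩ := Function.ne_iff.1 hc
  have hi1 : c i = 1 := (bit_cases _).resolve_left hi
  have := card_mul_sum_comp (G := Matrix ι κ Bit) (H := κ → Bit)
    { toFun := fun A => c ᵥ* A
      map_zero' := by simp
      map_add' := fun A B => Matrix.vecMul_add _ _ _ }
    (fun χ => ⟨Matrix.of fun i' j => if i' = i then χ j else 0, by
      ext j
      simp [Matrix.vecMul, dotProduct, hi1]⟩) f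
  simpa [ZMod.card] using this

/-- A uniformly random matrix with `m + s` rows whose first `m` rows form the matrix `H` satisfies
`H v = 0` with probability `2⁻ᵐ`, for each `v ≠ 0`. -/
theorem card_matrix_toRows₁_mulVec_eq_zero {ι κ τ : Type*} [Fintype ι] [Fintype κ] [Fintype τ]
    [DecidableEq ι] [DecidableEq κ] [DecidableEq τ] {v : κ → Bit} (hv : v ≠ 0) :
    (2 : ℝ) ^ Fintype.card ι *
        (Finset.univ.filter fun A : Matrix (ι ⊕ τ) κ Bit => A.toRows₁ *ᵥ v = 0).card =
      Fintype.card (Matrix (ι ⊕ τ) κ Bit) := by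
  obtain ⟨j, hj⟩ := Function.ne_iff.1 hv
  have hj1 : v j = 1 := (bit_cases _).resolve_left hj
  have := card_mul_sum_comp (G := Matrix (ι ⊕ τ) κ Bit) (H := ι → Bit)
    { toFun := fun A => A.toRows₁ *ᵥ v
      map_zero' := by ext; simp [Matrix.mulVec, dotProduct, Matrix.toRows₁]
      map_add' := fun A B => by
        ext; simp [Matrix.mulVec, dotProduct, Matrix.toRows₁, add_mul, Finset.sum_add_distrib] }
    (fun χ => ⟨Matrix.of fun i j' => if j' = j then Sum.elim χ 0 i else 0, by
      ext i
      simp [Matrix.mulVec, dotProduct, Matrix.toRows₁, hj1]⟩) (fun h => if h = 0 then 1 else 0)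
  simpa [ZMod.card, Finset.sum_ite] using this

/-- Vazirani's XOR lemma in the form needed here: if `p` is a (real) weight on bit strings, then the
weight of each value `k` of the hash `A₂ ξ`, jointly with the value `r` of `A₁ ξ`, is close to
uniform in terms of the Fourier coefficients of `p` at the combinations of the rows of `A` that
involve a row of `A₂`. -/
theorem sum_sub_pow_mul_sum_le {ι κ τ : Type*} [Fintype ι] [Fintype κ] [Fintype τ]
    [DecidableEq ι] [DecidableEq κ] [DecidableEq τ] (p : (κ → Bit) → ℝ)
    (A : Matrix (ι ⊕ τ) κ Bit) (r : ι → Bit) (k : τ → Bit) :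
    ∑ ξ, (if A.toRows₁ *ᵥ ξ = r then p ξ else 0) -
        2 ^ Fintype.card τ * ∑ ξ, (if A.toRows₁ *ᵥ ξ = r ∧ A.toRows₂ *ᵥ ξ = k then p ξ else 0) ≤
      (2 ^ Fintype.card ι : ℝ)⁻¹ * ∑ b : ι ⊕ τ → Bit with b ∘ Sum.inr ≠ 0,
        |∑ ξ, bitSign ((b ᵥ* A) ⬝ᵥ ξ) * p ξ| := by
  have hm : (0 : ℝ) < 2 ^ Fintype.card ι := by positivity
  have hchar : ∀ ξ : κ → Bit,
      ∑ b : ι ⊕ τ → Bit with b ∘ Sum.inr ≠ 0, bitSign (b ⬝ᵥ (Sum.elim r k)) *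
        bitSign ((b ᵥ* A) ⬝ᵥ ξ) =
      2 ^ Fintype.card ι * (2 ^ Fintype.card τ *
        (if A.toRows₁ *ᵥ ξ = r ∧ A.toRows₂ *ᵥ ξ = k then 1 else 0) -
        (if A.toRows₁ *ᵥ ξ = r then 1 else 0)) := by
    intro ξ
    have hself : ∀ v w : Bit, v + w = 0 ↔ w = v := by decide
    have h1 : ∀ b : ι ⊕ τ → Bit, bitSign (b ⬝ᵥ (Sum.elim r k)) * bitSign ((b ᵥ* A) ⬝ᵥ ξ) =
        bitSign ((b ∘ Sum.inl) ⬝ᵥ (r + A.toRows₁ *ᵥ ξ)) *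
          bitSign ((b ∘ Sum.inr) ⬝ᵥ (k + A.toRows₂ *ᵥ ξ)) := by
      intro b
      rw [← bitSign_add, ← bitSign_add, ← Matrix.dotProduct_mulVec, ← dotProduct_add]
      congr 1
      simp [dotProduct, Fintype.sum_sum_type, Matrix.mulVec, Matrix.toRows₁, Matrix.toRows₂]
    have h2 : ∀ f : (ι ⊕ τ → Bit) → ℝ, ∑ b : ι ⊕ τ → Bit with b ∘ Sum.inr ≠ 0, f b =
        ∑ b, f b - ∑ b : ι ⊕ τ → Bit with b ∘ Sum.inr = 0, f b := by
      intro f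
      rw [← Finset.sum_filter_add_sum_filter_not Finset.univ
        (fun b : ι ⊕ τ → Bit => b ∘ Sum.inr = 0)]
      ring
    have h3 : ∀ g : (ι → Bit) → (τ → Bit) → ℝ,
        ∑ b : ι ⊕ τ → Bit, g (b ∘ Sum.inl) (b ∘ Sum.inr) = ∑ a, ∑ c, g a c := by
      intro g
      rw [← (Equiv.sumArrowEquivProdArrow ι τ Bit).symm.sum_comp, Fintype.sum_prod_type]
      rfl
    rw [h2, Finset.sum_filter]
    simp_rw [h1]
    rw [h3 (fun a c => bitSign (a ⬝ᵥ (r + A.toRows₁ *ᵥ ξ)) * bitSign (c ⬝ᵥ (k + A.toRows₂ *ᵥ ξ))),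
      h3 (fun a c => if c = 0 then bitSign (a ⬝ᵥ (r + A.toRows₁ *ᵥ ξ)) *
        bitSign (c ⬝ᵥ (k + A.toRows₂ *ᵥ ξ)) else 0)]
    simp_rw [← Finset.mul_sum]
    simp only [Finset.sum_ite_eq', Finset.mem_univ, if_true, zero_dotProduct, bitSign_zero, mul_one]
    rw [← Finset.sum_mul, sum_bitSign_dotProduct, sum_bitSign_dotProduct]
    have e1 : r + A.toRows₁ *ᵥ ξ = 0 ↔ A.toRows₁ *ᵥ ξ = r := by
      simp only [funext_iff, Pi.add_apply, Pi.zero_apply, hself]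
    have e2 : k + A.toRows₂ *ᵥ ξ = 0 ↔ A.toRows₂ *ᵥ ξ = k := by
      simp only [funext_iff, Pi.add_apply, Pi.zero_apply, hself]
    simp only [e1, e2]
    by_cases h4 : A.toRows₁ *ᵥ ξ = r <;> by_cases h5 : A.toRows₂ *ᵥ ξ = k <;>
      (simp [h4, h5]; try ring)
  have hsum : ∑ ξ, (if A.toRows₁ *ᵥ ξ = r then p ξ else 0) -
        2 ^ Fintype.card τ * ∑ ξ, (if A.toRows₁ *ᵥ ξ = r ∧ A.toRows₂ *ᵥ ξ = k then p ξ else 0) =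
      -((2 ^ Fintype.card ι : ℝ)⁻¹ * ∑ b : ι ⊕ τ → Bit with b ∘ Sum.inr ≠ 0,
        bitSign (b ⬝ᵥ (Sum.elim r k)) * ∑ ξ, bitSign ((b ᵥ* A) ⬝ᵥ ξ) * p ξ) := by
    simp_rw [Finset.mul_sum]
    rw [Finset.sum_comm, ← Finset.sum_sub_distrib, ← Finset.sum_neg_distrib]
    refine Finset.sum_congr rfl fun ξ _ => ?_
    simp_rw [← mul_assoc]
    rw [← Finset.sum_mul]
    simp_rw [mul_assoc]
    rw [← Finset.mul_sum, hchar]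
    split_ifs <;> (field_simp; ring)
  rw [hsum, ← mul_neg]
  refine mul_le_mul_of_nonneg_left ?_ (by positivity)
  refine (neg_le_abs _).trans
    ((Finset.abs_sum_le_sum_abs _ _).trans (Finset.sum_le_sum fun b _ => ?_))
  rw [abs_mul, abs_bitSign, one_mul]

/-! ### The protocol as a kernel applied to the non-signaling system -/

namespace Rounds

variable {N n s : ℕ}

/-- Alice's inputs. -/
def u (c : Fin N → Round) : BitStr N := fun i => (c i).1

/-- Bob's inputs. -/
def v (c : Fin N → Round) : BitStr N := fun i => (c i).2.1

/-- Alice's outputs. -/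
def x (c : Fin N → Round) : BitStr N := fun i => (c i).2.2.1

/-- Bob's outputs. -/
def y (c : Fin N → Round) : BitStr N := fun i => (c i).2.2.2

/-- The rounds with input `(0,0)`. -/
def zeroRounds (c : Fin N → Round) : Finset (Fin N) :=
  Finset.univ.filter fun i => u c i = 0 ∧ v c i = 0

/-- The announcement if the rounds `e` are selected. -/
def announcement (c : Fin N → Round) (e : Fin n ↪ Fin N) : Announcement N n :=
  announce (u c) (v c) e (x c) (y c)

/-- The number of ways to select `n` rounds with input `(0,0)`, in order. -/
noncomputable def numSelections (n : ℕ) (c : Fin N → Round) : ℕ :=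
  (Finset.univ.filter fun e : Fin n ↪ Fin N => ∀ j, e j ∈ zeroRounds c).card

/-- Reading off the inputs and outputs of all rounds. -/
def equiv (N : ℕ) : (Fin N → Round) ≃ BitStr N × BitStr N × BitStr N × BitStr N where
  toFun c := (u c, v c, x c, y c)
  invFun q i := (q.1 i, q.2.1 i, q.2.2.1 i, q.2.2.2 i)
  left_inv _ := rfl
  right_inv _ := rfl

theorem sum_eq {M : Type*} [AddCommMonoid M]
    (f : BitStr N → BitStr N → BitStr N → BitStr N → M) :
    ∑ c : Fin N → Round, f (u c) (v c) (x c) (y c) =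
      ∑ a, ∑ b, ∑ x, ∑ y, f a b x y := by
  rw [← (equiv N).symm.sum_comp]
  simp only [Fintype.sum_prod_type]
  rfl

end Rounds

open Rounds

open Classical in
/-- What the protocol does, given the inputs and outputs of Alice's and Bob's systems. -/
noncomputable def protocolKernel {N n s : ℕ} (η : ℝ) (D : MinDistDecoder n)
    (c : Fin N → Round) : PMF (Outcome N n s η) :=
  if h : (Finset.univ.filter fun e : Fin n ↪ Fin N =>
      ∀ j, u c (e j) = 0 ∧ v c (e j) = 0).Nonempty then
    (PMF.uniformOfFinset _ h).bind fun e =>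
      if (announcement c e).Accepted η then
        (PMF.uniformOfFintype
            (Matrix (Fin ((announcement c e).syndromeLength η) ⊕ Fin s) (Fin n) Bit)).map fun A =>
          Outcome.key (announcement c e) A (A.toRows₁ *ᵥ (x c ∘ e)) (A.toRows₂ *ᵥ (x c ∘ e))
            (A.toRows₂ *ᵥ D.decode _ A.toRows₁ (A.toRows₁ *ᵥ (x c ∘ e)) (y c ∘ e))
      else PMF.pure (Outcome.abort (announcement c e))
  else PMF.pure (Outcome.tooFewZeroRounds (u c) (v c))

theorem protocolRun_eq_bind {N n s : ℕ} {W Z : Type*} (η : ℝ) (D : MinDistDecoder n)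
    (P : NSBox N W Z) (w : W) :
    protocolRun (s := s) η D P w =
      (PMF.uniformOfFintype (BitStr N × BitStr N)).bind fun uv =>
        (P.law uv.1 uv.2 w).bind fun xyz =>
          (protocolKernel η D ((equiv N).symm (uv.1, uv.2, xyz.1, xyz.2.1))).map
            fun o => (o, xyz.2.2) := by
  unfold protocolRun
  refine congrArg (PMF.bind _) (funext fun uv => congrArg (PMF.bind _) (funext fun xyz => ?_))
  obtain ⟨a, b⟩ := uv
  obtain ⟨x', y', z⟩ := xyz
  obtain ⟨c, hc⟩ := (equiv N).surjective (a, b, x', y')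
  rw [← hc, Equiv.symm_apply_apply]
  obtain ⟨rfl, rfl, rfl, rfl⟩ : u c = a ∧ v c = b ∧ x c = x' ∧ y c = y' := by
    change (u c, v c, x c, y c) = _ at hc
    simpa using hc
  unfold protocolKernel
  by_cases h : (Finset.univ.filter fun e : Fin n ↪ Fin N =>
      ∀ j, u c (e j) = 0 ∧ v c (e j) = 0).Nonempty
  · refine (dif_pos h).trans (Eq.trans ?_ (congrArg (PMF.map _) (dif_pos h).symm))
    rw [PMF.map_bind]
    refine congrArg (PMF.bind _) (funext fun e => ?_)
    by_cases h2 : (announcement c e).Accepted η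
    · refine (if_pos h2).trans (Eq.trans ?_ (congrArg (PMF.map _) (if_pos h2).symm))
      rw [PMF.map_comp]
      rfl
    · refine (if_neg h2).trans (Eq.trans ?_ (congrArg (PMF.map _) (if_neg h2).symm))
      rw [PMF.pure_map]
      rfl
  · refine (dif_neg h).trans (Eq.trans ?_ (congrArg (PMF.map _) (dif_neg h).symm))
    rw [PMF.pure_map]

theorem mem_zeroRounds {N : ℕ} {c : Fin N → Round} {i : Fin N} :
    i ∈ zeroRounds c ↔ u c i = 0 ∧ v c i = 0 := by simp [zeroRounds]

theorem numSelections_eq {N n : ℕ} (c : Fin N → Round) :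
    numSelections n c = (Finset.univ.filter fun e : Fin n ↪ Fin N =>
      ∀ j, u c (e j) = 0 ∧ v c (e j) = 0).card := by
  simp only [numSelections, mem_zeroRounds]

/-- The real system, with Alice's and Bob's inputs and outputs sorted by rounds: their inputs have
weight `4⁻ᴺ`. -/
theorem protocolRun_apply {N n s : ℕ} {W Z : Type*} (η : ℝ) (D : MinDistDecoder n)
    (P : NSBox N W Z) (w : W) (o : Outcome N n s η) (z : Z) :
    protocolRun η D P w (o, z) = ∑ c : Fin N → Round, ((4 : ℝ≥0∞) ^ N)⁻¹ *
      (P.law (u c) (v c) w (x c, y c, z) * protocolKernel η D c o) := by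
  classical
  have hmap : ∀ (p : PMF (Outcome N n s η)) (z' : Z),
      (p.map fun o => (o, z')) (o, z) = if z' = z then p o else 0 := by
    intro p z'
    rw [PMF.map_apply]
    split_ifs with h
    · subst h
      rw [tsum_eq_single o]
      · simp
      · intro o' ho'
        simp [ho'.symm]
    · rw [ENNReal.tsum_eq_zero]
      intro o'
      simp [Ne.symm h]
  rw [protocolRun_eq_bind, PMF.bind_apply, tsum_fintype]
  simp only [PMF.bind_apply, PMF.uniformOfFintype_apply, hmap]
  rw [← (equiv N).symm.sum_comp]
  have hcard : (Fintype.card (BitStr N × BitStr N) : ℝ≥0∞) = 4 ^ N := by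
    simp [ZMod.card, ← mul_pow]
  rw [hcard]
  simp only [Fintype.sum_prod_type]
  refine Finset.sum_congr rfl fun a _ => Finset.sum_congr rfl fun b _ => ?_
  rw [ENNReal.tsum_prod', tsum_fintype, Finset.mul_sum]
  refine Finset.sum_congr rfl fun x _ => ?_
  rw [ENNReal.tsum_prod', tsum_fintype, Finset.mul_sum]
  refine Finset.sum_congr rfl fun y _ => ?_
  congr 1
  rw [tsum_eq_single z]
  · simp
    rfl
  · intro z' hz'
    simp [hz']

open Classical in
theorem protocolKernel_key {N n s : ℕ} (η : ℝ) (D : MinDistDecoder n) (c : Fin N → Round)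
    (a : Announcement N n) (A : Matrix (Fin (a.syndromeLength η) ⊕ Fin s) (Fin n) Bit)
    (r : BitStr (a.syndromeLength η)) (k k' : BitStr s) :
    protocolKernel η D c (Outcome.key a A r k k') =
      ENNReal.ofReal (if (a = announcement c a.raw ∧ (∀ j, a.raw j ∈ zeroRounds c) ∧
          a.Accepted η) ∧ A.toRows₁ *ᵥ (x c ∘ a.raw) = r ∧ A.toRows₂ *ᵥ (x c ∘ a.raw) = k ∧
          A.toRows₂ *ᵥ D.decode _ A.toRows₁ r (y c ∘ a.raw) = k' then
        (numSelections n c : ℝ)⁻¹ * (Fintype.card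
          (Matrix (Fin (a.syndromeLength η) ⊕ Fin s) (Fin n) Bit) : ℝ)⁻¹ else 0) := by
  unfold protocolKernel
  split_ifs with h h2 h2
  · rw [PMF.bind_apply, tsum_fintype, Finset.sum_eq_single a.raw]
    · obtain ⟨⟨h3, h4, h5⟩, rfl, rfl, rfl⟩ := h2
      rw [PMF.uniformOfFinset_apply_of_mem _ (by simpa [mem_zeroRounds] using h4),
        ← numSelections_eq]
      have hpos : 0 < numSelections n c := by
        rw [numSelections_eq]; exact h.card_pos
      rw [ENNReal.ofReal_mul (by positivity), ENNReal.ofReal_inv_of_pos (by exact_mod_cast hpos),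
        ENNReal.ofReal_natCast, ENNReal.ofReal_inv_of_pos (by exact_mod_cast Fintype.card_pos),
        ENNReal.ofReal_natCast]
      congr 1
      generalize a.raw = e at *
      subst h3
      rw [if_pos h5, PMF.map_apply, tsum_eq_single A]
      · simp
      · intro B hB
        rw [if_neg]
        intro hAB
        simp only [Outcome.key.injEq, heq_eq_eq, true_and] at hAB
        exact hB hAB.1.symm
    · intro e _ he
      rw [mul_eq_zero]
      right
      have hne : announcement c e ≠ a := by
        rintro rfl
        exact he rfl
      split_ifs
      · rw [PMF.map_apply, ENNReal.tsum_eq_zero]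
        intro B
        rw [if_neg]
        intro hAB
        rw [Outcome.key.injEq] at hAB
        exact hne hAB.1.symm
      · rw [PMF.pure_apply, if_neg (by simp)]
    · simp
  · rw [ENNReal.ofReal_zero, PMF.bind_apply, ENNReal.tsum_eq_zero]
    intro e
    by_cases he : e ∈ (Finset.univ.filter fun e : Fin n ↪ Fin N =>
      ∀ j, u c (e j) = 0 ∧ v c (e j) = 0)
    · rw [mul_eq_zero]
      right
      split_ifs with h3
      · rw [PMF.map_apply, ENNReal.tsum_eq_zero]
        intro B
        rw [if_neg]
        intro hAB
        apply h2
        obtain ⟨rfl, hAB⟩ := Outcome.key.inj hAB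
        obtain ⟨h4, h5, h6, h7⟩ := hAB
        have h4 := eq_of_heq h4
        have h5 := eq_of_heq h5
        subst h4 h5 h6 h7
        exact ⟨⟨rfl, fun j => mem_zeroRounds.2 ((Finset.mem_filter.1 he).2 j), h3⟩, rfl, rfl, rfl⟩
      · rw [PMF.pure_apply, if_neg (by simp)]
    · rw [PMF.uniformOfFinset_apply_of_notMem _ he, zero_mul]
  · exfalso
    exact h ⟨a.raw, by simpa [mem_zeroRounds] using h2.1.2.1⟩
  · simp [PMF.pure_apply]

/-! ### Constructing the failure event -/

/-- The public transcript of a run that ends with keys: announcement, matrix and syndrome. -/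
abbrev Transcript (N n s : ℕ) (η : ℝ) : Type :=
  Σ a : Announcement N n, Matrix (Fin (a.syndromeLength η) ⊕ Fin s) (Fin n) Bit ×
    BitStr (a.syndromeLength η)

/-- The outcome with public transcript `q` and keys `k`, `k'`. -/
def Transcript.key {N n s : ℕ} {η : ℝ} (q : Transcript N n s η) (k k' : BitStr s) :
    Outcome N n s η :=
  Outcome.key q.1 q.2.1 q.2.2 k k'

section

variable {N n s : ℕ} {η : ℝ} {W Z : Type*}

/-- The mass that, given the transcript `q` and Eve's output `z`, can be kept outside of the failure
event for each value of the key. -/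
noncomputable def minKeyMass (run : W → PMF (Outcome N n s η × Z)) (w : W)
    (q : Transcript N n s η) (z : Z) : ℝ≥0∞ :=
  ⨅ k, run w (q.key k k, z)

/-- The total of `minKeyMass` over Eve's outputs, for her worst input. -/
noncomputable def minKeyMassInf (run : W → PMF (Outcome N n s η × Z))
    (q : Transcript N n s η) : ℝ≥0∞ :=
  ⨅ w, ∑' z, minKeyMass run w q z

/-- The part of the distribution outside of the failure event. For each transcript, `minKeyMass` is
scaled such that its total does not depend on Eve's input. (Where the total of `minKeyMass` is `0`,
so is `minKeyMass`, and the quotient is irrelevant.) -/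
noncomputable def keptMass (run : W → PMF (Outcome N n s η × Z)) (w : W) :
    Outcome N n s η → Z → ℝ≥0∞
  | .tooFewZeroRounds u v, z => run w (.tooFewZeroRounds u v, z)
  | .abort a, z => run w (.abort a, z)
  | .key a A r k k', z => if k = k' then
      minKeyMass run w ⟨a, A, r⟩ z *
        (minKeyMassInf run ⟨a, A, r⟩ / ∑' z', minKeyMass run w ⟨a, A, r⟩ z') else 0

variable (run : W → PMF (Outcome N n s η × Z))

theorem tsum_run_le_one (w : W) (o : Outcome N n s η) : ∑' z, run w (o, z) ≤ 1 := by
  rw [← (run w).tsum_coe, ENNReal.tsum_prod']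
  exact ENNReal.le_tsum o

theorem tsum_minKeyMass_ne_top (w : W) (q : Transcript N n s η) :
    ∑' z, minKeyMass run w q z ≠ ⊤ :=
  ne_top_of_le_ne_top ENNReal.one_ne_top
    ((ENNReal.tsum_le_tsum fun _ => iInf_le _ 0).trans (tsum_run_le_one run w (q.key 0 0)))

theorem keptMass_le (w : W) (o : Outcome N n s η) (z : Z) : keptMass run w o z ≤ run w (o, z) := by
  cases o with
  | tooFewZeroRounds u v => exact le_rfl
  | abort a => exact le_rfl
  | key a A r k k' =>
    simp only [keptMass]
    split_ifs with h
    · subst h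
      refine (mul_le_of_le_one_right' (ENNReal.div_le_of_le_mul ?_)).trans (iInf_le _ k)
      rw [one_mul]
      exact iInf_le _ w
    · exact bot_le

theorem tsum_keptMass_key (w : W) (q : Transcript N n s η) (k k' : BitStr s) :
    ∑' z, keptMass run w (q.key k k') z = if k = k' then minKeyMassInf run q else 0 := by
  obtain ⟨a, A, r⟩ := q
  by_cases h : k = k'
  · simp only [Transcript.key, keptMass, h, if_true]
    rw [ENNReal.tsum_mul_right]
    have hle : minKeyMassInf run ⟨a, A, r⟩ ≤ ∑' z', minKeyMass run w ⟨a, A, r⟩ z' := iInf_le _ w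
    by_cases h0 : ∑' z', minKeyMass run w ⟨a, A, r⟩ z' = 0
    · rw [h0, zero_mul]
      exact (le_antisymm (hle.trans h0.le) bot_le).symm
    · exact ENNReal.mul_div_cancel h0 (tsum_minKeyMass_ne_top run w _)
  · simp [Transcript.key, keptMass, h]

/-- The real system extended by the failure event. -/
noncomputable def extendedRun (w : W) : PMF (Outcome N n s η × Z × Bool) :=
  ⟨fun o => if o.2.2 then run w (o.1, o.2.1) - keptMass run w o.1 o.2.1
      else keptMass run w o.1 o.2.1, by
    rw [ENNReal.summable.hasSum_iff, ← (run w).tsum_coe, ENNReal.tsum_prod', ENNReal.tsum_prod']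
    refine tsum_congr fun o => ?_
    rw [ENNReal.tsum_prod']
    refine tsum_congr fun z => ?_
    rw [tsum_bool]
    simp [add_tsub_cancel_of_le (keptMass_le run w o z)]⟩

theorem extendedRun_false (w : W) (o : Outcome N n s η) (z : Z) :
    extendedRun run w (o, z, false) = keptMass run w o z := by
  change (if false then run w (o, z) - keptMass run w o z else keptMass run w o z) = _
  simp

theorem extendedRun_true (w : W) (o : Outcome N n s η) (z : Z) :
    extendedRun run w (o, z, true) = run w (o, z) - keptMass run w o z := by
  change (if true then run w (o, z) - keptMass run w o z else keptMass run w o z) = _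
  simp

theorem extendedRun_map_run (w : W) :
    (extendedRun run w).map (fun o => (o.1, o.2.1)) = run w := by
  classical
  ext ⟨o, z⟩
  rw [PMF.map_apply, ENNReal.tsum_prod', tsum_eq_single o, ENNReal.tsum_prod', tsum_eq_single z,
    tsum_bool, extendedRun_false, extendedRun_true]
  · simp [add_tsub_cancel_of_le (keptMass_le run w o z)]
  · intro z' hz'
    simp [hz'.symm]
  · intro o' ho'
    simp [ho'.symm]

theorem extendedRun_map_outcome (w : W) (o : Outcome N n s η) (b : Bool) :
    (extendedRun run w).map (fun o => (o.1, o.2.2)) (o, b) = ∑' z, extendedRun run w (o, z, b) := by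
  classical
  rw [PMF.map_apply, ENNReal.tsum_prod', tsum_eq_single o, ENNReal.tsum_prod']
  · refine tsum_congr fun z => ?_
    rw [tsum_eq_single b]
    · simp
    · intro b' hb'
      simp [hb'.symm]
  · intro o' ho'
    simp [ho'.symm]

theorem extendedRun_map_event (w : W) (b : Bool) :
    (extendedRun run w).map (fun o => o.2.2) b = ∑' o, ∑' z, extendedRun run w (o, z, b) := by
  classical
  rw [PMF.map_apply, ENNReal.tsum_prod']
  refine tsum_congr fun o => ?_
  rw [ENNReal.tsum_prod']
  refine tsum_congr fun z => ?_
  rw [tsum_eq_single b]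
  · simp
  · intro b' hb'
    simp [hb'.symm]

/-- If, for each public transcript, the total mass exceeds the mass that can be kept by at most
`B q`, then the keys are perfectly secret except with probability `∑ B q`. -/
theorem secureExcept_of_bound [Nonempty W] {p : ℝ≥0∞}
    (hmarg : ∀ w w' o, ∑' z, run w (o, z) = ∑' z, run w' (o, z))
    (B : Transcript N n s η → ℝ≥0∞)
    (hB : ∀ w q, ∑ k, ∑ k', ∑' z, run w (q.key k k', z) ≤
      2 ^ s * ∑' z, minKeyMass run w q z + B q)
    (hp : ∑' q, B q ≤ p) : SecureExcept run p := by
  classical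
  have hpow : (2 : ℝ≥0∞) ^ s ≠ ⊤ := ENNReal.pow_ne_top ENNReal.ofNat_ne_top
  have hpow0 : (2 : ℝ≥0∞) ^ s ≠ 0 := pow_ne_zero _ two_ne_zero
  have hG : ∀ q, minKeyMassInf run q ≠ ⊤ := fun q =>
    ne_top_of_le_ne_top (tsum_minKeyMass_ne_top run (Classical.arbitrary W) q) (iInf_le _ _)
  have hsumkept : ∀ w q, ∑ k, ∑ k', ∑' z, keptMass run w (q.key k k') z =
      2 ^ s * minKeyMassInf run q := by
    intro w q
    simp [tsum_keptMass_key, ZMod.card]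
  have hkept_marg : ∀ w w' o, ∑' z, keptMass run w o z = ∑' z, keptMass run w' o z := by
    intro w w' o
    cases o with
    | tooFewZeroRounds u v => exact hmarg w w' _
    | abort a => exact hmarg w w' _
    | key a A r k k' =>
      exact (tsum_keptMass_key run w ⟨a, A, r⟩ k k').trans
        (tsum_keptMass_key run w' ⟨a, A, r⟩ k k').symm
  have hkept_top : ∀ w o, ∑' z, keptMass run w o z ≠ ⊤ := fun w o =>
    ne_top_of_le_ne_top ENNReal.one_ne_top
      ((ENNReal.tsum_le_tsum fun z => keptMass_le run w o z).trans (tsum_run_le_one run w o))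
  have htrue : ∀ w o, ∑' z, extendedRun run w (o, z, true) =
      ∑' z, run w (o, z) - ∑' z, keptMass run w o z := by
    intro w o
    simp_rw [extendedRun_true]
    refine ENNReal.eq_sub_of_add_eq (hkept_top w o) ?_
    rw [← ENNReal.tsum_add]
    exact tsum_congr fun z => tsub_add_cancel_of_le (keptMass_le run w o z)
  refine ⟨extendedRun run, extendedRun_map_run run, ?_, ?_, ?_⟩
  · intro w w'
    ext ⟨o, b⟩
    rw [extendedRun_map_outcome, extendedRun_map_outcome]
    cases b
    · simp_rw [extendedRun_false]
      exact hkept_marg w w' o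
    · rw [htrue, htrue, hmarg w w', hkept_marg w w']
  · intro w
    rw [extendedRun_map_event]
    refine le_trans ?_ hp
    have hinj : Function.Injective
        fun t : Transcript N n s η × BitStr s × BitStr s => t.1.key t.2.1 t.2.2 := by
      rintro ⟨⟨a, A, r⟩, k, k'⟩ ⟨⟨a', A', r'⟩, l, l'⟩ h
      simp only [Transcript.key, Outcome.key.injEq] at h
      obtain ⟨rfl, h1, h2, rfl, rfl⟩ := h
      obtain rfl := eq_of_heq h1
      obtain rfl := eq_of_heq h2
      rfl
    rw [← hinj.tsum_eq, ENNReal.tsum_prod']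
    · refine ENNReal.tsum_le_tsum fun q => ?_
      rw [ENNReal.tsum_prod']
      simp only [tsum_fintype]
      have hGB : ∑ k, ∑ k', ∑' z, run w (q.key k k', z) ≤ 2 ^ s * minKeyMassInf run q + B q := by
        rw [minKeyMassInf, ENNReal.mul_iInf_of_ne hpow0 hpow, ENNReal.iInf_add]
        refine le_iInf fun w' => ?_
        simp_rw [hmarg w w']
        exact hB w' q
      rw [← hsumkept w q] at hGB
      have hfin : ∑ k, ∑ k', ∑' z, keptMass run w (q.key k k') z ≠ ⊤ := by
        rw [hsumkept]
        exact ENNReal.mul_ne_top hpow (hG q)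
      rw [← ENNReal.add_le_add_iff_left hfin]
      refine le_trans (le_of_eq ?_) hGB
      simp_rw [← Finset.sum_add_distrib]
      refine Finset.sum_congr rfl fun k _ => Finset.sum_congr rfl fun k' _ => ?_
      rw [htrue, add_tsub_cancel_of_le (ENNReal.tsum_le_tsum fun z => keptMass_le run w _ z)]
    · intro o ho
      cases o with
      | tooFewZeroRounds u v => simp [htrue, keptMass] at ho
      | abort a => simp [htrue, keptMass] at ho
      | key a A r k k' => exact ⟨(⟨a, A, r⟩, k, k'), rfl⟩
  · intro w z a A r k k'
    simp_rw [extendedRun_false]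
    by_cases h : k = k'
    · simp only [h, if_true, keptMass, Finset.sum_ite_eq, Finset.mem_univ, Finset.sum_const,
        Finset.card_univ, Fintype.card_pi, ZMod.card, Finset.prod_const, Fintype.card_fin,
        nsmul_eq_mul, Nat.cast_pow, Nat.cast_ofNat]
      exact (ENNReal.eq_div_iff hpow0 hpow).2 rfl
    · simp [keptMass, h]

end

/-! ### Privacy amplification against non-signaling adversaries -/

/-- The number of ways to select `n` rounds with input `(0,0)`, in order. -/
noncomputable def Announcement.numSelections {N n : ℕ} (a : Announcement N n) : ℕ :=
  (Finset.univ.filter fun e : Fin n ↪ Fin N => ∀ j, a.u (e j) = 0 ∧ a.v (e j) = 0).card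

/-- The data of the rounds `c`, blanked out in the selected rounds `e`. -/
def Rounds.clear {N n : ℕ} (e : Fin n ↪ Fin N) (c : Fin N → Round) : Fin N → Round :=
  fun i => if i ∈ Finset.univ.map e then 0 else c i

section

variable {N n s : ℕ} {η : ℝ}

/-- The functional that bounds the bias of the parity `χ` of the raw key from the rounds `e`. -/
noncomputable def parityBound (e : Fin n ↪ Fin N) (χ : BitStr n) (c : Fin N → Round) : ℝ :=
  ∏ j, if χ j = 0 then 1 / 4 else chshViolation (c (e j))

theorem chshViolation_nonneg (r : Round) : 0 ≤ chshViolation r := by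
  unfold chshViolation
  split_ifs <;> norm_num

theorem parityBound_nonneg (e : Fin n ↪ Fin N) (χ : BitStr n) (c : Fin N → Round) :
    0 ≤ parityBound e χ c := by
  refine Finset.prod_nonneg fun j _ => ?_
  split_ifs
  · norm_num
  · exact chshViolation_nonneg _

theorem eq_announcement_iff (a : Announcement N n) (c : Fin N → Round) :
    a = announcement c a.raw ↔
      (a.u = u c ∧ a.v = v c) ∧ (∀ i, i ∈ Finset.univ.map a.raw → a.x i = 0 ∧ a.y i = 0) ∧
        ∀ i, i ∉ Finset.univ.map a.raw → a.x i = x c i ∧ a.y i = y c i := by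
  obtain ⟨au, av, e, ax, ay⟩ := a
  simp only [announcement, announce, Announcement.mk.injEq, true_and]
  constructor
  · rintro ⟨rfl, rfl, hx, hy⟩
    refine ⟨⟨rfl, rfl⟩, fun i hi => ?_, fun i hi => ?_⟩
    · rw [hx, hy]; simp only [hi, if_true, and_self]
    · rw [hx, hy]; simp only [hi, if_false, and_self]
  · rintro ⟨⟨rfl, rfl⟩, h1, h2⟩
    refine ⟨rfl, rfl, funext fun i => ?_, funext fun i => ?_⟩
    · split_ifs with hi
      exacts [(h1 i hi).1, (h2 i hi).1]
    · split_ifs with hi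
      exacts [(h1 i hi).2, (h2 i hi).2]

theorem eq_announcement_clear_iff (a : Announcement N n) (c : Fin N → Round) :
    a = announcement (clear a.raw c) a.raw ↔
      (∀ i, i ∈ Finset.univ.map a.raw → (a.u i, a.v i, a.x i, a.y i) = 0) ∧
        ∀ i, i ∉ Finset.univ.map a.raw → c i = (a.u i, a.v i, a.x i, a.y i) := by
  rw [eq_announcement_iff]
  constructor
  · rintro ⟨⟨hu, hv⟩, h1, h2⟩
    refine ⟨fun i hi => ?_, fun i hi => ?_⟩
    · rw [hu, hv, (h1 i hi).1, (h1 i hi).2]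
      simp only [u, v, clear, hi, if_true]
      rfl
    · rw [hu, hv, (h2 i hi).1, (h2 i hi).2]
      simp only [u, v, x, y, clear, hi, if_false]
  · rintro ⟨h1, h2⟩
    refine ⟨⟨funext fun i => ?_, funext fun i => ?_⟩, fun i hi => ?_, fun i hi => ?_⟩
    · by_cases hi : i ∈ Finset.univ.map a.raw
      · simp only [u, clear, hi, if_true]
        exact congrArg Prod.fst (h1 i hi)
      · simp only [u, clear, hi, if_false]
        rw [h2 i hi]
    · by_cases hi : i ∈ Finset.univ.map a.raw
      · simp only [v, clear, hi, if_true]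
        exact congrArg (fun r : Round => r.2.1) (h1 i hi)
      · simp only [v, clear, hi, if_false]
        rw [h2 i hi]
    · exact ⟨congrArg (fun r : Round => r.2.2.1) (h1 i hi),
        congrArg (fun r : Round => r.2.2.2) (h1 i hi)⟩
    · simp only [x, y, clear, hi, if_false]
      rw [h2 i hi]
      exact ⟨rfl, rfl⟩

open Classical in
/-- Given what is announced, the bias of a parity of the raw key on the actual inputs `(0,0)` is at
most the probability, added up over all inputs of the rounds involved, that the CHSH condition is
violated in each of them. -/
theorem abs_sum_bitSign_le (a : Announcement N n) (χ : BitStr n) {F : (Fin N → Round) → ℝ}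
    (hF0 : ∀ c, 0 ≤ F c) (hF : RoundsNS F) :
    |∑ c, if a = announcement c a.raw ∧ ∀ j, a.raw j ∈ zeroRounds c then
        bitSign (χ ⬝ᵥ (x c ∘ a.raw)) * F c else 0| ≤
      ∑ c, if a = announcement (clear a.raw c) a.raw then
        parityBound a.raw χ c * F c else 0 := by
  -- outside of the selected rounds, both functionals fix what is announced; inside, they are the
  -- functionals of `dominates_marginal` or `dominates_bias`, depending on whether `χ` contains it
  by_cases hblank : ∀ i, i ∈ Finset.univ.map a.raw → (a.u i, a.v i, a.x i, a.y i) = 0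
  · set χ' : Fin N → Bit := Function.extend a.raw χ 0 with hχ'
    have hχ : ∀ j, χ' (a.raw j) = χ j := fun j => a.raw.injective.extend_apply χ 0 j
    let φ : Fin N → Round → ℝ := fun i r =>
      if i ∈ Finset.univ.map a.raw then
        (if χ' i = 0 then (if r.1 = 0 ∧ r.2.1 = 0 then 1 else 0)
          else if r.1 = 0 ∧ r.2.1 = 0 then bitSign r.2.2.1 else 0)
      else if r = (a.u i, a.v i, a.x i, a.y i) then 1 else 0
    let ψ : Fin N → Round → ℝ := fun i r =>
      if i ∈ Finset.univ.map a.raw then (if χ' i = 0 then 1 / 4 else chshViolation r)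
      else if r = (a.u i, a.v i, a.x i, a.y i) then 1 else 0
    have hdom : ∀ i, Dominates (ψ i) (φ i) := by
      intro i
      by_cases hi : i ∈ Finset.univ.map a.raw
      · by_cases h0 : χ' i = 0
        · simp only [φ, ψ, hi, h0, if_true]
          exact dominates_marginal
        · simp only [φ, ψ, hi, h0, if_true, if_false]
          exact dominates_bias
      · simp only [φ, ψ, hi, if_false]
        exact dominates_self fun r => by split_ifs <;> norm_num
    have hsplit : ∀ f : Fin N → ℝ, ∏ i, f i =
        (∏ j, f (a.raw j)) * ∏ i ∈ (Finset.univ.map a.raw)ᶜ, f i := fun f => by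
      rw [← Finset.prod_mul_prod_compl (Finset.univ.map a.raw), Finset.prod_map]
    have hmem : ∀ j, a.raw j ∈ Finset.univ.map a.raw := fun j =>
      Finset.mem_map_of_mem _ (Finset.mem_univ j)
    have hoff : ∀ c : Fin N → Round, (∏ i ∈ (Finset.univ.map a.raw)ᶜ,
        if c i = (a.u i, a.v i, a.x i, a.y i) then (1 : ℝ) else 0) =
        if a = announcement (clear a.raw c) a.raw then 1 else 0 := by
      intro c
      rw [Finset.prod_ite_zero, Finset.prod_const_one]
      have hiff := (eq_announcement_clear_iff a c).trans (and_iff_right hblank)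
      by_cases h : a = announcement (clear a.raw c) a.raw
      · rw [if_pos h, if_pos fun i hi => hiff.1 h i (Finset.mem_compl.1 hi)]
      · rw [if_neg h, if_neg fun h' => h (hiff.2 fun i hi => h' i (Finset.mem_compl.2 hi))]
    have hψ : ∀ c, ∏ i, ψ i (c i) =
        if a = announcement (clear a.raw c) a.raw then parityBound a.raw χ c else 0 := by
      intro c
      rw [hsplit]
      have h1 : ∏ i ∈ (Finset.univ.map a.raw)ᶜ, ψ i (c i) = ∏ i ∈ (Finset.univ.map a.raw)ᶜ,
          if c i = (a.u i, a.v i, a.x i, a.y i) then (1 : ℝ) else 0 :=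
        Finset.prod_congr rfl fun i hi => by
          simp only [ψ, Finset.mem_compl.1 hi, if_false]
      rw [h1, hoff, mul_ite, mul_one, mul_zero]
      simp only [ψ, hmem, if_true, hχ, parityBound]
    have hφ : ∀ c, ∏ i, φ i (c i) =
        if a = announcement c a.raw ∧ ∀ j, a.raw j ∈ zeroRounds c then
          bitSign (χ ⬝ᵥ (x c ∘ a.raw)) else 0 := by
      intro c
      rw [hsplit]
      have h1 : ∏ i ∈ (Finset.univ.map a.raw)ᶜ, φ i (c i) = ∏ i ∈ (Finset.univ.map a.raw)ᶜ,
          if c i = (a.u i, a.v i, a.x i, a.y i) then (1 : ℝ) else 0 :=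
        Finset.prod_congr rfl fun i hi => by
          simp only [φ, Finset.mem_compl.1 hi, if_false]
      have h2 : ∏ j, φ (a.raw j) (c (a.raw j)) =
          if ∀ j, a.raw j ∈ zeroRounds c then bitSign (χ ⬝ᵥ (x c ∘ a.raw)) else 0 := by
        have h3 : ∀ j, φ (a.raw j) (c (a.raw j)) =
            if a.raw j ∈ zeroRounds c then bitSign (χ j * x c (a.raw j)) else 0 := by
          intro j
          simp only [φ, hmem, if_true, hχ, zeroRounds, Finset.mem_filter, Finset.mem_univ, true_and]
          rcases bit_cases (χ j) with h | h <;> simp [h, u, v, x]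
        simp_rw [h3, Finset.prod_ite_zero, dotProduct, bitSign_sum]
        simp
      rw [h1, hoff, h2]
      have h4 : (a = announcement c a.raw ∧ ∀ j, a.raw j ∈ zeroRounds c) ↔
          (∀ j, a.raw j ∈ zeroRounds c) ∧ a = announcement (clear a.raw c) a.raw := by
        rw [and_comm]
        refine and_congr_right fun hz => ?_
        rw [eq_announcement_clear_iff, eq_announcement_iff]
        have hz' : ∀ i ∈ Finset.univ.map a.raw, u c i = 0 ∧ v c i = 0 := by
          intro i hi
          obtain ⟨j, -, rfl⟩ := Finset.mem_map.1 hi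
          exact mem_zeroRounds.1 (hz j)
        constructor
        · rintro ⟨⟨hu, hv⟩, h5, h6⟩
          refine ⟨hblank, fun i hi => ?_⟩
          rw [hu, hv, (h6 i hi).1, (h6 i hi).2]
          rfl
        · rintro ⟨-, h6⟩
          refine ⟨⟨funext fun i => ?_, funext fun i => ?_⟩, fun i hi => ?_, fun i hi => ?_⟩
          · by_cases hi : i ∈ Finset.univ.map a.raw
            · rw [(hz' i hi).1]
              exact congrArg Prod.fst (hblank i hi)
            · simp only [u, h6 i hi]
          · by_cases hi : i ∈ Finset.univ.map a.raw
            · rw [(hz' i hi).2]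
              exact congrArg (fun r : Round => r.2.1) (hblank i hi)
            · simp only [v, h6 i hi]
          · exact ⟨congrArg (fun r : Round => r.2.2.1) (hblank i hi),
              congrArg (fun r : Round => r.2.2.2) (hblank i hi)⟩
          · simp only [x, y, h6 i hi, and_self]
      simp only [h4, ite_and]
      split_ifs <;> simp
    have h := abs_sum_prod_mul_le hdom hF0 hF
    simp_rw [hφ, hψ, ite_mul, zero_mul] at h
    exact h
  -- announcements not blanked out in the selected rounds do not occur
  · have h0 : ∀ c, ¬(a = announcement c a.raw ∧ ∀ j, a.raw j ∈ zeroRounds c) := by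
      rintro c ⟨h1, h2⟩
      refine hblank fun i hi => ?_
      obtain ⟨⟨hu, hv⟩, h3, -⟩ := (eq_announcement_iff a c).1 h1
      obtain ⟨j, -, rfl⟩ := Finset.mem_map.1 hi
      rw [hu, hv, (mem_zeroRounds.1 (h2 j)).1, (mem_zeroRounds.1 (h2 j)).2, (h3 _ hi).1,
        (h3 _ hi).2]
      rfl
    simp only [h0, if_false, Finset.sum_const_zero, abs_zero]
    refine Finset.sum_nonneg fun c _ => ?_
    split_ifs
    · exact mul_nonneg (parityBound_nonneg _ _ _) (hF0 c)
    · exact le_rfl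

/-- The probability of the keys `k`, `k'` and the transcript `q`, given the inputs and outputs of
all rounds. -/
noncomputable def keyProb (D : MinDistDecoder n) (c : Fin N → Round) (q : Transcript N n s η)
    (k k' : BitStr s) : ℝ :=
  (protocolKernel η D c (q.key k k')).toReal

theorem keyProb_nonneg (D : MinDistDecoder n) (c : Fin N → Round) (q : Transcript N n s η)
    (k k' : BitStr s) : 0 ≤ keyProb D c q k k' := ENNReal.toReal_nonneg

theorem ofReal_keyProb (D : MinDistDecoder n) (c : Fin N → Round) (q : Transcript N n s η)
    (k k' : BitStr s) : ENNReal.ofReal (keyProb D c q k k') = protocolKernel η D c (q.key k k') :=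
  ENNReal.ofReal_toReal (PMF.apply_ne_top _ _)

open Classical in
theorem keyProb_eq (D : MinDistDecoder n) (c : Fin N → Round) (q : Transcript N n s η)
    (k k' : BitStr s) : keyProb D c q k k' =
      if ((q.1 = announcement c q.1.raw ∧ ∀ j, q.1.raw j ∈ zeroRounds c) ∧ q.1.Accepted η) ∧
          q.2.1.toRows₁ *ᵥ (x c ∘ q.1.raw) = q.2.2 ∧ q.2.1.toRows₂ *ᵥ (x c ∘ q.1.raw) = k ∧
          q.2.1.toRows₂ *ᵥ D.decode _ q.2.1.toRows₁ q.2.2 (y c ∘ q.1.raw) = k' then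
        (q.1.numSelections : ℝ)⁻¹ * (Fintype.card
          (Matrix (Fin (q.1.syndromeLength η) ⊕ Fin s) (Fin n) Bit) : ℝ)⁻¹ else 0 := by
  rw [keyProb, Transcript.key, protocolKernel_key, ENNReal.toReal_ofReal]
  · by_cases h : q.1 = announcement c q.1.raw
    · have : numSelections n c = q.1.numSelections := by
        rw [h, numSelections_eq]
        rfl
      rw [this]
      simp only [and_assoc]
    · simp only [h, false_and, if_false]
  · split_ifs <;> positivity

open Classical in
/-- The functional that bounds how far the key is from uniform, given the transcript `q`. -/
noncomputable def secrecyLoss (q : Transcript N n s η) (c : Fin N → Round) : ℝ :=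
  if q.1 = announcement (clear q.1.raw c) q.1.raw ∧ q.1.Accepted η then
    (q.1.numSelections : ℝ)⁻¹ * (Fintype.card
      (Matrix (Fin (q.1.syndromeLength η) ⊕ Fin s) (Fin n) Bit) : ℝ)⁻¹ *
      ((2 ^ q.1.syndromeLength η)⁻¹ *
        ∑ b : Fin (q.1.syndromeLength η) ⊕ Fin s → Bit with b ∘ Sum.inr ≠ 0,
          parityBound q.1.raw (b ᵥ* q.2.1) c)
  else 0

theorem secrecyLoss_nonneg (q : Transcript N n s η) (c : Fin N → Round) :
    0 ≤ secrecyLoss q c := by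
  unfold secrecyLoss
  split_ifs
  · exact mul_nonneg (by positivity)
      (mul_nonneg (by positivity) (Finset.sum_nonneg fun b _ => parityBound_nonneg _ _ _))
  · exact le_rfl

/-- The mass of the transcript `q` exceeds `2 ^ s` times the mass of each value of Alice's key by at
most the value of the functional `secrecyLoss`. -/
theorem sum_keyProb_le_secrecyLoss (D : MinDistDecoder n) (q : Transcript N n s η) (k₀ : BitStr s)
    {F : (Fin N → Round) → ℝ} (hF0 : ∀ c, 0 ≤ F c) (hF : RoundsNS F) :
    ∑ c, (∑ k, ∑ k', keyProb D c q k k') * F c ≤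
      2 ^ s * ∑ c, (∑ k', keyProb D c q k₀ k') * F c + ∑ c, secrecyLoss q c * F c := by
  classical
  by_cases hacc : q.1.Accepted η
  · set wt : ℝ := (q.1.numSelections : ℝ)⁻¹ * (Fintype.card
      (Matrix (Fin (q.1.syndromeLength η) ⊕ Fin s) (Fin n) Bit) : ℝ)⁻¹ with hwt
    have hwt0 : 0 ≤ wt := by positivity
    -- `p` is the weight of the values of the raw key, jointly with the announcement
    let V : (Fin N → Round) → Prop := fun c =>
      q.1 = announcement c q.1.raw ∧ ∀ j, q.1.raw j ∈ zeroRounds c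
    let p : BitStr n → ℝ := fun ξ => ∑ c, if V c ∧ x c ∘ q.1.raw = ξ then F c else 0
    have hp : ∀ g : BitStr n → ℝ, ∑ ξ, g ξ * p ξ =
        ∑ c, if V c then g (x c ∘ q.1.raw) * F c else 0 := by
      intro g
      simp_rw [p, Finset.mul_sum]
      rw [Finset.sum_comm]
      refine Finset.sum_congr rfl fun c _ => ?_
      by_cases hV : V c <;> simp [hV]
    have hk : ∀ c k, ∑ k', keyProb D c q k k' =
        if V c ∧ q.2.1.toRows₁ *ᵥ (x c ∘ q.1.raw) = q.2.2 ∧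
          q.2.1.toRows₂ *ᵥ (x c ∘ q.1.raw) = k then wt else 0 := by
      intro c k
      simp only [keyProb_eq, hacc, and_true]
      by_cases h : V c ∧ q.2.1.toRows₁ *ᵥ (x c ∘ q.1.raw) = q.2.2 ∧
          q.2.1.toRows₂ *ᵥ (x c ∘ q.1.raw) = k
      · rw [if_pos h]
        obtain ⟨h1, h2, h3⟩ := h
        rw [Finset.sum_eq_single
          (q.2.1.toRows₂ *ᵥ D.decode _ q.2.1.toRows₁ q.2.2 (y c ∘ q.1.raw))]
        · exact if_pos ⟨h1, h2, h3, rfl⟩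
        · exact fun k' _ hk' => if_neg fun h' => hk' h'.2.2.2.symm
        · exact fun h' => absurd (Finset.mem_univ _) h'
      · rw [if_neg h]
        refine Finset.sum_eq_zero fun k' _ => if_neg fun h' => h ⟨h'.1, h'.2.1, h'.2.2.1⟩
    have hkk : ∀ c, ∑ k, ∑ k', keyProb D c q k k' =
        if V c ∧ q.2.1.toRows₁ *ᵥ (x c ∘ q.1.raw) = q.2.2 then wt else 0 := by
      intro c
      simp_rw [hk]
      by_cases h : V c ∧ q.2.1.toRows₁ *ᵥ (x c ∘ q.1.raw) = q.2.2
      · rw [if_pos h, Finset.sum_eq_single (q.2.1.toRows₂ *ᵥ (x c ∘ q.1.raw))]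
        · exact if_pos ⟨h.1, h.2, rfl⟩
        · exact fun k _ hk' => if_neg fun h' => hk' h'.2.2.symm
        · exact fun h' => absurd (Finset.mem_univ _) h'
      · rw [if_neg h]
        exact Finset.sum_eq_zero fun k _ => if_neg fun h' => h ⟨h'.1, h'.2.1⟩
    have hL : ∑ c, (∑ k, ∑ k', keyProb D c q k k') * F c =
        wt * ∑ ξ, if q.2.1.toRows₁ *ᵥ ξ = q.2.2 then p ξ else 0 := by
      have := hp fun ξ => if q.2.1.toRows₁ *ᵥ ξ = q.2.2 then 1 else 0
      simp only [ite_mul, one_mul, zero_mul] at this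
      rw [this, Finset.mul_sum]
      refine Finset.sum_congr rfl fun c _ => ?_
      rw [hkk, ite_and]
      split_ifs <;> simp
    have hR : ∑ c, (∑ k', keyProb D c q k₀ k') * F c =
        wt * ∑ ξ, if q.2.1.toRows₁ *ᵥ ξ = q.2.2 ∧ q.2.1.toRows₂ *ᵥ ξ = k₀ then p ξ else 0 := by
      have := hp fun ξ =>
        if q.2.1.toRows₁ *ᵥ ξ = q.2.2 ∧ q.2.1.toRows₂ *ᵥ ξ = k₀ then 1 else 0
      simp only [ite_mul, one_mul, zero_mul] at this
      rw [this, Finset.mul_sum]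
      refine Finset.sum_congr rfl fun c _ => ?_
      rw [hk, ite_and]
      by_cases h1 : V c <;> by_cases h2 : q.2.1.toRows₁ *ᵥ (x c ∘ q.1.raw) = q.2.2 ∧
        q.2.1.toRows₂ *ᵥ (x c ∘ q.1.raw) = k₀ <;> simp [h1, h2]
    have hfour := sum_sub_pow_mul_sum_le p q.2.1 q.2.2 k₀
    have hloss : ∑ c, secrecyLoss q c * F c = wt * ((2 ^ q.1.syndromeLength η)⁻¹ *
        ∑ b : Fin (q.1.syndromeLength η) ⊕ Fin s → Bit with b ∘ Sum.inr ≠ 0,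
          ∑ c, if q.1 = announcement (clear q.1.raw c) q.1.raw then
            parityBound q.1.raw (b ᵥ* q.2.1) c * F c else 0) := by
      rw [Finset.sum_comm, Finset.mul_sum, Finset.mul_sum]
      refine Finset.sum_congr rfl fun c _ => ?_
      simp only [secrecyLoss, hacc, and_true]
      split_ifs
      · rw [← Finset.sum_mul]
        ring
      · simp
    have hb : ∀ b : Fin (q.1.syndromeLength η) ⊕ Fin s → Bit,
        |∑ ξ, bitSign ((b ᵥ* q.2.1) ⬝ᵥ ξ) * p ξ| ≤
          ∑ c, if q.1 = announcement (clear q.1.raw c) q.1.raw then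
            parityBound q.1.raw (b ᵥ* q.2.1) c * F c else 0 := by
      intro b
      rw [hp fun ξ => bitSign ((b ᵥ* q.2.1) ⬝ᵥ ξ)]
      exact abs_sum_bitSign_le q.1 (b ᵥ* q.2.1) hF0 hF
    rw [hL, hR, hloss]
    simp only [Fintype.card_fin] at hfour
    have h2 := mul_le_mul_of_nonneg_left (hfour.trans (mul_le_mul_of_nonneg_left
      (Finset.sum_le_sum fun b _ => hb b) (by positivity))) hwt0
    linarith
  · have h0 : ∀ c k k', keyProb D c q k k' = 0 := fun c k k' => by
      rw [keyProb_eq, if_neg (fun h => hacc h.1.2)]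
    simp only [h0, Finset.sum_const_zero, zero_mul, mul_zero, zero_add]
    exact Finset.sum_nonneg fun c _ => mul_nonneg (secrecyLoss_nonneg q c) (hF0 c)

end

/-! ### Sums over transcripts -/

/-- As there are only finitely many announcements, sums over transcripts are finite sums. -/
noncomputable instance (N n : ℕ) : Fintype (Announcement N n) :=
  Fintype.ofInjective (fun a => (a.u, a.v, a.raw, a.x, a.y)) fun a b h => by
    cases a
    cases b
    simpa using h

section

variable {N n s : ℕ} {η : ℝ}

open Classical in
/-- Given the inputs and outputs of all rounds, announcements are determined by the selection. -/
theorem sum_announcement_eq (m : (Fin n ↪ Fin N) → Announcement N n) (hm : ∀ e, (m e).raw = e)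
    (f : Announcement N n → ℝ) :
    ∑ a, (if a = m a.raw then f a else 0) = ∑ e, f (m e) := by
  rw [← Finset.sum_filter]
  refine Finset.sum_bij' (fun a _ => a.raw) (fun e _ => m e) ?_ ?_ ?_ ?_ ?_
  · simp
  · intro e _
    simp [hm]
  · intro a ha
    exact (Finset.mem_filter.1 ha).2.symm
  · intro e _
    exact hm e
  · intro a ha
    rw [← (Finset.mem_filter.1 ha).2]

theorem sum_transcript (f : Transcript N n s η → ℝ) :
    ∑ q, f q = ∑ a : Announcement N n,
      ∑ A : Matrix (Fin (a.syndromeLength η) ⊕ Fin s) (Fin n) Bit,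
        ∑ r : BitStr (a.syndromeLength η), f ⟨a, A, r⟩ := by
  rw [Fintype.sum_sigma]
  exact Finset.sum_congr rfl fun a _ => Fintype.sum_prod_type _

/-- The number of matrices that can be chosen after the announcement. -/
noncomputable def Announcement.numMatrices (s : ℕ) (η : ℝ) (a : Announcement N n) : ℕ :=
  Fintype.card (Matrix (Fin (a.syndromeLength η) ⊕ Fin s) (Fin n) Bit)

theorem Announcement.numMatrices_pos (s : ℕ) (η : ℝ) (a : Announcement N n) :
    0 < a.numMatrices s η := Fintype.card_pos

theorem card_raw (e : Fin n ↪ Fin N) : (Finset.univ.map e).card = n := by simp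

theorem Announcement.card_testRounds (a : Announcement N n) :
    a.testRounds.card = N - n := by
  rw [testRounds, Finset.card_compl, card_raw, Fintype.card_fin]

theorem zeroTestRounds_announcement (c : Fin N → Round) (e : Fin n ↪ Fin N) :
    (announcement c e).zeroTestRounds = zeroRounds c \ Finset.univ.map e := by
  ext i
  rw [Announcement.zeroTestRounds, Finset.mem_filter, Announcement.testRounds, Finset.mem_compl,
    Finset.mem_sdiff, mem_zeroRounds]
  exact and_comm

theorem card_zeroTestRounds_announcement {c : Fin N → Round} {e : Fin n ↪ Fin N}
    (he : ∀ j, e j ∈ zeroRounds c) :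
    (announcement c e).zeroTestRounds.card + n = (zeroRounds c).card := by
  rw [zeroTestRounds_announcement]
  have hsub : Finset.univ.map e ⊆ zeroRounds c := by
    intro i hi
    obtain ⟨j, -, rfl⟩ := Finset.mem_map.1 hi
    exact he j
  have := Finset.card_sdiff_add_card_eq_card hsub
  rwa [card_raw] at this

open Classical in
/-- Averaging over the protocol's random choices, given the inputs and outputs of all rounds. -/
theorem sum_keyProb_mul (D : MinDistDecoder n) (c : Fin N → Round)
    (f : Announcement N n → BitStr s → BitStr s → ℝ) :
    ∑ q : Transcript N n s η, ∑ k, ∑ k', keyProb D c q k k' * f q.1 k k' =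
      (numSelections n c : ℝ)⁻¹ * ∑ e : Fin n ↪ Fin N with ∀ j, e j ∈ zeroRounds c,
        if (announcement c e).Accepted η then
          ((announcement c e).numMatrices s η : ℝ)⁻¹ *
            ∑ A : Matrix (Fin ((announcement c e).syndromeLength η) ⊕ Fin s) (Fin n) Bit,
              f (announcement c e) (A.toRows₂ *ᵥ (x c ∘ e))
                (A.toRows₂ *ᵥ D.decode _ A.toRows₁ (A.toRows₁ *ᵥ (x c ∘ e)) (y c ∘ e))
        else 0 := by
  rw [sum_transcript]
  have h1 : ∀ a : Announcement N n,
      ∑ A : Matrix (Fin (a.syndromeLength η) ⊕ Fin s) (Fin n) Bit,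
        ∑ r : BitStr (a.syndromeLength η), ∑ k, ∑ k', keyProb D c ⟨a, A, r⟩ k k' * f a k k' =
      if a = announcement c a.raw then
        if ∀ j, a.raw j ∈ zeroRounds c then
          if a.Accepted η then (numSelections n c : ℝ)⁻¹ * ((a.numMatrices s η : ℝ)⁻¹ *
            ∑ A : Matrix (Fin (a.syndromeLength η) ⊕ Fin s) (Fin n) Bit,
              f a (A.toRows₂ *ᵥ (x c ∘ a.raw))
                (A.toRows₂ *ᵥ D.decode _ A.toRows₁ (A.toRows₁ *ᵥ (x c ∘ a.raw)) (y c ∘ a.raw)))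
          else 0
        else 0
      else 0 := by
    intro a
    by_cases hV : (a = announcement c a.raw ∧ ∀ j, a.raw j ∈ zeroRounds c) ∧ a.Accepted η
    · rw [if_pos hV.1.1, if_pos hV.1.2, if_pos hV.2, Finset.mul_sum, Finset.mul_sum]
      refine Finset.sum_congr rfl fun A _ => ?_
      have hnum : numSelections n c = a.numSelections := by
        rw [hV.1.1, numSelections_eq]
        rfl
      rw [Finset.sum_eq_single (A.toRows₁ *ᵥ (x c ∘ a.raw)),
        Finset.sum_eq_single (A.toRows₂ *ᵥ (x c ∘ a.raw)),
        Finset.sum_eq_single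
          (A.toRows₂ *ᵥ D.decode _ A.toRows₁ (A.toRows₁ *ᵥ (x c ∘ a.raw)) (y c ∘ a.raw)),
        keyProb_eq, if_pos ⟨hV, rfl, rfl, rfl⟩, hnum, mul_assoc]
      · rfl
      · intro k' _ hk'
        rw [keyProb_eq, if_neg fun h => hk' h.2.2.2.symm, zero_mul]
      · exact fun h' => absurd (Finset.mem_univ _) h'
      · intro k _ hk
        refine Finset.sum_eq_zero fun k' _ => ?_
        rw [keyProb_eq, if_neg fun h => hk h.2.2.1.symm, zero_mul]
      · exact fun h' => absurd (Finset.mem_univ _) h'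
      · intro r _ hr
        refine Finset.sum_eq_zero fun k _ => Finset.sum_eq_zero fun k' _ => ?_
        rw [keyProb_eq, if_neg fun h => hr h.2.1.symm, zero_mul]
      · exact fun h' => absurd (Finset.mem_univ _) h'
    · have h0 : ∀ A r k k', keyProb D c (⟨a, A, r⟩ : Transcript N n s η) k k' = 0 :=
        fun A r k k' => by rw [keyProb_eq, if_neg fun h => hV h.1]
      simp only [h0, zero_mul, Finset.sum_const_zero]
      by_cases h2 : a = announcement c a.raw
      · by_cases h3 : ∀ j, a.raw j ∈ zeroRounds c
        · rw [if_pos h2, if_pos h3, if_neg fun h4 => hV ⟨⟨h2, h3⟩, h4⟩]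
        · rw [if_pos h2, if_neg h3]
      · rw [if_neg h2]
  simp_rw [h1]
  rw [sum_announcement_eq (fun e => announcement c e) (fun _ => rfl), Finset.mul_sum,
    Finset.sum_filter]
  refine Finset.sum_congr rfl fun e _ => ?_
  change (if ∀ j, e j ∈ zeroRounds c then _ else _) = _
  split_ifs
  · rfl
  · simp
  · rfl

theorem sum_parityBound (e : Fin n ↪ Fin N) (c : Fin N → Round) :
    ∑ χ, parityBound e χ c = (4 ^ n)⁻¹ * ∏ j, (1 + 4 * chshViolation (c (e j))) := by
  unfold parityBound
  rw [← Fintype.prod_sum (fun j (b : Bit) => if b = 0 then 1 / 4 else chshViolation (c (e j)))]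
  have h : ∀ j, ∑ b : Bit, (if b = 0 then 1 / 4 else chshViolation (c (e j))) =
      4⁻¹ * (1 + 4 * chshViolation (c (e j))) := by
    intro j
    rw [sum_bit]
    simp
    ring
  simp_rw [h]
  rw [Finset.prod_mul_distrib]
  simp

open Classical in
/-- For `b ≠ 0` and a random matrix `A`, `b A` is uniform, so averaging over `A` replaces the bounds
for the parities that occur by the mean of the bounds for all parities. -/
theorem sum_secrecyLoss_le (c : Fin N → Round) (p : Announcement N n → Prop) :
    ∑ q : Transcript N n s η, (if p q.1 then secrecyLoss q c else 0) ≤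
      ∑ e : Fin n ↪ Fin N,
        if p (announcement (clear e c) e) ∧ (announcement (clear e c) e).Accepted η then
          ((announcement (clear e c) e).numSelections : ℝ)⁻¹ * (4 ^ n)⁻¹ *
            (2 ^ s * (2 ^ (announcement (clear e c) e).syndromeLength η * (2 ^ n)⁻¹)) *
            ∏ j, (1 + 4 * chshViolation (c (e j)))
        else 0 := by
  rw [sum_transcript]
  refine le_trans ?_ (sum_announcement_eq (fun e => announcement (clear e c) e) (fun _ => rfl)
    (fun a => if p a ∧ a.Accepted η then (a.numSelections : ℝ)⁻¹ * (4 ^ n)⁻¹ *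
      (2 ^ s * (2 ^ a.syndromeLength η * (2 ^ n)⁻¹)) *
        ∏ j, (1 + 4 * chshViolation (c (a.raw j))) else 0)).le
  refine Finset.sum_le_sum fun a _ => ?_
  by_cases h : a = announcement (clear a.raw c) a.raw
  swap
  · simp [secrecyLoss, h]
  by_cases hp : p a
  swap
  · simp [hp]
  by_cases hacc : a.Accepted η
  swap
  · simp [secrecyLoss, hacc]
  have hM : (0 : ℝ) < a.numMatrices s η := by exact_mod_cast a.numMatrices_pos s η
  have hq : ∀ A r, secrecyLoss (⟨a, A, r⟩ : Transcript N n s η) c =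
      (a.numSelections : ℝ)⁻¹ * (a.numMatrices s η : ℝ)⁻¹ * ((2 ^ a.syndromeLength η)⁻¹ *
        ∑ b : Fin (a.syndromeLength η) ⊕ Fin s → Bit with b ∘ Sum.inr ≠ 0,
          parityBound a.raw (b ᵥ* A) c) := fun A r => if_pos ⟨h, hacc⟩
  rw [if_pos h, if_pos ⟨hp, hacc⟩]
  simp only [hp, if_true, hq]
  simp only [Finset.sum_const, Finset.card_univ, Fintype.card_pi, ZMod.card, Finset.prod_const,
    Fintype.card_fin, nsmul_eq_mul, Nat.cast_pow, Nat.cast_ofNat]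
  rw [← Finset.mul_sum, ← Finset.mul_sum, ← Finset.mul_sum, Finset.sum_comm]
  have hb : ∀ b : Fin (a.syndromeLength η) ⊕ Fin s → Bit, b ∘ Sum.inr ≠ 0 →
      ∑ A : Matrix (Fin (a.syndromeLength η) ⊕ Fin s) (Fin n) Bit,
        parityBound a.raw (b ᵥ* A) c = (2 ^ n)⁻¹ * (a.numMatrices s η *
          ((4 ^ n)⁻¹ * ∏ j, (1 + 4 * chshViolation (c (a.raw j))))) := by
    intro b hb
    have hb0 : b ≠ 0 := fun h => hb (by rw [h]; rfl)
    have := sum_vecMul_eq hb0 (fun χ => parityBound a.raw χ c)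
    rw [sum_parityBound, Fintype.card_fin] at this
    rw [eq_inv_mul_iff_mul_eq₀ (by positivity), this]
    rfl
  rw [Finset.sum_congr rfl fun b hb' => hb b (Finset.mem_filter.1 hb').2, Finset.sum_const,
    nsmul_eq_mul]
  have hcard : ((Finset.univ.filter fun b : Fin (a.syndromeLength η) ⊕ Fin s → Bit =>
      b ∘ Sum.inr ≠ 0).card : ℝ) ≤ 2 ^ a.syndromeLength η * 2 ^ s := by
    have := Finset.card_filter_le (Finset.univ : Finset (Fin (a.syndromeLength η) ⊕ Fin s → Bit))
      fun b => b ∘ Sum.inr ≠ 0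
    simp only [Finset.card_univ, Fintype.card_pi, ZMod.card, Finset.prod_const, Fintype.card_sum,
      Fintype.card_fin, pow_add] at this
    exact_mod_cast this
  have hprod : 0 ≤ ∏ j, (1 + 4 * chshViolation (c (a.raw j))) :=
    Finset.prod_nonneg fun j _ => by have := chshViolation_nonneg (c (a.raw j)); positivity
  set Pr := ∏ j, (1 + 4 * chshViolation (c (a.raw j))) with hPr
  calc _ ≤ (2 : ℝ) ^ a.syndromeLength η * ((a.numSelections : ℝ)⁻¹ * (a.numMatrices s η : ℝ)⁻¹ *
        ((2 ^ a.syndromeLength η)⁻¹ * ((2 ^ a.syndromeLength η * 2 ^ s) *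
          ((2 ^ n)⁻¹ * (a.numMatrices s η * ((4 ^ n)⁻¹ * Pr)))))) := by gcongr
    _ = _ := by field_simp

end

/-! ### The secrecy of the key -/

section

variable {N n s : ℕ} {η : ℝ}

theorem Announcement.chshErrorRate_nonneg (a : Announcement N n) : 0 ≤ a.chshErrorRate := by
  unfold Announcement.chshErrorRate
  positivity

theorem Announcement.keyErrorRate_nonneg (a : Announcement N n) : 0 ≤ a.keyErrorRate := by
  unfold Announcement.keyErrorRate
  positivity

theorem binEntropyBits_nonneg {p : ℝ} (h0 : 0 ≤ p) (h1 : p ≤ 1) : 0 ≤ binEntropyBits p :=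
  div_nonneg (Real.binEntropy_nonneg h0 h1) (Real.log_nonneg one_le_two)

theorem Announcement.deltaEst_nonneg (a : Announcement N n) (hη : 0 ≤ η) : 0 ≤ a.deltaEst η :=
  add_nonneg a.keyErrorRate_nonneg hη

/-- For accepted parameters, the information that Eve may have about the raw key, as measured by
`1 + 4 ε`, leaves room for revealing the syndrome. -/
theorem two_pow_syndromeLength_mul_le {a : Announcement N n} (hη : 0 ≤ η) (ha : a.Accepted η) :
    (2 : ℝ) ^ a.syndromeLength η * (1 + 4 * a.epsEst η) ^ n ≤ 2 * 2 ^ n := by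
  obtain ⟨-, -, hδ, hε⟩ := ha
  have hδ0 := a.deltaEst_nonneg hη
  have hε0 : 0 ≤ a.epsEst η := add_nonneg a.chshErrorRate_nonneg hη
  set h := binEntropyBits (a.deltaEst η) with hh
  have hh0 : 0 ≤ h := binEntropyBits_nonneg hδ0 (by linarith)
  have hm : (a.syndromeLength η : ℝ) ≤ n * h + 1 :=
    (Nat.ceil_lt_add_one (mul_nonneg n.cast_nonneg hh0)).le
  have h1 : (2 : ℝ) ^ a.syndromeLength η ≤ 2 * (2 ^ h) ^ n := by
    rw [← Real.rpow_natCast, ← Real.rpow_natCast, ← Real.rpow_mul zero_le_two]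
    refine (Real.rpow_le_rpow_of_exponent_le one_le_two hm).trans_eq ?_
    rw [Real.rpow_add zero_lt_two, Real.rpow_one, mul_comm, mul_comm h]
  have h2 : 1 + 4 * a.epsEst η ≤ 2 * (2 ^ h)⁻¹ := by
    rw [Real.rpow_sub zero_lt_two, Real.rpow_neg zero_le_two, Real.rpow_one] at hε
    linarith
  have hpos : (0 : ℝ) < 2 ^ h := Real.rpow_pos_of_pos zero_lt_two _
  calc _ ≤ 2 * ((2 : ℝ) ^ h) ^ n * (2 * ((2 : ℝ) ^ h)⁻¹) ^ n := by gcongr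
    _ = _ := by
      rw [mul_assoc, ← mul_pow]
      congr 2
      field_simp

/-- The rounds in which the CHSH condition is violated. -/
def violatedRounds (c : Fin N → Round) : Finset (Fin N) :=
  Finset.univ.filter fun i => x c i + y c i ≠ u c i * v c i

theorem chshViolation_eq (c : Fin N → Round) (i : Fin N) :
    chshViolation (c i) = if i ∈ violatedRounds c then 1 else 0 := by
  unfold chshViolation
  refine if_congr ?_ rfl rfl
  rw [violatedRounds, Finset.mem_filter, and_iff_right (Finset.mem_univ i)]
  rfl

/-- All but `n` of the rounds are test rounds, so the measured error rate cannot be much smaller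
than the error rate in all rounds. -/
theorem card_violatedRounds_le (c : Fin N → Round) (e : Fin n ↪ Fin N) :
    ((violatedRounds c).card : ℝ) ≤
      n + (announcement (clear e c) e).chshErrorRate * (N - n : ℕ) := by
  set a := announcement (clear e c) e with ha
  have hsub : violatedRounds c ⊆ Finset.univ.map e ∪
      a.testRounds.filter fun i => a.x i + a.y i ≠ a.u i * a.v i := by
    intro i hi
    by_cases hie : i ∈ Finset.univ.map e
    · exact Finset.mem_union_left _ hie
    · refine Finset.mem_union_right _ (Finset.mem_filter.2 ⟨Finset.mem_compl.2 hie, ?_⟩)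
      have := (Finset.mem_filter.1 hi).2
      simp only [ha, announcement, announce, x, y, u, v, clear, hie, if_false] at this ⊢
      exact this
  have hcard := (Finset.card_le_card hsub).trans (Finset.card_union_le _ _)
  rw [card_raw] at hcard
  have hle : ((a.testRounds.filter fun i => a.x i + a.y i ≠ a.u i * a.v i).card : ℝ) ≤
      a.chshErrorRate * (N - n : ℕ) := by
    rw [Announcement.chshErrorRate, ← a.card_testRounds]
    by_cases h0 : a.testRounds.card = 0
    · have : (a.testRounds.filter fun i => a.x i + a.y i ≠ a.u i * a.v i).card = 0 :=
        Nat.le_zero.1 (h0 ▸ Finset.card_filter_le _ _)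
      rw [this, h0]
      simp
    · rw [div_mul_cancel₀]
      exact_mod_cast h0
  have : ((violatedRounds c).card : ℝ) ≤ n +
      (a.testRounds.filter fun i => a.x i + a.y i ≠ a.u i * a.v i).card := by exact_mod_cast hcard
  linarith

/-- If the test rounds sufficiently outnumber the raw rounds, half of the tolerance `η` absorbs the
violations in the raw rounds. -/
theorem violation_rate_le_epsEst {κ : ℕ} (hN : N = n + κ * n) (hn : 0 < n) (hκ : 2 ≤ κ * η)
    (c : Fin N → Round) (e : Fin n ↪ Fin N) :
    ((violatedRounds c).card : ℝ) / N + η / 2 ≤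
      (announcement (clear e c) e).epsEst η := by
  have hn' : (0 : ℝ) < n := by exact_mod_cast hn
  have hκ0 : (0 : ℝ) ≤ κ := κ.cast_nonneg
  have h1 := card_violatedRounds_le c e
  have hnn := (announcement (clear e c) e).chshErrorRate_nonneg
  rw [show N - n = κ * n by omega] at h1
  set r := (announcement (clear e c) e).chshErrorRate with hr
  have hη : 0 < η := by
    by_contra h
    nlinarith
  have h2 : ((violatedRounds c).card : ℝ) ≤ (r + η / 2) * (n + κ * n) := by
    push_cast at h1
    nlinarith [mul_nonneg hnn hn'.le, mul_pos hη hn']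
  rw [Announcement.epsEst, ← hr]
  have h3 : ((violatedRounds c).card : ℝ) / N ≤ r + η / 2 := by
    have hN' : (N : ℝ) = n + κ * n := by rw [hN]; push_cast; ring
    rw [hN', div_le_iff₀ (by positivity)]
    exact h2
  linarith

/-- The probability of each selection is small: with `z` test rounds with input `(0,0)`, there are
`z + n` rounds to select from, hence at least `z ^ n` selections. -/
theorem Announcement.card_zeroTestRounds_pow_le (c : Fin N → Round) (e : Fin n ↪ Fin N) :
    (announcement (clear e c) e).zeroTestRounds.card ^ n ≤
      (announcement (clear e c) e).numSelections := by
  have hz : ∀ j, e j ∈ zeroRounds (clear e c) := by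
    intro j
    simp [mem_zeroRounds, Rounds.u, Rounds.v, Rounds.clear]
  have h1 := card_zeroTestRounds_announcement hz
  have h2 := sub_pow_le_card_embeddings (zeroRounds (clear e c)) n
  rw [← h1, Nat.add_sub_cancel] at h2
  refine h2.trans_eq ?_
  simp only [mem_zeroRounds]
  rfl

/-- The announcement shows enough test rounds with input `(0,0)`: up to the factor `θ`, a quarter
of all rounds. -/
def Announcement.ManyZeroRounds (θ : ℝ) (a : Announcement N n) : Prop :=
  (N : ℝ) ≤ 4 * θ * a.zeroTestRounds.card

open Classical in
/-- Privacy amplification succeeds on average over the transcripts, whatever the inputs and outputs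
`c` of all rounds are. -/
theorem sum_secrecyLoss_le_of_manyZeroRounds {κ : ℕ} {θ : ℝ} (hN : N = n + κ * n) (hn : 0 < n)
    (hη : 0 < η) (hκ : 2 ≤ κ * η) (hθ : 0 ≤ θ) (c : Fin N → Round) :
    ∑ q : Transcript N n s η,
        (if q.1.ManyZeroRounds θ then secrecyLoss q c else 0) ≤
      2 ^ s * (2 * (θ / (1 + 2 * η / 5)) ^ n) := by
  have hN0 : 0 < N := by omega
  have hN' : (0 : ℝ) < N := by exact_mod_cast hN0
  set K := ((violatedRounds c).card : ℝ) / N with hK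
  have hK0 : 0 ≤ K := by positivity
  have hK1 : K ≤ 1 := by
    rw [hK, div_le_one hN']
    have := Finset.card_le_univ (violatedRounds c)
    rw [Fintype.card_fin] at this
    exact_mod_cast this
  -- a lower bound on `1 + 4 ε` for the estimated `ε`; compared with the mean `1 + 4 K`, the surplus
  -- `2 η` gains a constant factor in each raw round
  set B := 1 + 4 * K + 2 * η with hB
  have hB0 : 0 < B := by positivity
  have hprod : ∀ e : Fin n ↪ Fin N, 0 ≤ ∏ j, (1 + 4 * chshViolation (c (e j))) := fun e =>
    Finset.prod_nonneg fun j _ => by have := chshViolation_nonneg (c (e j)); positivity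
  have hterm : ∀ e : Fin n ↪ Fin N,
      (if (announcement (clear e c) e).ManyZeroRounds θ ∧
        (announcement (clear e c) e).Accepted η then
          ((announcement (clear e c) e).numSelections : ℝ)⁻¹ * (4 ^ n)⁻¹ *
            (2 ^ s * (2 ^ (announcement (clear e c) e).syndromeLength η * (2 ^ n)⁻¹)) *
            ∏ j, (1 + 4 * chshViolation (c (e j)))
        else 0) ≤ θ ^ n * ((N : ℝ) ^ n)⁻¹ * (2 ^ s * (2 * (B ^ n)⁻¹)) *
          ∏ j, (1 + 4 * chshViolation (c (e j))) := by
    intro e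
    have hp := hprod e
    split_ifs with h
    · obtain ⟨hmany, hacc⟩ := h
      set a := announcement (clear e c) e with ha
      have hz : (0 : ℝ) < a.zeroTestRounds.card := by exact_mod_cast hacc.1.card_pos
      have hsel : (a.zeroTestRounds.card : ℝ) ^ n ≤ a.numSelections := by
        exact_mod_cast Announcement.card_zeroTestRounds_pow_le c e
      have hsel0 : (0 : ℝ) < a.numSelections := lt_of_lt_of_le (by positivity) hsel
      have h1 : (a.numSelections : ℝ)⁻¹ * (4 ^ n)⁻¹ ≤ θ ^ n * ((N : ℝ) ^ n)⁻¹ := by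
        rw [← mul_inv, ← div_eq_mul_inv, inv_eq_one_div, div_le_div_iff₀ (by positivity)
          (by positivity), one_mul]
        calc (N : ℝ) ^ n ≤ (4 * θ * a.zeroTestRounds.card) ^ n := by
              gcongr
              exact hmany
          _ = θ ^ n * ((a.zeroTestRounds.card : ℝ) ^ n * 4 ^ n) := by rw [mul_pow, mul_pow]; ring
          _ ≤ _ := by gcongr
      have h2 : (2 : ℝ) ^ a.syndromeLength η * (2 ^ n)⁻¹ ≤ 2 * (B ^ n)⁻¹ := by
        have hBε : B ≤ 1 + 4 * a.epsEst η := by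
          have := violation_rate_le_epsEst hN hn hκ c e
          rw [hB, hK]
          linarith
        rw [← div_eq_mul_inv, ← div_eq_mul_inv, div_le_div_iff₀ (by positivity) (by positivity)]
        refine le_trans ?_ (two_pow_syndromeLength_mul_le hη.le hacc)
        gcongr
      gcongr
    · positivity
  refine (sum_secrecyLoss_le c (Announcement.ManyZeroRounds θ)).trans
    ((Finset.sum_le_sum fun e _ => hterm e).trans ?_)
  rw [← Finset.mul_sum]
  have hmom : ∑ e : Fin n ↪ Fin N, ∏ j, (1 + 4 * chshViolation (c (e j))) ≤
      (N : ℝ) ^ n * (1 + 4 * K) ^ n := by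
    have hne : (Finset.univ : Finset (Fin N)).Nonempty := ⟨⟨0, hN0⟩, Finset.mem_univ _⟩
    have h := sum_embeddings_prod_le (ι := Fin n) (K := violatedRounds c) hne (μ := 4) (by norm_num)
    simp only [Finset.mem_univ, implies_true, Finset.filter_true, Fintype.card_fin,
      Finset.card_univ] at h
    have hcard : ((Fintype.card (Fin n ↪ Fin N) : ℕ) : ℝ) ≤ (N : ℝ) ^ n := by
      rw [Fintype.card_embedding_eq, Fintype.card_fin, Fintype.card_fin]
      exact_mod_cast Nat.descFactorial_le_pow N n
    have heq : ∀ (e : Fin n ↪ Fin N) j, 1 + 4 * chshViolation (c (e j)) =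
        1 + if e j ∈ violatedRounds c then 4 else 0 := by
      intro e j
      rw [chshViolation_eq]
      split_ifs <;> norm_num
    simp_rw [heq]
    refine h.trans ?_
    gcongr
  calc _ ≤ θ ^ n * ((N : ℝ) ^ n)⁻¹ * (2 ^ s * (2 * (B ^ n)⁻¹)) *
        ((N : ℝ) ^ n * (1 + 4 * K) ^ n) := by gcongr
    _ = 2 ^ s * (2 * (θ * ((1 + 4 * K) / B)) ^ n) := by
        rw [mul_pow, div_pow]
        field_simp
    _ ≤ 2 ^ s * (2 * (θ / (1 + 2 * η / 5)) ^ n) := by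
        have hfrac : (1 + 4 * K) / B ≤ 1 / (1 + 2 * η / 5) := by
          rw [div_le_div_iff₀ hB0 (by positivity), hB]
          nlinarith
        rw [div_eq_mul_one_div θ]
        gcongr

end

/-! ### The correctness of the key -/

section

variable {N n s : ℕ} {η : ℝ}

/-- Decoding can only fail if a string other than Alice's has the same syndrome and is at least as
close to Bob's string. -/
theorem card_decodingError_le (D : MinDistDecoder n) (m : ℕ) (x y : BitStr n) :
    2 ^ m * ((Finset.univ.filter fun A : Matrix (Fin m ⊕ Fin s) (Fin n) Bit =>
        A.toRows₂ *ᵥ x ≠ A.toRows₂ *ᵥ D.decode _ A.toRows₁ (A.toRows₁ *ᵥ x) y).card : ℝ) ≤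
      Fintype.card (Matrix (Fin m ⊕ Fin s) (Fin n) Bit) *
        (Finset.univ.filter fun x' : BitStr n => hammingDist y x' ≤ hammingDist y x).card := by
  classical
  set S := Finset.univ.filter fun x' : BitStr n => hammingDist y x' ≤ hammingDist y x with hS
  have hsub : (Finset.univ.filter fun A : Matrix (Fin m ⊕ Fin s) (Fin n) Bit =>
        A.toRows₂ *ᵥ x ≠ A.toRows₂ *ᵥ D.decode _ A.toRows₁ (A.toRows₁ *ᵥ x) y) ⊆
      (S.filter fun x' => x' ≠ x).biUnion fun x' =>
        Finset.univ.filter fun A : Matrix (Fin m ⊕ Fin s) (Fin n) Bit =>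
          A.toRows₁ *ᵥ (x' - x) = 0 := by
    intro A hA
    have hA' := (Finset.mem_filter.1 hA).2
    refine Finset.mem_biUnion.2 ⟨D.decode _ A.toRows₁ (A.toRows₁ *ᵥ x) y, ?_, ?_⟩
    · refine Finset.mem_filter.2 ⟨Finset.mem_filter.2 ⟨Finset.mem_univ _,
        D.dist_decode_le _ _ _ _⟩, fun h => hA' ?_⟩
      rw [h]
    · refine Finset.mem_filter.2 ⟨Finset.mem_univ _, ?_⟩
      rw [Matrix.mulVec_sub, D.syndrome_decode, sub_self]
  have hcard : ((Finset.univ.filter fun A : Matrix (Fin m ⊕ Fin s) (Fin n) Bit =>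
        A.toRows₂ *ᵥ x ≠ A.toRows₂ *ᵥ D.decode _ A.toRows₁ (A.toRows₁ *ᵥ x) y).card : ℝ) ≤
      ∑ x' ∈ S.filter fun x' => x' ≠ x,
        ((Finset.univ.filter fun A : Matrix (Fin m ⊕ Fin s) (Fin n) Bit =>
          A.toRows₁ *ᵥ (x' - x) = 0).card : ℝ) := by
    exact_mod_cast (Finset.card_le_card hsub).trans Finset.card_biUnion_le
  have heach : ∀ x' ∈ S.filter fun x' => x' ≠ x,
      2 ^ m * ((Finset.univ.filter fun A : Matrix (Fin m ⊕ Fin s) (Fin n) Bit =>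
        A.toRows₁ *ᵥ (x' - x) = 0).card : ℝ) =
      Fintype.card (Matrix (Fin m ⊕ Fin s) (Fin n) Bit) := by
    intro x' hx'
    have := card_matrix_toRows₁_mulVec_eq_zero (ι := Fin m) (τ := Fin s)
      (sub_ne_zero.2 (Finset.mem_filter.1 hx').2)
    rwa [Fintype.card_fin] at this
  refine (mul_le_mul_of_nonneg_left hcard (by positivity)).trans ?_
  rw [Finset.mul_sum, Finset.sum_congr rfl heach, Finset.sum_const, nsmul_eq_mul, mul_comm]
  gcongr
  exact Finset.filter_subset _ _

/-- A syndrome of `n h(δ)` bits suffices for correcting `d < δ n` errors. -/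
theorem card_hammingBall_le_exp {δ : ℝ} (h0 : 0 < δ) (h1 : δ ≤ 1 / 2) {m : ℕ}
    (hm : n * binEntropyBits δ ≤ m) (y : BitStr n) (d : ℕ) :
    ((Finset.univ.filter fun x : BitStr n => hammingDist y x ≤ d).card : ℝ) ≤
      2 ^ m * Real.exp ((n * δ - d) * Real.log (δ / (1 - δ))) := by
  have h2 : 0 < 1 - δ := by linarith
  have ht : 0 < δ / (1 - δ) := by positivity
  have ht1 : δ / (1 - δ) ≤ 1 := by rw [div_le_one h2]; linarith
  have hball := card_hammingBall_mul_pow_le y d ht.le ht1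
  have hpow : (δ / (1 - δ)) ^ d = Real.exp (d * Real.log (δ / (1 - δ))) := by
    rw [Real.exp_nat_mul, Real.exp_log ht]
  have hsum : (1 + δ / (1 - δ)) ^ n = Real.exp (-(n * Real.log (1 - δ))) := by
    rw [← mul_neg, ← Real.log_inv, Real.exp_nat_mul, Real.exp_log (by positivity)]
    congr 1
    field_simp
    ring
  have hm' : Real.exp (n * Real.binEntropy δ) ≤ 2 ^ m := by
    have hlog : 0 < Real.log 2 := Real.log_pos one_lt_two
    rw [binEntropyBits, mul_div_assoc', div_le_iff₀ hlog] at hm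
    calc _ ≤ Real.exp (m * Real.log 2) := Real.exp_le_exp.2 hm
      _ = _ := by rw [Real.exp_nat_mul, Real.exp_log two_pos]
  rw [hpow, hsum, ← le_div_iff₀ (Real.exp_pos _), ← Real.exp_sub] at hball
  refine hball.trans ?_
  refine le_trans (le_of_eq ?_) (mul_le_mul_of_nonneg_right hm' (Real.exp_nonneg _))
  rw [← Real.exp_add]
  congr 1
  rw [Real.binEntropy, Real.log_inv, Real.log_inv, Real.log_div h0.ne' h2.ne']
  ring

/-- As the measured `ε` is at least `η`, the accepted values of `δ` stay away from `1/2`. -/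
theorem exists_log_deltaEst_le (hη : 0 < η) : ∃ l : ℝ, 0 < l ∧ ∀ (N n : ℕ) (a : Announcement N n),
    a.Accepted η → Real.log (a.deltaEst η / (1 - a.deltaEst η)) ≤ -l := by
  have hlog : 0 < Real.log (1 + 4 * η) := Real.log_pos (by linarith)
  have hcont := Real.binEntropy_continuous.continuousAt (x := 2⁻¹)
  rw [ContinuousAt, Real.binEntropy_two_inv] at hcont
  have hev := hcont.eventually (lt_mem_nhds (show Real.log 2 - Real.log (1 + 4 * η) < Real.log 2 by
    linarith))
  obtain ⟨r, hr, hball⟩ := Metric.eventually_nhds_iff.1 hev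
  refine ⟨2 * r, by positivity, fun N n a ha => ?_⟩
  obtain ⟨-, -, hδ, hε⟩ := ha
  have hε0 : η ≤ a.epsEst η := le_add_of_nonneg_left a.chshErrorRate_nonneg
  have hδ0 : 0 < a.deltaEst η := add_pos_of_nonneg_of_pos a.keyErrorRate_nonneg hη
  set δ := a.deltaEst η with hδdef
  have hent : Real.binEntropy δ ≤ Real.log 2 - Real.log (1 + 4 * η) := by
    have h2 : (1 + 4 * η) ≤ 2 * (2 : ℝ) ^ (-binEntropyBits δ) := by
      rw [Real.rpow_sub zero_lt_two, Real.rpow_one] at hε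
      linarith
    have h3 := Real.log_le_log (by positivity) h2
    rw [Real.log_mul two_ne_zero (Real.rpow_pos_of_pos two_pos _).ne', Real.log_rpow two_pos,
      binEntropyBits, neg_mul, div_mul_cancel₀ _ (Real.log_pos one_lt_two).ne'] at h3
    linarith
  have hfar : δ ≤ 1 / 2 - r := by
    by_contra hcon
    push Not at hcon
    have := hball (y := δ) (by
      rw [Real.dist_eq, abs_lt]
      constructor <;> norm_num <;> linarith)
    linarith
  have h1 : 0 < 1 - δ := by linarith
  refine (Real.log_le_sub_one_of_pos (div_pos hδ0 h1)).trans ?_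
  rw [div_sub_one h1.ne', div_le_iff₀ h1]
  nlinarith

/-- The rounds with input `(0,0)` in which the outputs differ. -/
def keyErrorRounds (c : Fin N → Round) : Finset (Fin N) :=
  (zeroRounds c).filter fun i => x c i ≠ y c i

/-- All but `n` of the rounds with input `(0,0)` are test rounds. -/
theorem card_keyErrorRounds_le (c : Fin N → Round) (e : Fin n ↪ Fin N) :
    ((keyErrorRounds c).card : ℝ) ≤
      n + (announcement c e).keyErrorRate * (announcement c e).zeroTestRounds.card := by
  set a := announcement c e with ha
  have hsub : keyErrorRounds c ⊆ Finset.univ.map e ∪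
      a.zeroTestRounds.filter fun i => a.x i ≠ a.y i := by
    intro i hi
    by_cases hie : i ∈ Finset.univ.map e
    · exact Finset.mem_union_left _ hie
    · obtain ⟨hz, hxy⟩ := Finset.mem_filter.1 hi
      refine Finset.mem_union_right _ (Finset.mem_filter.2 ⟨?_, ?_⟩)
      · rw [ha, zeroTestRounds_announcement]
        exact Finset.mem_sdiff.2 ⟨hz, hie⟩
      · simp only [ha, announcement, announce, hie, if_false]
        exact hxy
  have hcard := (Finset.card_le_card hsub).trans (Finset.card_union_le _ _)
  rw [card_raw] at hcard
  have hle : ((a.zeroTestRounds.filter fun i => a.x i ≠ a.y i).card : ℝ) ≤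
      a.keyErrorRate * a.zeroTestRounds.card := by
    rw [Announcement.keyErrorRate]
    by_cases h0 : a.zeroTestRounds.card = 0
    · have : (a.zeroTestRounds.filter fun i => a.x i ≠ a.y i).card = 0 :=
        Nat.le_zero.1 (h0 ▸ Finset.card_filter_le _ _)
      rw [this, h0]
      simp
    · rw [div_mul_cancel₀]
      exact_mod_cast h0
  have : ((keyErrorRounds c).card : ℝ) ≤ n +
      (a.zeroTestRounds.filter fun i => a.x i ≠ a.y i).card := by exact_mod_cast hcard
  linarith

/-- If the test rounds with input `(0,0)` sufficiently outnumber the raw rounds, half of the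
tolerance `η` absorbs the errors in the raw rounds. -/
theorem keyError_rate_le_deltaEst {κ : ℕ} {θ : ℝ} (hN : N = n + κ * n) (hη : 0 < η)
    (hκ : 8 * θ ≤ η * (κ + 1)) {c : Fin N → Round} {e : Fin n ↪ Fin N}
    (he : ∀ j, e j ∈ zeroRounds c) (hz : (announcement c e).zeroTestRounds.Nonempty)
    (hmany : (announcement c e).ManyZeroRounds θ) :
    ((keyErrorRounds c).card : ℝ) / (zeroRounds c).card + η / 2 ≤
      (announcement c e).deltaEst η := by
  have hcard := card_zeroTestRounds_announcement he
  have hD := card_keyErrorRounds_le c e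
  have hz' : (0 : ℝ) < (announcement c e).zeroTestRounds.card := by exact_mod_cast hz.card_pos
  have hnn := (announcement c e).keyErrorRate_nonneg
  rw [Announcement.ManyZeroRounds] at hmany
  rw [Announcement.deltaEst, ← hcard]
  set zT : ℝ := ((announcement c e).zeroTestRounds.card : ℝ) with hzT
  set r := (announcement c e).keyErrorRate with hr
  have hn0 : (0 : ℝ) ≤ n := n.cast_nonneg
  have hκ0 : (0 : ℝ) < κ + 1 := by positivity
  have hN' : (N : ℝ) = (κ + 1) * n := by rw [hN]; push_cast; ring
  have hnz : (n : ℝ) ≤ η / 2 * zT := by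
    have h1 : (κ + 1 : ℝ) * n ≤ (κ + 1) * (η / 2 * zT) := by
      rw [← hN']
      nlinarith [mul_le_mul_of_nonneg_right hκ hz'.le]
    exact le_of_mul_le_mul_left h1 hκ0
  have h3 : ((keyErrorRounds c).card : ℝ) / ((announcement c e).zeroTestRounds.card + n : ℕ) ≤
      r + η / 2 := by
    push_cast
    rw [← hzT, div_le_iff₀ (by positivity)]
    nlinarith [mul_nonneg hnn hn0, mul_nonneg hη.le hn0]
  linarith

theorem hammingDist_comp_eq {c : Fin N → Round} {e : Fin n ↪ Fin N}
    (he : ∀ j, e j ∈ zeroRounds c) :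
    hammingDist (y c ∘ e) (x c ∘ e) =
      (Finset.univ.filter fun j => e j ∈ keyErrorRounds c).card := by
  rw [hammingDist]
  congr 1
  ext j
  simp only [keyErrorRounds, Finset.mem_filter, Finset.mem_univ, true_and, he j,
    Function.comp_apply]
  exact ne_comm

open Classical in
/-- Error correction succeeds on average over the protocol's random choices, whatever the inputs and
outputs `c` of all rounds are. -/
theorem sum_keyProb_ne_le {κ : ℕ} {θ l : ℝ} (hN : N = n + κ * n) (hη : 0 < η)
    (hκ : 8 * θ ≤ η * (κ + 1)) (hl0 : 0 < l) (hl1 : l ≤ 1) (hlη : l ≤ η / 4)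
    (hl : ∀ a : Announcement N n, a.Accepted η →
      Real.log (a.deltaEst η / (1 - a.deltaEst η)) ≤ -l)
    (D : MinDistDecoder n) (c : Fin N → Round) :
    ∑ q : Transcript N n s η, (if q.1.ManyZeroRounds θ then
        ∑ k, ∑ k', if k ≠ k' then keyProb D c q k k' else 0 else 0) ≤
      Real.exp (-(l * η / 4) * n) := by
  have h1 := sum_keyProb_mul (s := s) (η := η) D c
    fun a k k' => if a.ManyZeroRounds θ ∧ k ≠ k' then 1 else 0
  have h2 : ∑ q : Transcript N n s η, (if q.1.ManyZeroRounds θ then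
        ∑ k, ∑ k', if k ≠ k' then keyProb D c q k k' else 0 else 0) =
      ∑ q : Transcript N n s η, ∑ k, ∑ k', keyProb D c q k k' *
        if q.1.ManyZeroRounds θ ∧ k ≠ k' then 1 else 0 := by
    refine Finset.sum_congr rfl fun q _ => ?_
    split_ifs with h <;> simp [h]
  rw [h2, h1]
  set E := Finset.univ.filter fun e : Fin n ↪ Fin N => ∀ j, e j ∈ zeroRounds c with hE
  rcases E.eq_empty_or_nonempty with h0 | hne
  · rw [h0, Finset.sum_empty, mul_zero]
    positivity
  have hE0 : (0 : ℝ) < numSelections n c := by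
    rw [numSelections, ← hE]
    exact_mod_cast hne.card_pos
  set p := ((keyErrorRounds c).card : ℝ) / (zeroRounds c).card with hp
  have hp0 : 0 ≤ p := by positivity
  have hp1 : p ≤ 1 := by
    refine div_le_one_of_le₀ ?_ (by positivity)
    exact_mod_cast Finset.card_filter_le _ _
  have hterm : ∀ e ∈ E, (if (announcement c e).Accepted η then
          ((announcement c e).numMatrices s η : ℝ)⁻¹ *
            ∑ A : Matrix (Fin ((announcement c e).syndromeLength η) ⊕ Fin s) (Fin n) Bit,
              (if (announcement c e).ManyZeroRounds θ ∧ A.toRows₂ *ᵥ (x c ∘ e) ≠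
                A.toRows₂ *ᵥ D.decode _ A.toRows₁ (A.toRows₁ *ᵥ (x c ∘ e)) (y c ∘ e)
                then 1 else 0)
        else 0) ≤ Real.exp (-(l * (p + η / 2)) * n) *
          ∏ j, (1 + if e j ∈ keyErrorRounds c then Real.exp l - 1 else 0) := by
    intro e he
    have hez := (Finset.mem_filter.1 he).2
    have hprod : ∏ j, (1 + if e j ∈ keyErrorRounds c then Real.exp l - 1 else 0) =
        Real.exp (l * hammingDist (y c ∘ e) (x c ∘ e)) := by
      rw [hammingDist_comp_eq hez, Finset.card_filter, Nat.cast_sum, Finset.mul_sum, Real.exp_sum]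
      refine Finset.prod_congr rfl fun j _ => ?_
      split_ifs <;> simp
    rw [hprod, ← Real.exp_add]
    by_cases hacc : (announcement c e).Accepted η
    swap
    · rw [if_neg hacc]
      positivity
    by_cases hmany : (announcement c e).ManyZeroRounds θ
    swap
    · simp only [hmany, false_and, if_false, Finset.sum_const_zero, mul_zero, ite_self]
      positivity
    rw [if_pos hacc]
    simp only [hmany, true_and]
    rw [Finset.sum_boole]
    set a := announcement c e with ha
    have hM : (0 : ℝ) < a.numMatrices s η := by exact_mod_cast a.numMatrices_pos s η
    have hδ := keyError_rate_le_deltaEst hN hη hκ hez hacc.1 hmany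
    have hδ0 : 0 < a.deltaEst η := add_pos_of_nonneg_of_pos a.keyErrorRate_nonneg hη
    set d := hammingDist (y c ∘ e) (x c ∘ e) with hd
    have hexp : Real.exp (-(l * (n * a.deltaEst η - d))) ≤
        Real.exp (-(l * (p + η / 2)) * n + l * d) := by
      refine Real.exp_le_exp.2 ?_
      have := mul_le_mul_of_nonneg_left hδ (mul_nonneg hl0.le (n.cast_nonneg (α := ℝ)))
      linarith
    refine le_trans ?_ hexp
    rw [inv_mul_le_iff₀ hM]
    -- if there are more than `δ n` errors, the claimed bound exceeds `1`
    by_cases hdn : (d : ℝ) ≤ n * a.deltaEst η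
    · have h3 := card_decodingError_le (s := s) D (a.syndromeLength η) (x c ∘ e) (y c ∘ e)
      have h4 := card_hammingBall_le_exp hδ0 hacc.2.2.1.le (Nat.le_ceil _) (y c ∘ e) d
      have h5 : Real.exp ((n * a.deltaEst η - d) *
          Real.log (a.deltaEst η / (1 - a.deltaEst η))) ≤
          Real.exp (-(l * (n * a.deltaEst η - d))) := by
        refine Real.exp_le_exp.2 ?_
        have := mul_le_mul_of_nonneg_left (hl a hacc) (sub_nonneg.2 hdn)
        linarith
      have h6 := h3.trans (mul_le_mul_of_nonneg_left
        (h4.trans (mul_le_mul_of_nonneg_left h5 (by positivity))) (by positivity))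
      rw [mul_left_comm] at h6
      exact le_of_mul_le_mul_left h6 (by positivity)
    · refine le_trans ?_ (le_mul_of_one_le_right hM.le (Real.one_le_exp ?_))
      · exact_mod_cast Finset.card_le_univ _
      · nlinarith
  have hsample := sum_embeddings_prod_le (ι := Fin n) (K := keyErrorRounds c) (Z := zeroRounds c)
    (μ := Real.exp l - 1)
  rw [inv_mul_le_iff₀ hE0]
  refine (Finset.sum_le_sum hterm).trans ?_
  rw [← Finset.mul_sum]
  rcases (zeroRounds c).eq_empty_or_nonempty with hZ | hZ
  · have hn0 : n = 0 := by
      by_contra hn0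
      obtain ⟨e, he⟩ := hne
      have := (Finset.mem_filter.1 he).2 ⟨0, Nat.pos_of_ne_zero hn0⟩
      rw [hZ] at this
      exact absurd this (Finset.notMem_empty _)
    subst hn0
    simp [numSelections, hE]
  have h7 := hsample hZ (by linarith [Real.add_one_le_exp l])
  rw [← hp, Fintype.card_fin] at h7
  have h7' : ∑ e ∈ E, ∏ j, (1 + if e j ∈ keyErrorRounds c then Real.exp l - 1 else 0) ≤
      numSelections n c * (1 + (Real.exp l - 1) * p) ^ n := by
    rw [numSelections]
    convert h7
  have h8 : (1 + (Real.exp l - 1) * p) ^ n ≤ Real.exp ((l * p + l ^ 2) * n) := by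
    rw [mul_comm (l * p + l ^ 2), Real.exp_nat_mul]
    refine pow_le_pow_left₀ ?_ ?_ n
    · have := mul_nonneg (sub_nonneg.2 (Real.one_le_exp hl0.le)) hp0
      linarith
    · rw [mul_comm]
      exact one_add_mul_exp_sub_one_le hp0 hp1 (by rw [abs_of_pos hl0]; exact hl1)
  calc _ ≤ Real.exp (-(l * (p + η / 2)) * n) *
        (numSelections n c * Real.exp ((l * p + l ^ 2) * n)) := by
        gcongr
        exact h7'.trans (mul_le_mul_of_nonneg_left h8 hE0.le)
    _ = numSelections n c * Real.exp ((l ^ 2 - l * η / 2) * n) := by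
        rw [mul_left_comm, ← Real.exp_add]
        congr 2
        ring
    _ ≤ _ := by
        gcongr
        nlinarith

open Classical in
/-- Whether there are many test rounds with input `(0,0)` does not depend on which of the rounds are
selected. -/
theorem sum_keyProb_not_manyZeroRounds_le {θ : ℝ} (D : MinDistDecoder n) (c : Fin N → Round) :
    ∑ q : Transcript N n s η, (if q.1.ManyZeroRounds θ then 0 else
        ∑ k, ∑ k', keyProb D c q k k') ≤
      if (N : ℝ) ≤ 4 * θ * ((zeroRounds c).card - n) then 0 else 1 := by
  have h1 := sum_keyProb_mul (s := s) (η := η) D c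
    fun a _ _ => if a.ManyZeroRounds θ then 0 else 1
  have h2 : ∑ q : Transcript N n s η, (if q.1.ManyZeroRounds θ then 0 else
        ∑ k, ∑ k', keyProb D c q k k') =
      ∑ q : Transcript N n s η, ∑ k, ∑ k', keyProb D c q k k' *
        if q.1.ManyZeroRounds θ then 0 else 1 := by
    refine Finset.sum_congr rfl fun q _ => ?_
    split_ifs with h <;> simp
  rw [h2, h1]
  have hterm : ∀ e ∈ Finset.univ.filter (fun e : Fin n ↪ Fin N => ∀ j, e j ∈ zeroRounds c),
      (if (announcement c e).Accepted η then
          ((announcement c e).numMatrices s η : ℝ)⁻¹ *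
            ∑ _A : Matrix (Fin ((announcement c e).syndromeLength η) ⊕ Fin s) (Fin n) Bit,
              (if (announcement c e).ManyZeroRounds θ then (0 : ℝ) else 1)
        else 0) ≤ if (N : ℝ) ≤ 4 * θ * ((zeroRounds c).card - n) then 0 else 1 := by
    intro e he
    have hez := (Finset.mem_filter.1 he).2
    have hcard := card_zeroTestRounds_announcement hez
    have hiff : (announcement c e).ManyZeroRounds θ ↔
        (N : ℝ) ≤ 4 * θ * ((zeroRounds c).card - n) := by
      rw [← hcard, Announcement.ManyZeroRounds]
      push_cast
      rw [add_sub_cancel_right]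
    simp only [hiff]
    by_cases hmany : (N : ℝ) ≤ 4 * θ * ((zeroRounds c).card - n)
    · simp [hmany]
    · have hM : (0 : ℝ) < (announcement c e).numMatrices s η := by
        exact_mod_cast (announcement c e).numMatrices_pos s η
      simp only [hmany, if_false]
      split_ifs
      · rw [Finset.sum_const, nsmul_eq_mul, mul_one]
        exact (inv_mul_cancel₀ hM.ne').le
      · exact zero_le_one
  refine (mul_le_mul_of_nonneg_left (Finset.sum_le_sum hterm) (by positivity)).trans ?_
  rw [Finset.sum_const, nsmul_eq_mul, ← mul_assoc]
  refine mul_le_of_le_one_left (by split_ifs <;> norm_num) ?_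
  exact inv_mul_le_one

end

/-! ### Security of the protocol -/

section

variable {N n s : ℕ} {η θ : ℝ}

open Classical in
/-- The functional that bounds the part of the transcript `q` lost to the failure event. -/
noncomputable def transcriptLoss (θ : ℝ) (D : MinDistDecoder n) (q : Transcript N n s η)
    (c : Fin N → Round) : ℝ :=
  (if q.1.ManyZeroRounds θ then secrecyLoss q c else 0) +
    2 ^ s * (if q.1.ManyZeroRounds θ then
      ∑ k, ∑ k', if k ≠ k' then keyProb D c q k k' else 0 else 0) +
    (if q.1.ManyZeroRounds θ then 0 else ∑ k, ∑ k', keyProb D c q k k')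

theorem sum_keyProb_ne_nonneg (D : MinDistDecoder n) (q : Transcript N n s η)
    (c : Fin N → Round) : 0 ≤ ∑ k, ∑ k', if k ≠ k' then keyProb D c q k k' else 0 :=
  Finset.sum_nonneg fun k _ => Finset.sum_nonneg fun k' _ => by
    split_ifs
    exacts [keyProb_nonneg _ _ _ _ _, le_rfl]

theorem sum_keyProb_nonneg (D : MinDistDecoder n) (q : Transcript N n s η)
    (c : Fin N → Round) : 0 ≤ ∑ k, ∑ k', keyProb D c q k k' :=
  Finset.sum_nonneg fun _ _ => Finset.sum_nonneg fun _ _ => keyProb_nonneg _ _ _ _ _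

theorem transcriptLoss_nonneg (D : MinDistDecoder n) (q : Transcript N n s η)
    (c : Fin N → Round) : 0 ≤ transcriptLoss θ D q c := by
  refine add_nonneg (add_nonneg ?_ (mul_nonneg (pow_nonneg zero_le_two s) ?_)) ?_
  · split_ifs
    exacts [secrecyLoss_nonneg q c, le_rfl]
  · split_ifs
    exacts [sum_keyProb_ne_nonneg D q c, le_rfl]
  · split_ifs
    exacts [le_rfl, sum_keyProb_nonneg D q c]

/-- The hypothesis of `secureExcept_of_bound`, for fixed input and output of Eve: besides the loss
of secrecy, the runs with differing keys are lost, and so are all runs with few rounds `(0,0)`. -/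
theorem sum_keyProb_le_transcriptLoss (D : MinDistDecoder n) (q : Transcript N n s η)
    (k₀ : BitStr s) {F : (Fin N → Round) → ℝ} (hF0 : ∀ c, 0 ≤ F c) (hF : RoundsNS F) :
    ∑ c, (∑ k, ∑ k', keyProb D c q k k') * F c ≤
      2 ^ s * ∑ c, keyProb D c q k₀ k₀ * F c + ∑ c, transcriptLoss θ D q c * F c := by
  by_cases hmany : q.1.ManyZeroRounds θ
  · have hloss : ∀ c, transcriptLoss θ D q c = secrecyLoss q c +
        2 ^ s * ∑ k, ∑ k', if k ≠ k' then keyProb D c q k k' else 0 := by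
      intro c
      simp only [transcriptLoss, hmany, if_true, add_zero]
    have hk : ∀ c, ∑ k', keyProb D c q k₀ k' ≤
        keyProb D c q k₀ k₀ + ∑ k, ∑ k', if k ≠ k' then keyProb D c q k k' else 0 := by
      intro c
      have h1 : ∑ k', keyProb D c q k₀ k' = keyProb D c q k₀ k₀ +
          ∑ k', if k₀ ≠ k' then keyProb D c q k₀ k' else 0 := by
        rw [← Finset.sum_filter, Finset.filter_ne, Finset.add_sum_erase _ _ (Finset.mem_univ k₀)]
      rw [h1]
      refine (add_le_add_iff_left _).2 ?_
      exact Finset.single_le_sum (f := fun k => ∑ k', if k ≠ k' then keyProb D c q k k' else 0)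
        (fun k _ => Finset.sum_nonneg fun k' _ => by
          split_ifs
          exacts [keyProb_nonneg _ _ _ _ _, le_rfl]) (Finset.mem_univ k₀)
    refine (sum_keyProb_le_secrecyLoss D q k₀ hF0 hF).trans ?_
    simp_rw [hloss, add_mul, Finset.sum_add_distrib, mul_assoc, ← Finset.mul_sum]
    have h2 : ∑ c, (∑ k', keyProb D c q k₀ k') * F c ≤ ∑ c, keyProb D c q k₀ k₀ * F c +
        ∑ c, (∑ k, ∑ k', if k ≠ k' then keyProb D c q k k' else 0) * F c := by
      rw [← Finset.sum_add_distrib]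
      refine Finset.sum_le_sum fun c _ => ?_
      rw [← add_mul]
      exact mul_le_mul_of_nonneg_right (hk c) (hF0 c)
    have h3 := mul_le_mul_of_nonneg_left h2 (show (0 : ℝ) ≤ 2 ^ s by positivity)
    linarith
  · have hloss : ∀ c, transcriptLoss θ D q c = ∑ k, ∑ k', keyProb D c q k k' := by
      intro c
      simp only [transcriptLoss, hmany, if_false, mul_zero, zero_add]
    simp_rw [hloss]
    refine le_add_of_nonneg_left (mul_nonneg (by positivity) ?_)
    exact Finset.sum_nonneg fun c _ => mul_nonneg (keyProb_nonneg _ _ _ _ _) (hF0 c)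

variable {W Z : Type*}

/-- For fixed input and output of Eve, a non-signaling system as a function of the inputs and
outputs of all rounds. -/
noncomputable def NSBox.roundLaw (P : NSBox N W Z) (w : W) (z : Z) (c : Fin N → Round) : ℝ≥0∞ :=
  P.law (Rounds.u c) (Rounds.v c) w (Rounds.x c, Rounds.y c, z)

theorem NSBox.roundLaw_ne_top (P : NSBox N W Z) (w : W) (z : Z) (c : Fin N → Round) :
    P.roundLaw w z c ≠ ⊤ := PMF.apply_ne_top _ _

theorem NSBox.roundsNS_roundLaw (P : NSBox N W Z) (w : W) (z : Z) :
    RoundsNS fun c => (P.roundLaw w z c).toReal := by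
  intro i c
  have hupd : ∀ r : Round, P.roundLaw w z (Function.update c i r) =
      P.law (Function.update (Rounds.u c) i r.1) (Function.update (Rounds.v c) i r.2.1) w
        (Function.update (Rounds.x c) i r.2.2.1, Function.update (Rounds.y c) i r.2.2.2, z) := by
    intro r
    have h : ∀ f : Round → Bit, (fun j => f (Function.update c i r j)) =
        Function.update (fun j => f (c j)) i (f r) := fun f => by
      ext j
      exact Function.apply_update (fun _ => f) c i r j
    rw [NSBox.roundLaw]
    congr 1
    · congr 1
      · exact h fun r => r.1
      · exact h fun r => r.2.1
    · refine Prod.ext (h fun r => r.2.2.1) (Prod.ext (h fun r => r.2.2.2) rfl)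
  constructor
  · intro u u' v y
    have h := P.ns_alice i u' (Function.update (Rounds.u c) i u) (Function.update (Rounds.v c) i v)
      w (Rounds.x c) (Function.update (Rounds.y c) i y) z
    rw [Function.update_idem] at h
    simp_rw [hupd]
    rw [← ENNReal.toReal_sum fun _ _ => PMF.apply_ne_top _ _,
      ← ENNReal.toReal_sum fun _ _ => PMF.apply_ne_top _ _, h]
  · intro u v v' x
    have h := P.ns_bob i v' (Function.update (Rounds.u c) i u) (Function.update (Rounds.v c) i v)
      w (Function.update (Rounds.x c) i x) (Rounds.y c) z
    rw [Function.update_idem] at h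
    simp_rw [hupd]
    rw [← ENNReal.toReal_sum fun _ _ => PMF.apply_ne_top _ _,
      ← ENNReal.toReal_sum fun _ _ => PMF.apply_ne_top _ _, h]

/-- The total weight of a function of the inputs of Alice and Bob. -/
theorem NSBox.sum_roundLaw_mul (P : NSBox N W Z) (w : W)
    (g : BitStr N → BitStr N → ℝ≥0∞) :
    ∑ c, (∑' z, P.roundLaw w z c) * g (Rounds.u c) (Rounds.v c) = ∑ a, ∑ b, g a b := by
  have h := Rounds.sum_eq fun a b x y => (∑' z, P.law a b w (x, y, z)) * g a b
  refine h.trans (Finset.sum_congr rfl fun a _ => Finset.sum_congr rfl fun b _ => ?_)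
  simp_rw [← Finset.sum_mul]
  have h1 : ∑ x, ∑ y, ∑' z, P.law a b w (x, y, z) = 1 := by
    rw [← (P.law a b w).tsum_coe, ENNReal.tsum_prod', tsum_fintype]
    refine Finset.sum_congr rfl fun x _ => ?_
    rw [ENNReal.tsum_prod', tsum_fintype]
  rw [h1, one_mul]

theorem protocolRun_key (D : MinDistDecoder n) (P : NSBox N W Z) (w : W)
    (q : Transcript N n s η) (k k' : BitStr s) (z : Z) :
    protocolRun η D P w (q.key k k', z) =
      ENNReal.ofReal ((4 ^ N)⁻¹ * ∑ c, keyProb D c q k k' * (P.roundLaw w z c).toReal) := by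
  rw [protocolRun_apply, ENNReal.ofReal_mul (by positivity), ENNReal.ofReal_sum_of_nonneg,
    Finset.mul_sum]
  · refine Finset.sum_congr rfl fun c _ => ?_
    rw [ENNReal.ofReal_mul (keyProb_nonneg _ _ _ _ _), ofReal_keyProb,
      ENNReal.ofReal_toReal (P.roundLaw_ne_top w z c), ENNReal.ofReal_inv_of_pos (by positivity),
      mul_comm (protocolKernel η D c (q.key k k')), ENNReal.ofReal_pow (by norm_num)]
    norm_num
    rfl
  · exact fun c _ => mul_nonneg (keyProb_nonneg _ _ _ _ _) ENNReal.toReal_nonneg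

theorem protocolRun_marginal (D : MinDistDecoder n) (P : NSBox N W Z) (w : W)
    (o : Outcome N n s η) : ∑' z, protocolRun η D P w (o, z) =
      ∑ c, ((4 : ℝ≥0∞) ^ N)⁻¹ * ((∑' z, P.roundLaw w z c) * protocolKernel η D c o) := by
  simp_rw [protocolRun_apply]
  rw [Summable.tsum_finsetSum fun _ _ => ENNReal.summable]
  refine Finset.sum_congr rfl fun c _ => ?_
  rw [ENNReal.tsum_mul_left, ENNReal.tsum_mul_right]
  rfl

/-- For uniform inputs, there are enough rounds with input `(0,0)` except with exponentially small
probability. -/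
theorem sum_few_zeroRounds_le {γ : ℝ} (hγ0 : 0 ≤ γ) (hγ1 : γ ≤ 1) {t : ℝ}
    (ht : t ≤ (1 / 4 - γ) * N) :
    ∑ a : BitStr N, ∑ b : BitStr N, (if
      ((Finset.univ.filter fun i => a i = 0 ∧ b i = 0).card : ℝ) < t then (4 ^ N)⁻¹ else 0) ≤
      Real.exp (-(γ ^ 2 / 4) * N) := by
  have hch := chernoff_bound (C := Bit × Bit) (fun _ => 1 / 4) (fun _ => by norm_num)
    (by simp) (fun r => ¬(r.1 = 0 ∧ r.2 = 0)) (p := 3 / 4) (γ := γ)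
    (by
      have : (Finset.univ.filter fun r : Bit × Bit => ¬(r.1 = 0 ∧ r.2 = 0)).card = 3 := by decide
      rw [Finset.sum_const, this]
      norm_num) hγ0 hγ1 N
  refine le_trans ?_ hch
  rw [← (Equiv.arrowProdEquivProdArrow (Fin N) (fun _ => Bit) fun _ => Bit).symm.sum_comp,
    Fintype.sum_prod_type]
  refine Finset.sum_le_sum fun a _ => Finset.sum_le_sum fun b _ => ?_
  change _ ≤ (if (3 / 4 + γ) * N ≤
    ((Finset.univ.filter fun i => ¬(a i = 0 ∧ b i = 0)).card : ℝ) then _ else _)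
  have hcard : ((Finset.univ.filter fun i => a i = 0 ∧ b i = 0).card : ℝ) +
      (Finset.univ.filter fun i => ¬(a i = 0 ∧ b i = 0)).card = N := by
    have := Finset.card_filter_add_card_filter_not (s := (Finset.univ : Finset (Fin N)))
      (fun i => a i = 0 ∧ b i = 0)
    rw [Finset.card_univ, Fintype.card_fin] at this
    exact_mod_cast this
  split_ifs with h1 h2
  · simp
  · exfalso
    apply h2
    linarith
  · positivity
  · exact le_rfl

/-- Security with explicit error terms: loss of secrecy, failure of error correction, and a lack of
rounds with input `(0,0)`. -/
theorem secureExcept_protocolRun {κ : ℕ} {l γ : ℝ} (hN : N = n + κ * n) (hn : 0 < n) (hη : 0 < η)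
    (hκ : 2 ≤ κ * η) (hθ : 0 < θ) (hκ' : 8 * θ ≤ η * (κ + 1))
    (hl0 : 0 < l) (hl1 : l ≤ 1) (hlη : l ≤ η / 4)
    (hl : ∀ a : Announcement N n, a.Accepted η →
      Real.log (a.deltaEst η / (1 - a.deltaEst η)) ≤ -l)
    (hγ0 : 0 ≤ γ) (hγ1 : γ ≤ 1) (hγ : n + N / (4 * θ) ≤ (1 / 4 - γ) * N)
    (P : NSBox N W Z) (D : MinDistDecoder n) :
    SecureExcept (protocolRun (s := s) η D P)
      (ENNReal.ofReal (2 ^ s * (2 * (θ / (1 + 2 * η / 5)) ^ n) +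
        2 ^ s * Real.exp (-(l * η / 4) * n) + Real.exp (-(γ ^ 2 / 4) * N))) := by
  classical
  -- without inputs of Eve there are no systems to extend
  rcases isEmpty_or_nonempty W with hW | hW
  · exact ⟨fun w => isEmptyElim w, fun w => isEmptyElim w, fun w => isEmptyElim w,
      fun w => isEmptyElim w, fun w => isEmptyElim w⟩
  obtain ⟨w₀⟩ := id hW
  have hmargBox : ∀ w c, ∑' z, P.roundLaw w z c = ∑' z, P.roundLaw w₀ z c :=
    fun w c => P.ns_eve _ _ _ _ _ _
  have hpow : (2 : ℝ≥0∞) ^ s ≠ ⊤ := ENNReal.pow_ne_top ENNReal.ofNat_ne_top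
  have hpow0 : (2 : ℝ≥0∞) ^ s ≠ 0 := pow_ne_zero _ two_ne_zero
  refine secureExcept_of_bound _ ?_ (fun q => ∑ c, ((4 : ℝ≥0∞) ^ N)⁻¹ *
    ((∑' z, P.roundLaw w₀ z c) * ENNReal.ofReal (transcriptLoss θ D q c))) ?_ ?_
  · intro w w' o
    rw [protocolRun_marginal, protocolRun_marginal]
    simp_rw [hmargBox]
  · intro w q
    have hz : ∀ z, ∑ k, ∑ k', protocolRun η D P w (q.key k k', z) ≤
        2 ^ s * minKeyMass (protocolRun η D P) w q z +
          ∑ c, ((4 : ℝ≥0∞) ^ N)⁻¹ *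
            (P.roundLaw w z c * ENNReal.ofReal (transcriptLoss θ D q c)) := by
      intro z
      rw [minKeyMass, ENNReal.mul_iInf_of_ne hpow0 hpow, ENNReal.iInf_add]
      refine le_iInf fun k₀ => ?_
      have hreal := sum_keyProb_le_transcriptLoss (θ := θ) D q k₀
        (fun c => ENNReal.toReal_nonneg (a := P.roundLaw w z c)) (P.roundsNS_roundLaw w z)
      have hleft : ∑ k, ∑ k', protocolRun η D P w (q.key k k', z) =
          ENNReal.ofReal ((4 ^ N)⁻¹ *
            ∑ c, (∑ k, ∑ k', keyProb D c q k k') * (P.roundLaw w z c).toReal) := by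
        have hnn : ∀ k k', 0 ≤ ((4 : ℝ) ^ N)⁻¹ *
            ∑ c, keyProb D c q k k' * (P.roundLaw w z c).toReal := fun k k' =>
          mul_nonneg (by positivity) (Finset.sum_nonneg fun c _ =>
            mul_nonneg (keyProb_nonneg _ _ _ _ _) ENNReal.toReal_nonneg)
        simp_rw [protocolRun_key]
        simp_rw [← ENNReal.ofReal_sum_of_nonneg fun k' (_ : k' ∈ Finset.univ) => hnn _ k']
        rw [← ENNReal.ofReal_sum_of_nonneg fun k _ => Finset.sum_nonneg fun k' _ => hnn k k']
        congr 1
        simp_rw [← Finset.mul_sum, Finset.sum_mul]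
        congr 1
        exact (Finset.sum_congr rfl fun k _ => Finset.sum_comm).trans Finset.sum_comm
      have hright : ∑ c, ((4 : ℝ≥0∞) ^ N)⁻¹ *
            (P.roundLaw w z c * ENNReal.ofReal (transcriptLoss θ D q c)) =
          ENNReal.ofReal ((4 ^ N)⁻¹ *
            ∑ c, transcriptLoss θ D q c * (P.roundLaw w z c).toReal) := by
        rw [ENNReal.ofReal_mul (by positivity), ENNReal.ofReal_sum_of_nonneg fun c _ =>
          mul_nonneg (transcriptLoss_nonneg _ _ _) ENNReal.toReal_nonneg, Finset.mul_sum]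
        refine Finset.sum_congr rfl fun c _ => ?_
        rw [ENNReal.ofReal_mul (transcriptLoss_nonneg _ _ _),
          ENNReal.ofReal_toReal (P.roundLaw_ne_top w z c),
          ENNReal.ofReal_inv_of_pos (by positivity), ENNReal.ofReal_pow (by norm_num),
          mul_comm (P.roundLaw w z c)]
        norm_num
      have h2 : (2 : ℝ≥0∞) ^ s = ENNReal.ofReal (2 ^ s) := by
        rw [ENNReal.ofReal_pow (by norm_num)]
        norm_num
      have hnn1 : 0 ≤ ∑ c, keyProb D c q k₀ k₀ * (P.roundLaw w z c).toReal :=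
        Finset.sum_nonneg fun c _ => mul_nonneg (keyProb_nonneg _ _ _ _ _) ENNReal.toReal_nonneg
      have hnn2 : 0 ≤ ∑ c, transcriptLoss θ D q c * (P.roundLaw w z c).toReal :=
        Finset.sum_nonneg fun c _ => mul_nonneg (transcriptLoss_nonneg _ _ _) ENNReal.toReal_nonneg
      rw [hleft, hright, protocolRun_key, h2, ← ENNReal.ofReal_mul (by positivity),
        ← ENNReal.ofReal_add (by positivity) (by positivity)]
      refine ENNReal.ofReal_le_ofReal ?_
      have h3 := mul_le_mul_of_nonneg_left hreal (show (0 : ℝ) ≤ (4 ^ N)⁻¹ by positivity)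
      linarith
    calc ∑ k, ∑ k', ∑' z, protocolRun η D P w (q.key k k', z)
        = ∑' z, ∑ k, ∑ k', protocolRun η D P w (q.key k k', z) := by
          rw [Summable.tsum_finsetSum fun _ _ => ENNReal.summable]
          refine Finset.sum_congr rfl fun k _ => ?_
          rw [Summable.tsum_finsetSum fun _ _ => ENNReal.summable]
      _ ≤ _ := ENNReal.tsum_le_tsum hz
      _ = _ := by
          rw [ENNReal.tsum_add, ENNReal.tsum_mul_left,
            Summable.tsum_finsetSum fun _ _ => ENNReal.summable]
          congr 1
          refine Finset.sum_congr rfl fun c _ => ?_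
          rw [ENNReal.tsum_mul_left, ENNReal.tsum_mul_right, hmargBox]
  · set bd : ℝ := 2 ^ s * (2 * (θ / (1 + 2 * η / 5)) ^ n) +
        2 ^ s * Real.exp (-(l * η / 4) * n) with hbd
    have hbd0 : 0 ≤ bd := by positivity
    let few : BitStr N → BitStr N → ℝ := fun a b =>
      if ((Finset.univ.filter fun i => a i = 0 ∧ b i = 0).card : ℝ) < n + N / (4 * θ) then 1 else 0
    have hfew0 : ∀ a b, 0 ≤ few a b := fun a b => by
      simp only [few]
      split_ifs <;> norm_num
    have hc : ∀ c : Fin N → Round,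
        ∑ q : Transcript N n s η, transcriptLoss θ D q c ≤ bd + few (u c) (v c) := by
      intro c
      have h1 := sum_secrecyLoss_le_of_manyZeroRounds (s := s) hN hn hη hκ hθ.le c
      have h2 := sum_keyProb_ne_le (s := s) hN hη hκ' hl0 hl1 hlη hl D c
      have h3 := sum_keyProb_not_manyZeroRounds_le (s := s) (η := η) (θ := θ) D c
      have h4 : (if (N : ℝ) ≤ 4 * θ * ((zeroRounds c).card - n) then (0 : ℝ) else 1) ≤
          few (u c) (v c) := by
        simp only [few]
        split_ifs with h5 h6 h6
        · norm_num
        · norm_num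
        · norm_num
        · exfalso
          apply h5
          have h7 : (n : ℝ) + N / (4 * θ) ≤ (zeroRounds c).card := not_lt.1 h6
          have h8 : (N : ℝ) / (4 * θ) ≤ (zeroRounds c).card - n := by linarith
          rw [div_le_iff₀ (by positivity)] at h8
          linarith
      have h5 := mul_le_mul_of_nonneg_left h2 (show (0 : ℝ) ≤ 2 ^ s by positivity)
      unfold transcriptLoss
      rw [Finset.sum_add_distrib, Finset.sum_add_distrib, ← Finset.mul_sum]
      linarith
    rw [tsum_fintype, Finset.sum_comm]
    have hinv : ((4 : ℝ≥0∞) ^ N)⁻¹ = ENNReal.ofReal ((4 ^ N)⁻¹) := by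
      rw [ENNReal.ofReal_inv_of_pos (by positivity), ENNReal.ofReal_pow (by norm_num)]
      norm_num
    calc _ ≤ ∑ c, (∑' z, P.roundLaw w₀ z c) *
          ENNReal.ofReal ((4 ^ N)⁻¹ * (bd + few (u c) (v c))) := by
          refine Finset.sum_le_sum fun c _ => ?_
          rw [← Finset.mul_sum, ← Finset.mul_sum, ← ENNReal.ofReal_sum_of_nonneg
            fun q _ => transcriptLoss_nonneg _ _ _, mul_left_comm,
            ENNReal.ofReal_mul (by positivity), hinv]
          gcongr
          exact hc c
      _ = ∑ a, ∑ b, ENNReal.ofReal ((4 ^ N)⁻¹ * (bd + few a b)) :=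
          P.sum_roundLaw_mul w₀ fun a b => ENNReal.ofReal ((4 ^ N)⁻¹ * (bd + few a b))
      _ = ENNReal.ofReal (∑ a, ∑ b, (4 ^ N)⁻¹ * (bd + few a b)) := by
          have hnn : ∀ a b, 0 ≤ ((4 : ℝ) ^ N)⁻¹ * (bd + few a b) := fun a b =>
            mul_nonneg (by positivity) (add_nonneg hbd0 (hfew0 a b))
          rw [ENNReal.ofReal_sum_of_nonneg fun a _ => Finset.sum_nonneg fun b _ => hnn a b]
          refine Finset.sum_congr rfl fun a _ => ?_
          rw [ENNReal.ofReal_sum_of_nonneg fun b _ => hnn a b]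
      _ ≤ _ := by
          refine ENNReal.ofReal_le_ofReal ?_
          have h1 := sum_few_zeroRounds_le hγ0 hγ1 hγ
          have h2 : ∀ a b : BitStr N, ((4 : ℝ) ^ N)⁻¹ * (bd + few a b) = (4 ^ N)⁻¹ * bd +
              (if ((Finset.univ.filter fun i => a i = 0 ∧ b i = 0).card : ℝ) < n + N / (4 * θ)
                then (4 ^ N)⁻¹ else 0) := by
            intro a b
            simp only [few]
            split_ifs <;> ring
          simp_rw [h2, Finset.sum_add_distrib]
          refine add_le_add (le_of_eq ?_) h1
          simp only [Finset.sum_const, Finset.card_univ, Fintype.card_pi, ZMod.card,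
            Finset.prod_const, Fintype.card_fin, nsmul_eq_mul, Nat.cast_pow, Nat.cast_ofNat]
          rw [show (4 : ℝ) ^ N = 2 ^ N * 2 ^ N by rw [← mul_pow]; norm_num]
          field_simp

end

/-! ### The accepted region -/

theorem two_rpow_neg_binEntropyBits (p : ℝ) :
    (2 : ℝ) ^ (-binEntropyBits p) = Real.exp (-Real.binEntropy p) := by
  have hlog : Real.log 2 ≠ 0 := (Real.log_pos one_lt_two).ne'
  rw [Real.rpow_def_of_pos two_pos, binEntropyBits]
  congr 1
  field_simp

/-- The thresholds of 80% and 98% lie in the accepted region since `2 ^ (-h(1/50)) ≥ 9/10`, that is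
`1/5 ≤ 2 ^ (-h(1/50) - 1) - 1/4`. -/
theorem binEntropy_one_div_fifty_le : Real.binEntropy (1 / 50) ≤ -Real.log (9 / 10) := by
  have h : Real.log (50 * (50 / 49) ^ 49) ≤ Real.log ((10 / 9) ^ 50) :=
    Real.log_le_log (by norm_num) (by norm_num)
  rw [Real.log_mul (by norm_num) (by norm_num), Real.log_pow, Real.log_pow] at h
  rw [Real.binEntropy, ← Real.log_inv]
  norm_num at h ⊢
  linarith

theorem Announcement.accepted_of_lt {N n : ℕ} {η : ℝ} (hη : 0 ≤ η) {a : Announcement N n}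
    (hz : a.zeroTestRounds.Nonempty) (hb : a.Balanced η) (hε : a.epsEst η < 1 / 5)
    (hδ : a.deltaEst η < 1 / 50) : a.Accepted η := by
  refine ⟨hz, hb, by linarith, hε.trans_le ?_⟩
  have hδ0 := a.deltaEst_nonneg hη
  have hmono : Real.binEntropy (a.deltaEst η) ≤ Real.binEntropy (1 / 50) :=
    Real.binEntropy_strictMonoOn.monotoneOn ⟨hδ0, by norm_num; linarith⟩ (by norm_num) hδ.le
  have hexp : (9 / 10 : ℝ) ≤ (2 : ℝ) ^ (-binEntropyBits (a.deltaEst η)) := by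
    rw [two_rpow_neg_binEntropyBits]
    calc (9 / 10 : ℝ) = Real.exp (Real.log (9 / 10)) := (Real.exp_log (by norm_num)).symm
      _ ≤ _ := Real.exp_le_exp.2 (by linarith [binEntropy_one_div_fifty_le])
  rw [Real.rpow_sub two_pos, Real.rpow_one]
  linarith

/-! ### Honest devices -/

section

variable {N n s : ℕ} {η : ℝ}

/-- The number of rounds with property `p`. -/
def roundCount (p : Round → Prop) [DecidablePred p] (c : Fin N → Round) : ℕ :=
  (Finset.univ.filter fun i => p (c i)).card

/-- The numbers of rounds with various properties are all within `γ N` of, or on the right side of,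
their means in independent rounds with error probabilities `ε` and `δ`. -/
structure Typical (γ ε δ : ℝ) (c : Fin N → Round) : Prop where
  zero : (roundCount (fun r => ¬(r.1 = 0 ∧ r.2.1 = 0)) c : ℝ) < (3 / 4 + γ) * N
  chsh : (roundCount (fun r => r.2.2.1 + r.2.2.2 ≠ r.1 * r.2.1) c : ℝ) < (ε + γ) * N
  key : (roundCount (fun r => (r.1 = 0 ∧ r.2.1 = 0) ∧ r.2.2.1 ≠ r.2.2.2) c : ℝ) < (δ / 4 + γ) * N
  alice : ∀ b, (roundCount (fun r => r.2.2.1 = b) c : ℝ) < (1 / 2 + γ) * N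
  bob : ∀ b, (roundCount (fun r => r.2.2.2 = b) c : ℝ) < (1 / 2 + γ) * N

/-- If neither bit value is much more frequent than `1/2` in all rounds, then ones have frequency
close to `1/2` in a set `t` of almost all rounds. -/
theorem abs_div_sub_half_le {N k : ℕ} {t : Finset (Fin N)} (ht : t.card = k) (hk : 0 < k)
    {f : Fin N → Bit} {γ η : ℝ} (hNk : (1 / 2 + γ) * N ≤ (1 / 2 + η) * k)
    (h : ∀ b, ((Finset.univ.filter fun i => f i = b).card : ℝ) < (1 / 2 + γ) * N)
    {g : Fin N → Bit} (hg : ∀ i ∈ t, g i = f i) :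
    |((t.filter fun i => g i = 1).card : ℝ) / t.card - 1 / 2| ≤ η := by
  have hle : ∀ b, ((t.filter fun i => g i = b).card : ℝ) ≤ (1 / 2 + η) * k := by
    intro b
    refine le_trans ?_ ((h b).le.trans hNk)
    have : (t.filter fun i => g i = b) ⊆ Finset.univ.filter fun i => f i = b := by
      intro i hi
      obtain ⟨hi1, hi2⟩ := Finset.mem_filter.1 hi
      exact Finset.mem_filter.2 ⟨Finset.mem_univ _, by rw [← hg i hi1, hi2]⟩
    exact_mod_cast Finset.card_le_card this
  have hsum : ((t.filter fun i => g i = 1).card : ℝ) + (t.filter fun i => g i = 0).card = k := by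
    have h1 := Finset.card_filter_add_card_filter_not (s := t) (fun i => g i = 1)
    have h2 : (t.filter fun i => ¬g i = 1) = t.filter fun i => g i = 0 := by
      refine Finset.filter_congr fun i _ => ?_
      rcases bit_cases (g i) with h | h <;> simp [h]
    rw [h2, ht] at h1
    exact_mod_cast h1
  have hk' : (0 : ℝ) < k := by exact_mod_cast hk
  have h0 := hle 0
  have h1 := hle 1
  rw [ht, abs_le]
  constructor
  · rw [le_sub_iff_add_le, le_div_iff₀ hk']
    linarith
  · rw [sub_le_iff_le_add, div_le_iff₀ hk']
    linarith

theorem Typical.lt_card_zeroRounds {γ ε δ : ℝ} {c : Fin N → Round} (hc : Typical γ ε δ c) :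
    (1 / 4 - γ) * N < (zeroRounds c).card := by
  have h1 := Finset.card_filter_add_card_filter_not (s := (Finset.univ : Finset (Fin N)))
    (fun i => u c i = 0 ∧ v c i = 0)
  rw [Finset.card_univ, Fintype.card_fin] at h1
  have h2 : ((zeroRounds c).card : ℝ) +
      roundCount (fun r => ¬(r.1 = 0 ∧ r.2.1 = 0)) c = N := by exact_mod_cast h1
  linarith [hc.zero]

theorem Typical.numSelections_pos {γ ε δ : ℝ} {c : Fin N → Round} (hc : Typical γ ε δ c)
    (h : n ≤ (1 / 4 - γ) * N) : 0 < numSelections n c := by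
  have hlt : n < (zeroRounds c).card := by exact_mod_cast h.trans_lt hc.lt_card_zeroRounds
  exact (Nat.pow_pos (Nat.sub_pos_of_lt hlt)).trans_le
    (sub_pow_le_card_embeddings (zeroRounds c) n)

/-- If all counts are typical, the protocol continues whichever rounds are selected. -/
theorem Typical.accepted {κ : ℕ} {ε δ : ℝ} (hN : N = n + κ * n) (hn : 0 < n) (hη : 0 < η)
    (hκ : 40 ≤ κ * η) (hε0 : 0 ≤ ε) (hδ0 : 0 ≤ δ) (hε : ε + 2 * η ≤ 1 / 5)
    (hδ : δ + 2 * η ≤ 1 / 50) {c : Fin N → Round} (hc : Typical (η / 40) ε δ c)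
    {e : Fin n ↪ Fin N} (he : ∀ j, e j ∈ zeroRounds c) : (announcement c e).Accepted η := by
  have hn' : (0 : ℝ) < n := by exact_mod_cast hn
  have hN' : (N : ℝ) = n + κ * n := by rw [hN]; push_cast; ring
  have hNn : N - n = κ * n := by omega
  have hκ0 : 0 < κ := by
    rcases Nat.eq_zero_or_pos κ with h | h
    · rw [h] at hκ
      norm_num at hκ
    · exact h
  have hk : 0 < κ * n := Nat.mul_pos hκ0 hn
  have hk' : (0 : ℝ) < κ * n := by exact_mod_cast hk
  have hnk : (n : ℝ) ≤ η / 40 * (κ * n) := by nlinarith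
  have hNk : (N : ℝ) ≤ (1 + η / 40) * (κ * n) := by rw [hN']; linarith
  have hη1 : η ≤ 1 / 100 := by linarith
  set a := announcement c e with ha
  have hoff : ∀ i, i ∈ a.testRounds → a.x i = x c i ∧ a.y i = y c i := by
    intro i hi
    have hi' : i ∉ Finset.univ.map e := Finset.mem_compl.1 hi
    simp only [ha, announcement, announce, hi', if_false, and_self]
  have htest : (a.testRounds.card : ℝ) = κ * n := by
    rw [a.card_testRounds, hNn]
    push_cast
    ring
  have hz := hc.lt_card_zeroRounds
  have hzT : (a.zeroTestRounds.card : ℝ) + n = (zeroRounds c).card := by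
    exact_mod_cast card_zeroTestRounds_announcement he
  have hnN : (n : ℝ) ≤ η / 40 * N := by rw [hN']; nlinarith
  have hzT' : (1 / 4 - η / 20) * N < a.zeroTestRounds.card := by linarith
  have hN0 : (0 : ℝ) < N := by rw [hN']; positivity
  have hzT0 : (0 : ℝ) < a.zeroTestRounds.card := lt_of_le_of_lt (by nlinarith) hzT'
  refine Announcement.accepted_of_lt hη.le ?_ ⟨?_, ?_⟩ ?_ ?_
  · exact Finset.card_pos.1 (by exact_mod_cast hzT0)
  · refine abs_div_sub_half_le (γ := η / 40) (f := x c) (a.card_testRounds.trans hNn) hk ?_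
      hc.alice fun i hi => (hoff i hi).1
    push_cast
    nlinarith
  · refine abs_div_sub_half_le (γ := η / 40) (f := y c) (a.card_testRounds.trans hNn) hk ?_
      hc.bob fun i hi => (hoff i hi).2
    push_cast
    nlinarith
  · have hle : ((a.testRounds.filter fun i => a.x i + a.y i ≠ a.u i * a.v i).card : ℝ) ≤
        roundCount (fun r => r.2.2.1 + r.2.2.2 ≠ r.1 * r.2.1) c := by
      have : (a.testRounds.filter fun i => a.x i + a.y i ≠ a.u i * a.v i) ⊆
          Finset.univ.filter fun i => (c i).2.2.1 + (c i).2.2.2 ≠ (c i).1 * (c i).2.1 := by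
        intro i hi
        obtain ⟨hi1, hi2⟩ := Finset.mem_filter.1 hi
        refine Finset.mem_filter.2 ⟨Finset.mem_univ _, ?_⟩
        rw [(hoff i hi1).1, (hoff i hi1).2] at hi2
        exact hi2
      exact_mod_cast Finset.card_le_card this
    have hlt : a.chshErrorRate < ε + η := by
      rw [Announcement.chshErrorRate, htest, div_lt_iff₀ hk']
      refine lt_of_le_of_lt hle (hc.chsh.trans_le ?_)
      nlinarith [mul_le_mul_of_nonneg_left hNk (show 0 ≤ ε + η / 40 by positivity),
        mul_pos hη hk']
    rw [Announcement.epsEst]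
    linarith
  · have hle : ((a.zeroTestRounds.filter fun i => a.x i ≠ a.y i).card : ℝ) ≤
        roundCount (fun r => (r.1 = 0 ∧ r.2.1 = 0) ∧ r.2.2.1 ≠ r.2.2.2) c := by
      have : (a.zeroTestRounds.filter fun i => a.x i ≠ a.y i) ⊆ Finset.univ.filter
          fun i => ((c i).1 = 0 ∧ (c i).2.1 = 0) ∧ (c i).2.2.1 ≠ (c i).2.2.2 := by
        intro i hi
        obtain ⟨hi1, hi2⟩ := Finset.mem_filter.1 hi
        obtain ⟨hi3, hi4⟩ := Finset.mem_filter.1 hi1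
        refine Finset.mem_filter.2 ⟨Finset.mem_univ _, hi4, ?_⟩
        rw [(hoff i hi3).1, (hoff i hi3).2] at hi2
        exact hi2
      exact_mod_cast Finset.card_le_card this
    have hlt : a.keyErrorRate < δ + η := by
      rw [Announcement.keyErrorRate, div_lt_iff₀ hzT0]
      refine lt_of_le_of_lt hle (hc.key.trans_le ?_)
      have h1 : (δ / 4 + η / 40) * N ≤ (δ + η) * ((1 / 4 - η / 20) * N) := by
        rw [← mul_assoc]
        refine mul_le_mul_of_nonneg_right ?_ hN0.le
        nlinarith
      exact h1.trans (mul_le_mul_of_nonneg_left hzT'.le (by positivity))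
    rw [Announcement.deltaEst]
    linarith

/-- The protocol is not aborted if a selection is possible and every selection is accepted. -/
theorem protocolKernel_eq_zero {c : Fin N → Round} (hne : 0 < numSelections n c)
    (hacc : ∀ e : Fin n ↪ Fin N, (∀ j, e j ∈ zeroRounds c) → (announcement c e).Accepted η)
    (D : MinDistDecoder n) (o : Outcome N n s η) (ho : o.isKey = false) :
    protocolKernel η D c o = 0 := by
  classical
  rw [numSelections_eq] at hne
  by_contra h
  have hmem := (PMF.mem_support_iff _ _).2 h
  unfold protocolKernel at hmem
  rw [dif_pos (Finset.card_pos.1 hne), PMF.mem_support_bind_iff] at hmem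
  obtain ⟨e, he, hmem⟩ := hmem
  rw [PMF.mem_support_uniformOfFinset_iff, Finset.mem_filter] at he
  rw [if_pos (hacc e fun j => mem_zeroRounds.2 (he.2 j)), PMF.mem_support_map_iff] at hmem
  obtain ⟨A, -, rfl⟩ := hmem
  exact absurd ho (by simp [Outcome.isKey])

/-- The joint distribution of inputs and outputs of a single box on uniform inputs. -/
noncomputable def SingleBox.roundProb (B : SingleBox) (r : Round) : ℝ :=
  1 / 4 * (B r.1 r.2.1 (r.2.2.1, r.2.2.2)).toReal

theorem SingleBox.roundProb_nonneg (B : SingleBox) (r : Round) : 0 ≤ B.roundProb r :=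
  mul_nonneg (by norm_num) ENNReal.toReal_nonneg

theorem SingleBox.sum_toReal (B : SingleBox) (u v : Bit) :
    ∑ x, ∑ y, (B u v (x, y)).toReal = 1 := by
  rw [← Fintype.sum_prod_type' (f := fun x y => (B u v (x, y)).toReal),
    ← ENNReal.toReal_sum fun _ _ => PMF.apply_ne_top _ _, ← tsum_fintype (L := .unconditional _),
    PMF.tsum_coe, ENNReal.toReal_one]

theorem SingleBox.sum_roundProb_filter (B : SingleBox) (p : Round → Prop) [DecidablePred p] :
    ∑ r with p r, B.roundProb r = 1 / 4 * ∑ u, ∑ v, ∑ x, ∑ y,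
      if p (u, v, x, y) then (B u v (x, y)).toReal else 0 := by
  rw [Finset.sum_filter]
  simp only [Fintype.sum_prod_type, SingleBox.roundProb, Finset.mul_sum, mul_ite, mul_zero]

theorem SingleBox.sum_roundProb (B : SingleBox) : ∑ r, B.roundProb r = 1 := by
  have h := B.sum_roundProb_filter fun _ => True
  simp only [Finset.filter_true, if_true, SingleBox.sum_toReal] at h
  rw [h]
  simp [ZMod.card]
  norm_num

theorem SingleBox.Unbiased.toReal {B : SingleBox} (hB : B.Unbiased) (u v b : Bit) :
    ∑ y, (B u v (b, y)).toReal = 1 / 2 ∧ ∑ x, (B u v (x, b)).toReal = 1 / 2 := by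
  constructor
  · rw [← ENNReal.toReal_sum fun _ _ => PMF.apply_ne_top _ _, (hB u v b).1]
    norm_num
  · rw [← ENNReal.toReal_sum fun _ _ => PMF.apply_ne_top _ _, (hB u v b).2]
    norm_num

open Classical in
/-- In independent rounds, the counts are typical except with exponentially small probability. -/
theorem sum_not_typical_le {γ : ℝ} (hγ0 : 0 ≤ γ) (hγ1 : γ ≤ 1) {B : SingleBox} (hB : B.Unbiased)
    (N : ℕ) : ∑ c : Fin N → Round,
      (if Typical γ B.chshError B.keyError c then 0 else ∏ i, B.roundProb (c i)) ≤
        7 * Real.exp (-(γ ^ 2 / 4) * N) := by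
  have hch : ∀ (p : Round → Prop) [DecidablePred p] (m : ℝ), ∑ r with p r, B.roundProb r ≤ m →
      ∀ Q : (Fin N → Round) → Prop, (∀ c, Q c → (m + γ) * N ≤ roundCount p c) →
      ∑ c : Fin N → Round, (if Q c then ∏ i, B.roundProb (c i) else 0) ≤
        Real.exp (-(γ ^ 2 / 4) * N) := fun p _ m hm Q hQ => by
    refine le_trans (Finset.sum_le_sum fun c _ => ?_)
      (chernoff_bound B.roundProb B.roundProb_nonneg B.sum_roundProb p hm hγ0 hγ1 N)
    have h0 : 0 ≤ ∏ i, B.roundProb (c i) := Finset.prod_nonneg fun i _ => B.roundProb_nonneg _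
    split_ifs with h1 h2
    exacts [le_rfl, absurd (hQ c h1) h2, h0, le_rfl]
  let Q : Fin 7 → (Fin N → Round) → Prop := ![
    fun c => (3 / 4 + γ) * N ≤ roundCount (fun r => ¬(r.1 = 0 ∧ r.2.1 = 0)) c,
    fun c => (B.chshError + γ) * N ≤ roundCount (fun r => r.2.2.1 + r.2.2.2 ≠ r.1 * r.2.1) c,
    fun c => (B.keyError / 4 + γ) * N ≤
      roundCount (fun r => (r.1 = 0 ∧ r.2.1 = 0) ∧ r.2.2.1 ≠ r.2.2.2) c,
    fun c => (1 / 2 + γ) * N ≤ roundCount (fun r => r.2.2.1 = 0) c,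
    fun c => (1 / 2 + γ) * N ≤ roundCount (fun r => r.2.2.1 = 1) c,
    fun c => (1 / 2 + γ) * N ≤ roundCount (fun r => r.2.2.2 = 0) c,
    fun c => (1 / 2 + γ) * N ≤ roundCount (fun r => r.2.2.2 = 1) c]
  have halice : ∀ b, ∑ r with r.2.2.1 = b, B.roundProb r ≤ 1 / 2 := fun b => by
    rw [B.sum_roundProb_filter]
    have h := fun u v => (hB.toReal u v b).1
    rcases bit_cases b with rfl | rfl <;>
    · simp only [sum_bit] at h ⊢
      simp
      linarith [h 0 0, h 0 1, h 1 0, h 1 1]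
  have hbob : ∀ b, ∑ r with r.2.2.2 = b, B.roundProb r ≤ 1 / 2 := fun b => by
    rw [B.sum_roundProb_filter]
    have h := fun u v => (hB.toReal u v b).2
    rcases bit_cases b with rfl | rfl <;>
    · simp only [sum_bit] at h ⊢
      simp
      linarith [h 0 0, h 0 1, h 1 0, h 1 1]
  have hQ : ∀ i, ∑ c : Fin N → Round, (if Q i c then ∏ i, B.roundProb (c i) else 0) ≤
      Real.exp (-(γ ^ 2 / 4) * N) := by
    intro i
    fin_cases i
    · refine hch _ _ ?_ _ fun c h => h
      rw [B.sum_roundProb_filter]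
      have h := B.sum_toReal
      simp only [sum_bit] at h ⊢
      simp
      linarith [h 0 1, h 1 0, h 1 1]
    · refine hch _ _ ?_ _ fun c h => h
      rw [B.sum_roundProb_filter]
      rfl
    · refine hch _ _ ?_ _ fun c h => h
      rw [B.sum_roundProb_filter, SingleBox.keyError]
      simp only [sum_bit]
      simp
      linarith
    · exact hch _ _ (halice 0) _ fun c h => h
    · exact hch _ _ (halice 1) _ fun c h => h
    · exact hch _ _ (hbob 0) _ fun c h => h
    · exact hch _ _ (hbob 1) _ fun c h => h
  have hunion : ∀ c : Fin N → Round,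
      (if Typical γ B.chshError B.keyError c then 0 else ∏ i, B.roundProb (c i)) ≤
        ∑ i, if Q i c then ∏ i, B.roundProb (c i) else 0 := by
    intro c
    have h0 : 0 ≤ ∏ i, B.roundProb (c i) := Finset.prod_nonneg fun i _ => B.roundProb_nonneg _
    have hnn : ∀ i ∈ Finset.univ, 0 ≤ if Q i c then ∏ i, B.roundProb (c i) else 0 := fun i _ => by
      split_ifs
      exacts [h0, le_rfl]
    split_ifs with hc
    · exact Finset.sum_nonneg hnn
    · obtain ⟨i, hi⟩ : ∃ i, Q i c := by
        by_contra hcon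
        push Not at hcon
        refine hc ⟨lt_of_not_ge (hcon 0), lt_of_not_ge (hcon 1), lt_of_not_ge (hcon 2),
          fun b => ?_, fun b => ?_⟩
        · rcases bit_cases b with rfl | rfl
          exacts [lt_of_not_ge (hcon 3), lt_of_not_ge (hcon 4)]
        · rcases bit_cases b with rfl | rfl
          exacts [lt_of_not_ge (hcon 5), lt_of_not_ge (hcon 6)]
      refine le_trans (le_of_eq ?_) (Finset.single_le_sum hnn (Finset.mem_univ i))
      rw [if_pos hi]
  refine (Finset.sum_le_sum fun c _ => hunion c).trans ?_
  rw [Finset.sum_comm]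
  refine (Finset.sum_le_sum fun i _ => hQ i).trans ?_
  simp

variable {W Z : Type*}

/-- The protocol is only aborted if one of the seven counts of `Typical` deviates from its mean. -/
theorem protocolRun_abort_le {κ : ℕ} (hN : N = n + κ * n) (hn : 0 < n) (hη : 0 < η)
    (hκ : 40 ≤ κ * η) (P : NSBox N W Z) (D : MinDistDecoder n) {B : SingleBox} (w : W)
    (hP : P.IsIID B) (hB : B.Unbiased) (hε : B.chshError + 2 * η ≤ 1 / 5)
    (hδ : B.keyError + 2 * η ≤ 1 / 50) :
    ((protocolRun (s := s) η D P w).map fun o => o.1.isKey) false ≤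
      ENNReal.ofReal (7 * Real.exp (-((η / 40) ^ 2 / 4) * N)) := by
  classical
  have hε0 : 0 ≤ B.chshError := by
    unfold SingleBox.chshError
    refine mul_nonneg (by norm_num) (Finset.sum_nonneg fun _ _ => Finset.sum_nonneg fun _ _ =>
      Finset.sum_nonneg fun _ _ => Finset.sum_nonneg fun _ _ => ?_)
    split_ifs
    exacts [ENNReal.toReal_nonneg, le_rfl]
  have hδ0 : 0 ≤ B.keyError := by
    unfold SingleBox.keyError
    refine Finset.sum_nonneg fun _ _ => Finset.sum_nonneg fun _ _ => ?_
    split_ifs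
    exacts [ENNReal.toReal_nonneg, le_rfl]
  have hη1 : η ≤ 1 / 100 := by linarith
  have hkernel : ∀ c : Fin N → Round, ∑' o : Outcome N n s η,
      (if o.isKey = false then protocolKernel η D c o else 0) ≤
        if Typical (η / 40) B.chshError B.keyError c then 0 else 1 := by
    intro c
    split_ifs with hc
    · refine (ENNReal.tsum_eq_zero.2 fun o => ?_).le
      split_ifs with ho
      · refine protocolKernel_eq_zero ?_
          (fun e he => hc.accepted hN hn hη hκ hε0 hδ0 hε hδ he) D o ho
        refine hc.numSelections_pos ?_
        have hN' : (N : ℝ) = n + κ * n := by rw [hN]; push_cast; ring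
        have hn' : (0 : ℝ) < n := by exact_mod_cast hn
        have hκ1 : (4000 : ℝ) ≤ κ := by nlinarith [κ.cast_nonneg (α := ℝ)]
        rw [hN']
        nlinarith [mul_le_mul_of_nonneg_right hκ1 hn'.le]
      · rfl
    · rw [← (protocolKernel (s := s) η D c).tsum_coe]
      refine ENNReal.tsum_le_tsum fun o => ?_
      split_ifs
      exacts [le_rfl, bot_le]
  have hlaw : ∀ c : Fin N → Round, ((4 : ℝ≥0∞) ^ N)⁻¹ * ∑' z, P.roundLaw w z c =
      ENNReal.ofReal (∏ i, B.roundProb (c i)) := by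
    intro c
    have h1 : ∑' z, P.roundLaw w z c = ∏ i, B (u c i) (v c i) (x c i, y c i) := hP _ _ _ _ _
    rw [h1, ENNReal.ofReal_prod_of_nonneg fun i _ => B.roundProb_nonneg _]
    have h2 : ∀ i, ENNReal.ofReal (B.roundProb (c i)) =
        (4 : ℝ≥0∞)⁻¹ * B (u c i) (v c i) (x c i, y c i) := by
      intro i
      rw [SingleBox.roundProb, ENNReal.ofReal_mul (by norm_num),
        ENNReal.ofReal_toReal (PMF.apply_ne_top _ _), one_div,
        ENNReal.ofReal_inv_of_pos (by norm_num)]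
      norm_num
      rfl
    simp_rw [h2, Finset.prod_mul_distrib]
    simp [ENNReal.inv_pow]
  calc ((protocolRun (s := s) η D P w).map fun o => o.1.isKey) false
      = ∑' o : Outcome N n s η,
          if o.isKey = false then ∑' z, protocolRun η D P w (o, z) else 0 := by
        rw [PMF.map_apply, ENNReal.tsum_prod']
        refine tsum_congr fun o => ?_
        by_cases ho : o.isKey = false
        · simp [ho]
        · simp [ho]
    _ = ∑ c, (((4 : ℝ≥0∞) ^ N)⁻¹ * ∑' z, P.roundLaw w z c) * ∑' o : Outcome N n s η,
          (if o.isKey = false then protocolKernel η D c o else 0) := by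
        simp_rw [protocolRun_marginal, ← ENNReal.tsum_mul_left]
        rw [← Summable.tsum_finsetSum fun _ _ => ENNReal.summable]
        refine tsum_congr fun o => ?_
        split_ifs
        · exact Finset.sum_congr rfl fun c _ => by rw [ENNReal.tsum_mul_left, mul_assoc]
        · simp
    _ ≤ ∑ c : Fin N → Round, ENNReal.ofReal
          (if Typical (η / 40) B.chshError B.keyError c then 0 else ∏ i, B.roundProb (c i)) := by
        refine Finset.sum_le_sum fun c _ => ?_
        rw [hlaw]
        refine (mul_le_mul_right (hkernel c) _).trans ?_
        split_ifs <;> simp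
    _ = ENNReal.ofReal (∑ c : Fin N → Round,
          if Typical (η / 40) B.chshError B.keyError c then 0 else ∏ i, B.roundProb (c i)) := by
        rw [ENNReal.ofReal_sum_of_nonneg fun c _ => ?_]
        split_ifs
        exacts [le_rfl, Finset.prod_nonneg fun i _ => B.roundProb_nonneg _]
    _ ≤ _ := ENNReal.ofReal_le_ofReal
        (sum_not_typical_le (by positivity) (by linarith) hB N)

/-! ### Singlets -/

theorem singletProb_eq (u v x y : Bit) : singletProb u v x y =
    ((if x = 0 then Real.cos (aliceAngle u) else -Real.sin (aliceAngle u)) *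
        (if y = 0 then Real.sin (bobAngle v) else Real.cos (bobAngle v)) -
      (if x = 0 then Real.sin (aliceAngle u) else Real.cos (aliceAngle u)) *
        (if y = 0 then Real.cos (bobAngle v) else -Real.sin (bobAngle v))) ^ 2 / 2 := by
  have key : ∀ t : ℝ, ‖(t : ℂ) * (1 / (Real.sqrt 2 : ℂ))‖ ^ 2 = t ^ 2 / 2 := by
    intro t
    rw [norm_mul, mul_pow, norm_div, div_pow, Complex.norm_real, Complex.norm_real]
    simp [Real.sq_sqrt, div_eq_mul_inv]
  rw [← key]
  unfold singletProb
  congr 2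
  by_cases hx : x = 0 <;> by_cases hy : y = 0 <;>
    simp [polarization, singletState, hx, hy, Fin.sum_univ_two, -Complex.ofReal_cos,
      -Complex.ofReal_sin, Complex.conj_ofReal] <;> ring

theorem toReal_singletBox (u v x y : Bit) :
    (singletBox u v (x, y)).toReal = singletProb u v x y := by
  rw [singletBox, PMF.ofFintype_apply, ENNReal.toReal_ofReal]
  unfold singletProb
  positivity

theorem singletBox_unbiased : singletBox.Unbiased := by
  intro u v b
  have hsc := Real.sin_sq_add_cos_sq (aliceAngle u)
  have hsc' := Real.sin_sq_add_cos_sq (bobAngle v)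
  have hprod : (Real.sin (aliceAngle u) ^ 2 + Real.cos (aliceAngle u) ^ 2) *
      (Real.sin (bobAngle v) ^ 2 + Real.cos (bobAngle v) ^ 2) = 1 := by rw [hsc, hsc', one_mul]
  have hhalf : ENNReal.ofReal (1 / 2) = 1 / 2 := by
    rw [ENNReal.ofReal_div_of_pos two_pos]
    simp
  have hnn : ∀ x y, 0 ≤ singletProb u v x y := fun x y => by
    rw [singletProb_eq]
    positivity
  have hbox : ∀ x y, singletBox u v (x, y) = ENNReal.ofReal (singletProb u v x y) := fun x y => by
    rw [singletBox, PMF.ofFintype_apply]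
  simp only [hbox, ← hhalf]
  rw [← ENNReal.ofReal_sum_of_nonneg fun y _ => hnn b y,
    ← ENNReal.ofReal_sum_of_nonneg fun x _ => hnn x b]
  simp only [sum_bit, singletProb_eq]
  constructor <;> congr 1 <;> rcases bit_cases b with rfl | rfl <;> simp <;> nlinarith

theorem singletBox_chshError : singletBox.chshError = 3 / 16 := by
  have h3 : Real.sqrt 3 ^ 2 = 3 := Real.sq_sqrt (by norm_num)
  simp only [SingleBox.chshError, toReal_singletBox, singletProb_eq, sum_bit, aliceAngle, bobAngle]
  simp [show (1 + 1 : Bit) = 0 by decide]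
  ring_nf
  rw [show Real.sqrt 3 ^ 4 = (Real.sqrt 3 ^ 2) ^ 2 by ring, h3]
  norm_num

theorem singletBox_keyError : singletBox.keyError = 0 := by
  simp [SingleBox.keyError, toReal_singletBox, singletProb_eq, sum_bit, aliceAngle, bobAngle]

end

/-! ### Choice of the constants -/

theorem two_rpow_neg_mul_eq {L x : ℝ} :
    (2 : ℝ) ^ (-(L / (4 * Real.log 2) * x)) = Real.exp (-(L / 4) * x) := by
  have hlog : Real.log 2 ≠ 0 := (Real.log_pos one_lt_two).ne'
  rw [Real.rpow_def_of_pos two_pos]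
  congr 1
  field_simp

theorem two_pow_keyLength_le {L : ℝ} (hL : 0 ≤ L) (n : ℕ) :
    (2 : ℝ) ^ ⌈L / (2 * Real.log 2) * n⌉₊ ≤ 2 * Real.exp (L / 2 * n) := by
  have hlog : 0 < Real.log 2 := Real.log_pos one_lt_two
  have h := (Nat.ceil_lt_add_one (show 0 ≤ L / (2 * Real.log 2) * n by positivity)).le
  calc (2 : ℝ) ^ ⌈L / (2 * Real.log 2) * n⌉₊
      = (2 : ℝ) ^ ((⌈L / (2 * Real.log 2) * n⌉₊ : ℕ) : ℝ) := (Real.rpow_natCast _ _).symm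
    _ ≤ (2 : ℝ) ^ (L / (2 * Real.log 2) * n + 1) :=
        Real.rpow_le_rpow_of_exponent_le one_le_two h
    _ = _ := by
        rw [Real.rpow_add two_pos, Real.rpow_one, Real.rpow_def_of_pos two_pos, mul_comm]
        congr 2
        field_simp

theorem seven_mul_exp_le {L : ℝ} {n : ℕ} (hn : 28 / L ≤ n) (hL : 0 < L) :
    7 * Real.exp (-(L / 2) * n) ≤ Real.exp (-(L / 4) * n) := by
  rw [div_le_iff₀ hL] at hn
  have h7 : (7 : ℝ) ≤ Real.exp (L / 4 * n) := by
    have := Real.add_one_le_exp (L / 4 * n)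
    linarith
  calc 7 * Real.exp (-(L / 2) * n) ≤ Real.exp (L / 4 * n) * Real.exp (-(L / 2) * n) := by gcongr
    _ = _ := by
        rw [← Real.exp_add]
        congr 1
        ring

theorem mainTheorem1 (η : ℝ) (hη : 0 < η) :
    ∃ κ : ℕ, 0 < κ ∧ ∃ σ : ℝ, 0 < σ ∧ ∃ c : ℝ, 0 < c ∧ ∃ n₀ : ℕ, ∀ n : ℕ, n₀ ≤ n →
      -- the protocol continues as soon as the parameter estimation shows more than 80% and 98%
      (∀ a : Announcement (n + κ * n) n, a.zeroTestRounds.Nonempty → a.Balanced η →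
        a.epsEst η < 1 / 5 → a.deltaEst η < 1 / 50 → a.Accepted η) ∧
      -- keys of length at least `σ n` are common and perfectly secret except with probability
      -- `2^(-c n)`, for every adversary limited only by the non-signaling conditions
      (∀ (W Z : Type*) (P : NSBox (n + κ * n) W Z) (D : MinDistDecoder n),
        SecureExcept (protocolRun (s := ⌈σ * n⌉₊) η D P)
          (ENNReal.ofReal ((2 : ℝ) ^ (-(c * n))))) ∧
      -- with unbiased devices better than 80% and 98% the protocol is almost never aborted
      (∀ (W Z : Type*) (P : NSBox (n + κ * n) W Z) (D : MinDistDecoder n) (B : SingleBox) (w : W),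
        P.IsIID B → B.Unbiased → B.chshError + 2 * η ≤ 1 / 5 → B.keyError + 2 * η ≤ 1 / 50 →
        ((protocolRun (s := ⌈σ * n⌉₊) η D P w).map fun o => o.1.isKey) false ≤
          ENNReal.ofReal ((2 : ℝ) ^ (-(c * n)))) ∧
      -- in particular, this holds with singlet states
      (η ≤ 1 / 160 →
        ∀ (W Z : Type*) (P : NSBox (n + κ * n) W Z) (D : MinDistDecoder n) (w : W),
        P.IsIID singletBox →
        ((protocolRun (s := ⌈σ * n⌉₊) η D P w).map fun o => o.1.isKey) false ≤
          ENNReal.ofReal ((2 : ℝ) ^ (-(c * n)))) := by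
  -- `l` is the exponent used in the moment bound for the number of errors in the raw key
  obtain ⟨l₀, hl₀, hlog⟩ := exists_log_deltaEst_le hη
  set l := min (min l₀ 1) (η / 4) with hl
  have hl0 : 0 < l := by positivity
  have hll₀ : l ≤ l₀ := (min_le_left _ _).trans (min_le_left _ _)
  have hl1 : l ≤ 1 := (min_le_left _ _).trans (min_le_right _ _)
  have hlη : l ≤ η / 4 := min_le_right _ _
  -- `θ` lies strictly between `1` and the gain `1 + 2 η / 5` of privacy amplification
  set θ := 1 + η / 5 with hθ
  have hθ0 : 0 < θ := by positivity
  -- `1 / 4 - 1 / (4 θ) = 2 γ`: one `γ` is for the deviation of the number of rounds with input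
  -- `(0,0)` from its mean, the other one for the `n` selected rounds
  set γ := η / (8 * (5 + η)) with hγ
  have hγ0 : 0 < γ := by positivity
  have hγ1 : γ ≤ 1 := by
    rw [hγ, div_le_one (by positivity)]
    linarith
  obtain ⟨κ, hκ⟩ := exists_nat_ge (40 / η + 8 * θ / η + 1 / γ)
  have h40 : 0 < 40 / η := by positivity
  have h8 : 0 < 8 * θ / η := by positivity
  have h1γ : 0 < 1 / γ := by positivity
  have hκ40 : 40 ≤ κ * η := by
    rw [← div_le_iff₀ hη]
    linarith
  have hκ8 : 8 * θ ≤ η * (κ + 1) := by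
    rw [mul_comm η, ← div_le_iff₀ hη]
    linarith
  have hκγ : 1 ≤ κ * γ := by
    rw [← div_le_iff₀ hγ0]
    linarith
  have hκ0 : 0 < κ := by
    rcases Nat.eq_zero_or_pos κ with h | h
    · rw [h] at hκ40
      norm_num at hκ40
    · exact h
  -- the exponent common to all exponentially small error terms
  set ρ := Real.log ((1 + 2 * η / 5) / θ) with hρ
  have hρ0 : 0 < ρ := Real.log_pos (by
    rw [one_lt_div hθ0, hθ]
    linarith)
  set L := min (min ρ (l * η / 4)) (min (γ ^ 2 / 4) ((η / 40) ^ 2 / 4)) with hL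
  have hL0 : 0 < L := by positivity
  have hLρ : L ≤ ρ := (min_le_left _ _).trans (min_le_left _ _)
  have hLl : L ≤ l * η / 4 := (min_le_left _ _).trans (min_le_right _ _)
  have hLγ : L ≤ γ ^ 2 / 4 := (min_le_right _ _).trans (min_le_left _ _)
  have hLη : L ≤ (η / 40) ^ 2 / 4 := (min_le_right _ _).trans (min_le_right _ _)
  have hlog2 : 0 < Real.log 2 := Real.log_pos one_lt_two
  -- the factor `2 ^ s ≈ exp (L n / 2)` uses up half of the exponent, the factor `7` a quarter
  refine ⟨κ, hκ0, L / (2 * Real.log 2), by positivity, L / (4 * Real.log 2), by positivity,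
    ⌈28 / L⌉₊, fun n hn => ?_⟩
  have hnL : 28 / L ≤ n := (Nat.le_ceil _).trans (by exact_mod_cast hn)
  have hn0' : (0 : ℝ) < n := lt_of_lt_of_le (by positivity) hnL
  have hn0 : 0 < n := by exact_mod_cast hn0'
  have hN : ((n + κ * n : ℕ) : ℝ) = n + κ * n := by push_cast; ring
  have hNn : (n : ℝ) ≤ (n + κ * n : ℕ) := by rw [hN]; nlinarith
  have hexp : ∀ (b : ℝ) (m : ℝ), L ≤ b → (n : ℝ) ≤ m → Real.exp (-b * m) ≤ Real.exp (-L * n) := by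
    intro b m hb hm
    refine Real.exp_le_exp.2 ?_
    nlinarith
  have habort : 7 * Real.exp (-((η / 40) ^ 2 / 4) * (n + κ * n : ℕ)) ≤
      (2 : ℝ) ^ (-(L / (4 * Real.log 2) * n)) := by
    rw [two_rpow_neg_mul_eq]
    refine le_trans ?_ (seven_mul_exp_le hnL hL0)
    have h1 := hexp _ _ hLη hNn
    have h2 : Real.exp (-L * n) ≤ Real.exp (-(L / 2) * n) := Real.exp_le_exp.2 (by nlinarith)
    linarith
  refine ⟨fun a => Announcement.accepted_of_lt hη.le, fun W Z P D => ?_,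
    fun W Z P D B w hP hB hε hδ =>
      (protocolRun_abort_le rfl hn0 hη hκ40 P D w hP hB hε hδ).trans
        (ENNReal.ofReal_le_ofReal habort), ?_⟩
  · have hsec := secureExcept_protocolRun (s := ⌈L / (2 * Real.log 2) * n⌉₊) rfl hn0 hη
      (by linarith) hθ0 hκ8 hl0 hl1 hlη (fun a ha => (hlog _ _ a ha).trans (neg_le_neg hll₀))
      hγ0.le hγ1 (by
        have h1 : ((n + κ * n : ℕ) : ℝ) / (4 * θ) = (1 / 4 - 2 * γ) * (n + κ * n : ℕ) := by
          rw [hθ, hγ]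
          field_simp
          ring
        rw [h1, hN]
        nlinarith) P D
    obtain ⟨ext, h1, h2, h3, h4⟩ := hsec
    refine ⟨ext, h1, h2, fun w => (h3 w).trans (ENNReal.ofReal_le_ofReal ?_), h4⟩
    rw [two_rpow_neg_mul_eq]
    refine le_trans ?_ (seven_mul_exp_le hnL hL0)
    have e1 : (θ / (1 + 2 * η / 5)) ^ n ≤ Real.exp (-L * n) := by
      have : θ / (1 + 2 * η / 5) = Real.exp (-ρ) := by
        rw [hρ, ← Real.log_inv, inv_div, Real.exp_log (by positivity)]
      rw [this, ← Real.exp_nat_mul, mul_comm]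
      exact hexp ρ n hLρ le_rfl
    have e2 := hexp _ _ hLl (le_refl (n : ℝ))
    have e3 := hexp _ _ hLγ hNn
    have e4 := two_pow_keyLength_le hL0.le n
    have e5 : Real.exp (L / 2 * n) * Real.exp (-L * n) = Real.exp (-(L / 2) * n) := by
      rw [← Real.exp_add]
      congr 1
      ring
    have e6 : (1 : ℝ) ≤ Real.exp (L / 2 * n) := Real.one_le_exp (by positivity)
    have e7 := Real.exp_pos (-L * n)
    calc _ ≤ 2 * Real.exp (L / 2 * n) * (2 * Real.exp (-L * n)) +
          2 * Real.exp (L / 2 * n) * Real.exp (-L * n) +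
          Real.exp (L / 2 * n) * Real.exp (-L * n) := by
          gcongr
          exact e3.trans (le_mul_of_one_le_left e7.le e6)
      _ = 7 * (Real.exp (L / 2 * n) * Real.exp (-L * n)) := by ring
      _ ≤ _ := by rw [e5]
  · intro hη' W Z P D w hP
    refine (protocolRun_abort_le rfl hn0 hη hκ40 P D w hP singletBox_unbiased ?_ ?_).trans
      (ENNReal.ofReal_le_ofReal habort)
    · rw [singletBox_chshError]
      linarith
    · rw [singletBox_keyError]
      linarith
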